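/- Let $\mathbb T^2=\mathbb R/\mathbb Z\times\mathbb R/\mathbb Z$ with Lebesgue (Haar probability) measure $\lambda$, and let $S_t(x_1,x_2)=(x_1+t,x_2)$ for $t\in\mathbb R/\mathbb Z$. **Theorem B.** For every natural number $r$ there is a $\lambda$-preserving real-analytic diffeomorphism $T$ of $\mathbb T^2$ such that: 1. $T$ is obtained by the approximation by conjugation method. That is, there are integers $p_n$, positive integers $q_n,k_n,l_n$ ($n\ge 0$) with $p_{n+1}=k_nl_nq_np_n+1$ and $q_{n+1}=k_nl_nq_n^2$, and $\lambda$-preserving real-analytic diffeomorphisms $h_n$ of $\mathbb T^2$ with $h_n\circ S_{\alpha_n}=S_{\alpha_n}\circ h_n$, where $\alpha_n=p_n/q_n$ mod $1$, such that, with $H_n=h_0\circ h_1\circ\dots\circ h_n$, the maps $T_n=H_n\circ S_{\alpha_{n+1}}\circ H_n^{-1}$ converge to $T$ in the real-analytic topology: for some $\rho>0$, suitable lifts to $\mathbb R^2$ of all $T_n$ and of $T$ extend holomorphically to $\{z\in\mathbb C^2: |\operatorname{Im} z_1|<\rho,\ |\operatorname{Im} z_2|<\rho\}$ and the extensions converge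 uniformly there, and the same holds for $T_n^{-1}$ and $T^{-1}$. 2. $T$ is minimal: for every $x\in\mathbb T^2$ the forward orbit $\{T^ix: i\ge 0\}$ is dense in $\mathbb T^2$. 3. $\lambda$ is a generic measure for $T$: there is a point $x\in\mathbb T^2$ with $\frac1N\sum_{i=0}^{N-1}\varphi(T^ix)\to\int\varphi\,d\lambda$ for every continuous $\varphi:\mathbb T^2\to\mathbb R$. 4. There are $r$ pairwise distinct $T$-invariant Borel probability measures $\mu_1,\dots,\mu_r$ on $\mathbb T^2$, each absolutely continuous with respect to $\lambda$, such that $T$ is weakly mixing with respect to each $\mu_i$: there is a sequence $(m_n)$ of natural numbers (depending on $i$) such that $|\mu_i(B\cap T^{-m_n}A)-\mu_i(B)\mu_i(A)|\to 0$ for all Borel sets $A,B$. -/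

import Mathlib

open MeasureTheory Filter Topology Set

noncomputable section

/-- The two-torus `ℝ/ℤ × ℝ/ℤ`. Its `volume` is the Lebesgue (Haar probability) measure. -/
abbrev Torus : Type := UnitAddCircle × UnitAddCircle

namespace Torus

/-- The covering projection `ℝ² → ℝ²/ℤ²`. -/
def proj (x : ℝ × ℝ) : Torus := ((x.1 : UnitAddCircle), (x.2 : UnitAddCircle))

/-- A map of the torus is real-analytic if it has a real-analytic lift to `ℝ²`. -/
def IsAnalyticMap (f : Torus → Torus) : Prop :=
  ∃ F : ℝ × ℝ → ℝ × ℝ, AnalyticOnNhd ℝ F univ ∧ ∀ x, proj (F x) = f (proj x)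

/-- Area-preserving real-analytic diffeomorphisms of the torus (real-analytic homeomorphisms
with real-analytic inverse that preserve Lebesgue measure). -/
structure IsAreaPreservingAnalyticDiffeo (T : Torus ≃ₜ Torus) : Prop where
  analytic : IsAnalyticMap T
  analytic_symm : IsAnalyticMap T.symm
  measurePreserving : MeasurePreserving T (volume : Measure Torus) volume

/-- The inclusion `ℝ² → ℂ²`. -/
def toComplex (x : ℝ × ℝ) : ℂ × ℂ := ((x.1 : ℂ), (x.2 : ℂ))

/-- The complex neighbourhood `{|Im z₁| < ρ, |Im z₂| < ρ}` of `ℝ²` in `ℂ²`. -/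
def strip (ρ : ℝ) : Set (ℂ × ℂ) := {z | |z.1.im| < ρ ∧ |z.2.im| < ρ}

/-- `F` is holomorphic on `strip ρ` and restricts on `ℝ²` to a lift of `f`. -/
structure IsHolomorphicLift (ρ : ℝ) (f : Torus → Torus) (F : ℂ × ℂ → ℂ × ℂ) : Prop where
  differentiableOn : DifferentiableOn ℂ F (strip ρ)
  lift : ∀ x : ℝ × ℝ, ∃ y : ℝ × ℝ, F (toComplex x) = toComplex y ∧ proj y = f (proj x)

/-- Convergence `f n → f` uniformly on `strip ρ`, for holomorphic extensions of suitable lifts. -/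
def TendstoOnStrip (ρ : ℝ) (f : ℕ → Torus → Torus) (g : Torus → Torus) : Prop :=
  ∃ (F : ℕ → ℂ × ℂ → ℂ × ℂ) (G : ℂ × ℂ → ℂ × ℂ),
    (∀ n, IsHolomorphicLift ρ (f n) (F n)) ∧ IsHolomorphicLift ρ g G ∧
      TendstoUniformlyOn F G atTop (strip ρ)

/-- Convergence of a sequence in the real-analytic topology on diffeomorphisms of the torus: the
maps and their inverses converge uniformly on some complex strip around `ℝ²`. -/
def TendstoAnalytic (f : ℕ → Torus ≃ₜ Torus) (g : Torus ≃ₜ Torus) : Prop :=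
  ∃ ρ : ℝ, 0 < ρ ∧ TendstoOnStrip ρ (fun n => f n) g ∧
    TendstoOnStrip ρ (fun n => (f n).symm) g.symm

/-- The circle action `S_t (x₁, x₂) = (x₁ + t, x₂)`. -/
def shift (t : UnitAddCircle) : Torus ≃ₜ Torus :=
  (Homeomorph.addRight t).prodCongr (Homeomorph.refl UnitAddCircle)

/-- The composition `h 0 ∘ h 1 ∘ ⋯ ∘ h n` (multiplication of homeomorphisms is composition). -/
def conjugacy (h : ℕ → Torus ≃ₜ Torus) : ℕ → Torus ≃ₜ Torus
  | 0 => h 0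
  | n + 1 => conjugacy h n * h (n + 1)

/-- `T` is obtained by the (real-analytic) approximation by conjugation method: it is the limit,
in the real-analytic topology, of `T n = H n ∘ S_{α (n+1)} ∘ (H n)⁻¹`, where
`H n = h 0 ∘ ⋯ ∘ h n`, every `h n` is an area-preserving real-analytic diffeomorphism commuting
with `S_{α n}`, and `α n = p n / q n` with `p (n+1) = k n * l n * q n * p n + 1` and
`q (n+1) = k n * l n * q n ^ 2`. -/
def IsApproximationByConjugation (T : Torus ≃ₜ Torus) : Prop :=
  ∃ (p : ℕ → ℤ) (q k l : ℕ → ℕ) (α : ℕ → UnitAddCircle) (h : ℕ → Torus ≃ₜ Torus),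
    0 < q 0 ∧ (∀ n, 0 < k n) ∧ (∀ n, 0 < l n) ∧
    (∀ n, p (n + 1) = k n * l n * q n * p n + 1) ∧
    (∀ n, q (n + 1) = k n * l n * q n ^ 2) ∧
    (∀ n, α n = (((p n : ℝ) / (q n : ℝ) : ℝ) : UnitAddCircle)) ∧
    (∀ n, IsAreaPreservingAnalyticDiffeo (h n)) ∧
    (∀ n, h n * shift (α n) = shift (α n) * h n) ∧
    TendstoAnalytic
      (fun n => conjugacy h n * shift (α (n + 1)) * (conjugacy h n)⁻¹) T

end Torus

/-- A map is minimal if every forward orbit is dense. -/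
def IsMinimalMap {X : Type*} [TopologicalSpace X] (T : X → X) : Prop :=
  ∀ x : X, Dense (range fun n : ℕ => T^[n] x)

/-- `x` is a generic point for `μ`: `(1/N) ∑_{i<N} φ (T^i x) → ∫ φ dμ` for every continuous
compactly supported `φ`. -/
def IsBirkhoffGenericPoint {X : Type*} [TopologicalSpace X] [MeasurableSpace X] (T : X → X)
    (μ : Measure X) (x : X) : Prop :=
  ∀ φ : X → ℝ, Continuous φ → HasCompactSupport φ →
    Tendsto (fun N : ℕ => birkhoffAverage ℝ T φ N x) atTop (𝓝 (∫ y, φ y ∂μ))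

/-- A measure is generic if it has a generic point. -/
def IsGenericMeasure {X : Type*} [TopologicalSpace X] [MeasurableSpace X] (T : X → X)
    (μ : Measure X) : Prop :=
  ∃ x : X, IsBirkhoffGenericPoint T μ x

/-- `T` preserves `μ` and is weakly mixing: along some sequence of times, every pair of
measurable sets becomes asymptotically independent. -/
structure IsWeaklyMixing {X : Type*} [MeasurableSpace X] (T : X → X) (μ : Measure X) : Prop where
  measurePreserving : MeasurePreserving T μ μ
  mixing : ∃ m : ℕ → ℕ, ∀ A B : Set X, MeasurableSet A → MeasurableSet B →
    Tendsto (fun n => |μ.real (B ∩ T^[m n] ⁻¹' A) - μ.real B * μ.real A|) atTop (𝓝 0)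

end

/-!
The diffeomorphism is a limit of the periodic maps `H ∘ S_{p/q} ∘ H⁻¹`, where `H` is replaced at every
step by `H ∘ h` for an area-preserving `h` that commutes with `S_{1/q}`, and `p/q` by `p/q + 1/q'` with
`q' = k * q ^ 2`. All maps `h` are products of shears with entire lifts, so `h`, its inverse and
everything built from them extend to `ℂ²`. As `h` commutes with `S_{1/q}`, the new periodic map tends
to the old one, uniformly on the strip `|Im| < 1` and for any fixed number of iterates, when
`k → ∞`. Hence properties of finitely many iterates of the periodic maps, and of their holomorphic
lifts, survive in the limit (`Stage.IsStep`, `Stage.IsAdmissible.exists_step`, `IsChain`), and the limit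
is real-analytic by Osgood's lemma (`TendstoUniformlyOn.analyticOnNhd_complex_prod`).

What remains is the choice of `h` (`exists_design`). Entire shears approximate, in measure, all shears
by bounded measurable functions that are `1/q`-periodic where this is needed. Commutators of such
shears exchange two rows `[i/R, (i+1)/R)` over an arbitrary measurable `1/(2q)`-periodic set of columns
(`isApproximable_exchange`), so `h` may imitate any permutation of rows that depends measurably on the
column (`isApproximable_fiberPerm`). The map to be imitated is designed as follows.

* *Weak mixing.* The torus is divided into `r` annuli. In every annulus the rows are rotated by an
  amount that is zero over the first half of a column period and takes every value equally often over
  the second half, and then a steep horizontal shear is applied (`modelMap`). Translation by `1/(4q)`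
  exchanges the two halves; therefore a point and its translate are mapped almost independently in
  the annulus (`abs_integral_modelMap_sub_le`). For suitable `k`, some iterate of `S_{p'/q'}` is the
  translation by `1/(4q)`.
* *Invariant measures.* `h` almost preserves the annuli. By the Borel–Cantelli lemma their images
  under `H` converge to disjoint sets of measure `1/r`; the normalized restrictions of Lebesgue
  measure to these are the measures sought (`limitMeasure`), and mixing passes to the limit
  (`IsChain.isWeaklyMixing`).
* *Minimality.* A further shear with a thin peak, of small support in measure, drives every horizontal
  circle around the torus vertically, whence every orbit is almost dense
  (`IsApproximable.exists_dense`).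
* *The generic point.* Over a single row, `h` is modified so that a horizontal circle starts at a
  prescribed height, lingers there and then sweeps quickly through all heights (`detourMap`). The
  running averages along the corresponding orbit then change from the ones at the prescribed height,
  which were good by the previous step, to the space averages. That `h` only approximates the
  modified map in measure does no harm if the starting point maximizes `u ↦ ∫₀ᵘ (1_B - ε)` for the
  exceptional set `B`: from there on all running averages of `1_B` are at most `ε`
  (`exists_running_average_le`). The starting points of the successive steps lie in nested balls,
  whose common point is generic (`IsChain.exists_generic`).
-/

noncomputable section

/-! ### Holomorphic functions of two complex variables -/

/-- **Osgood's lemma** in two variables, at a point. The proof applies the one-variable theory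
to Banach-valued functions: `z₁ ↦ f (z₁, ·)` is analytic with values in the continuous functions
on a circle, the Cauchy kernel `z₂ ↦ (· - z₂)⁻¹` is so as well, and `f` is a continuous bilinear
expression in the two. -/
theorem analyticAt_of_separately_differentiable {f : ℂ × ℂ → ℂ} {a b : ℂ} {r : ℝ} (hr : 0 < r)
    (hc : ContinuousOn f (Metric.closedBall a r ×ˢ Metric.closedBall b r))
    (h₁ : ∀ w ∈ Metric.closedBall b r, DifferentiableOn ℂ (fun z => f (z, w)) (Metric.ball a r))
    (h₂ : ∀ z ∈ Metric.ball a r, DifferentiableOn ℂ (fun w => f (z, w)) (Metric.ball b r)) :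
    AnalyticAt ℂ f (a, b) := by
  lift r to NNReal using hr.le
  have hr' : 0 < r := by exact_mod_cast hr
  have hclosed : IsClosed (Metric.closedBall a (r:ℝ) ×ˢ Metric.closedBall b (r:ℝ)) :=
    Metric.isClosed_closedBall.prod Metric.isClosed_closedBall
  obtain ⟨g, hg⟩ := ContinuousMap.exists_restrict_eq hclosed
    ⟨_, continuousOn_iff_continuous_domRestrict.1 hc⟩
  have hgf : ∀ z ∈ Metric.closedBall a (r:ℝ), ∀ w ∈ Metric.closedBall b (r:ℝ),
      g (z, w) = f (z, w) := by
    intro z hz w hw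
    have := DFunLike.congr_fun hg ⟨(z, w), ⟨hz, hw⟩⟩
    simpa using this
  let K := Icc (0:ℝ) (2 * Real.pi)
  let c : C(K, ℂ) := ⟨fun θ => circleMap b r θ, (continuous_circleMap b r).comp continuous_subtype_val⟩
  have hcs : ∀ θ : K, c θ ∈ Metric.sphere b (r:ℝ) := fun θ => circleMap_mem_sphere b r.coe_nonneg θ
  let G : C(ℂ, C(K, ℂ)) := ContinuousMap.curry (g.comp (ContinuousMap.prodMap (ContinuousMap.id ℂ) c))
  have hG : ∀ z θ, G z θ = g (z, c θ) := fun z θ => rfl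
  have hci : CircleIntegrable (fun z => G z) a r := G.continuous.continuousOn.circleIntegrable r.coe_nonneg
  have hA : AnalyticAt ℂ (fun w => (2 * ↑Real.pi * Complex.I)⁻¹ • ∮ (z : ℂ) in C(a, r), (z - w)⁻¹ • G z) a :=
    (hasFPowerSeriesOn_cauchy_integral hci hr').analyticAt
  set A := (fun w => (2 * ↑Real.pi * Complex.I)⁻¹ • ∮ (z : ℂ) in C(a, r), (z - w)⁻¹ • G z) with hAdef
  have hAval : ∀ z ∈ Metric.ball a (r:ℝ), ∀ θ : K, A z θ = f (z, c θ) := by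
    intro z hz θ
    have hw : c θ ∈ Metric.closedBall b (r:ℝ) := Metric.sphere_subset_closedBall (hcs θ)
    have hcz : CircleIntegrable (fun ζ => (ζ - z)⁻¹ • G ζ) a r := by
      apply ContinuousOn.circleIntegrable r.coe_nonneg
      refine ContinuousOn.fun_smul ?_ G.continuous.continuousOn
      refine ContinuousOn.inv₀ (by fun_prop) ?_
      intro ζ hζ h0
      rw [sub_eq_zero] at h0
      rw [h0, Metric.mem_sphere] at hζ
      rw [Metric.mem_ball] at hz
      linarith
    have e1 : A z θ = (2 * ↑Real.pi * Complex.I)⁻¹ • ∮ (ζ : ℂ) in C(a, r), (ζ - z)⁻¹ • f (ζ, c θ) := by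
      have : (∮ (ζ : ℂ) in C(a, r), (ζ - z)⁻¹ • G ζ) θ = ∮ (ζ : ℂ) in C(a, r), (ζ - z)⁻¹ • f (ζ, c θ) := by
        have := (ContinuousMap.evalCLM ℂ (M := ℂ) θ).intervalIntegral_comp_comm hcz.out
        simp only [ContinuousMap.evalCLM_apply] at this
        unfold circleIntegral
        refine Eq.trans this.symm ?_
        apply intervalIntegral.integral_congr
        intro t _
        have ht : circleMap a r t ∈ Metric.closedBall a (r:ℝ) := circleMap_mem_closedBall a r.coe_nonneg t
        simp only [ContinuousMap.smul_apply, hG, hgf _ ht _ hw]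
      rw [hAdef]
      simp only [ContinuousMap.smul_apply, this]
    rw [e1]
    apply Complex.two_pi_I_inv_smul_circleIntegral_sub_inv_smul_of_differentiable_on_off_countable
      (s := ∅) countable_empty hz
    · exact hc.comp (by fun_prop) (fun z hz => ⟨hz, hw⟩)
    · intro x hx
      exact (h₁ _ hw).differentiableAt (Metric.isOpen_ball.mem_nhds hx.1)
  -- the Cauchy kernel in the second variable
  let k : ℂ → C(K, ℂ) := fun w => Ring.inverse (c - algebraMap ℂ C(K, ℂ) w)
  have hunit : ∀ w ∈ Metric.ball b (r:ℝ), IsUnit (c - algebraMap ℂ C(K, ℂ) w) := by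
    intro w hw
    rw [ContinuousMap.isUnit_iff_forall_ne_zero]
    intro θ h0
    have h0 : c θ - w = 0 := by simpa using h0
    rw [sub_eq_zero] at h0
    have := hcs θ
    rw [h0, Metric.mem_sphere] at this
    rw [Metric.mem_ball] at hw
    linarith
  have hk : ∀ w ∈ Metric.ball b (r:ℝ), ∀ θ, k w θ = (c θ - w)⁻¹ := by
    intro w hw θ
    have := Ring.inverse_mul_cancel _ (hunit w hw)
    have := DFunLike.congr_fun this θ
    simp only [ContinuousMap.mul_apply, ContinuousMap.sub_apply, ContinuousMap.one_apply] at this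
    exact eq_inv_of_mul_eq_one_left this
  have hkA : AnalyticAt ℂ k b := by
    obtain ⟨u, hu⟩ := hunit b (Metric.mem_ball_self hr)
    have h1 : AnalyticAt ℂ Ring.inverse (c - algebraMap ℂ C(K, ℂ) b) := hu ▸ analyticAt_inverse u
    have h2 : AnalyticAt ℂ (fun w => c - algebraMap ℂ C(K, ℂ) w) b := by
      apply AnalyticAt.sub analyticAt_const
      exact (Algebra.linearMap ℂ C(K, ℂ)).toContinuousLinearMap.analyticAt b
    exact AnalyticAt.comp (g := Ring.inverse) h1 h2
  -- integration along the circle as a continuous functional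
  let μ : Measure K := Measure.comap Subtype.val volume
  have hμ : IsFiniteMeasure μ := ⟨by
    rw [(MeasurableEmbedding.subtype_coe measurableSet_Icc).comap_apply, image_univ, Subtype.range_coe]
    exact isCompact_Icc.measure_lt_top⟩
  let J : C(K, ℂ) →L[ℂ] ℂ := LinearMap.mkContinuous
    { toFun := fun φ => ∫ θ : K, deriv (circleMap b r) θ * φ θ ∂μ
      map_add' := by
        intro φ ψ
        simp only [ContinuousMap.add_apply, mul_add]
        apply integral_add
        all_goals
          apply Continuous.integrable_of_hasCompactSupport
          · simp only [deriv_circleMap]; fun_prop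
          · exact HasCompactSupport.of_compactSpace _
      map_smul' := by
        intro s φ
        simp only [ContinuousMap.smul_apply, RingHom.id_apply, smul_eq_mul, ← integral_const_mul]
        congr 1; ext θ; ring }
    (r * μ.real univ) (by
      intro φ
      simp only [LinearMap.coe_mk, AddHom.coe_mk]
      refine (norm_integral_le_of_norm_le_const (C := r * ‖φ‖) (Eventually.of_forall fun θ => ?_)).trans
        (le_of_eq (by ring))
      rw [norm_mul, deriv_circleMap, norm_mul, Complex.norm_I, mul_one, norm_circleMap_zero,
        abs_of_nonneg r.coe_nonneg]
      gcongr
      exact φ.norm_coe_le_norm θ)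
  have hJ : ∀ φ, J φ = ∫ θ : K, deriv (circleMap b r) θ * φ θ ∂μ := fun φ => rfl
  have hfin : ∀ z ∈ Metric.ball a (r:ℝ), ∀ w ∈ Metric.ball b (r:ℝ),
      f (z, w) = (2 * ↑Real.pi * Complex.I)⁻¹ • J (k w * A z) := by
    intro z hz w hw
    have hz' := Metric.ball_subset_closedBall hz
    rw [← Complex.two_pi_I_inv_smul_circleIntegral_sub_inv_smul_of_differentiable_on_off_countable
      (f := fun w => f (z, w)) (s := ∅) countable_empty hw
      (hc.comp (by fun_prop) (fun w hw => ⟨hz', hw⟩))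
      (fun x hx => (h₂ _ hz).differentiableAt (Metric.isOpen_ball.mem_nhds hx.1))]
    congr 1
    unfold circleIntegral
    rw [hJ, intervalIntegral.integral_of_le Real.two_pi_pos.le, ← integral_Icc_eq_integral_Ioc,
      ← integral_subtype_comap measurableSet_Icc]
    apply integral_congr_ae
    refine Eventually.of_forall fun θ => ?_
    simp only [smul_eq_mul, ContinuousMap.mul_apply, hk w hw, hAval z hz]
    rfl
  have hfinal : AnalyticAt ℂ (fun x : ℂ × ℂ => (2 * ↑Real.pi * Complex.I)⁻¹ • J (k x.2 * A x.1)) (a, b) := by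
    refine AnalyticAt.fun_const_smul ?_
    refine (J.analyticAt _).fun_comp ?_
    apply AnalyticAt.mul
    · exact AnalyticAt.fun_comp (f := Prod.snd) (g := k) (x := (a, b)) hkA analyticAt_snd
    · exact AnalyticAt.fun_comp (f := Prod.fst) (g := A) (x := (a, b)) hA analyticAt_fst
  refine hfinal.congr ?_
  filter_upwards [(Metric.isOpen_ball.prod Metric.isOpen_ball).mem_nhds
    (show (a, b) ∈ Metric.ball a (r:ℝ) ×ˢ Metric.ball b (r:ℝ) from
      ⟨Metric.mem_ball_self hr, Metric.mem_ball_self hr⟩)] with x hx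
  exact (hfin x.1 hx.1 x.2 hx.2).symm

/-- A uniform limit of holomorphic maps of two variables on an open set is analytic. -/
theorem TendstoUniformlyOn.analyticOnNhd_complex_prod {F : ℕ → ℂ × ℂ → ℂ × ℂ} {G : ℂ × ℂ → ℂ × ℂ}
    {U : Set (ℂ × ℂ)} (hU : IsOpen U) (hF : ∀ n, DifferentiableOn ℂ (F n) U)
    (hlim : TendstoUniformlyOn F G atTop U) : AnalyticOnNhd ℂ G U := by
  have scalar : ∀ (F : ℕ → ℂ × ℂ → ℂ) (G : ℂ × ℂ → ℂ), (∀ n, DifferentiableOn ℂ (F n) U) →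
      TendstoUniformlyOn F G atTop U → AnalyticOnNhd ℂ G U := by
    intro F G hF hlim
    rintro ⟨a, b⟩ hab
    have hGc : ContinuousOn G U :=
      hlim.continuousOn (Frequently.of_forall fun n => (hF n).continuousOn)
    obtain ⟨r, hr, hball⟩ := Metric.nhds_basis_closedBall.mem_iff.1 (hU.mem_nhds hab)
    rw [← closedBall_prod_same] at hball
    refine analyticAt_of_separately_differentiable hr (hGc.mono hball) ?_ ?_
    · intro w hw
      have hsub : ∀ z ∈ Metric.ball a r, (z, w) ∈ U := fun z hz =>
        hball ⟨Metric.ball_subset_closedBall hz, hw⟩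
      have : TendstoUniformlyOn (fun n z => F n (z, w)) (fun z => G (z, w)) atTop (Metric.ball a r) := by
        rw [Metric.tendstoUniformlyOn_iff] at hlim ⊢
        exact fun ε hε => (hlim ε hε).mono fun n hn z hz => hn _ (hsub z hz)
      refine this.tendstoLocallyUniformlyOn.differentiableOn (Eventually.of_forall fun n => ?_)
        Metric.isOpen_ball
      exact (hF n).comp (by fun_prop) hsub
    · intro z hz
      have hsub : ∀ w ∈ Metric.ball b r, (z, w) ∈ U := fun w hw =>
        hball ⟨Metric.ball_subset_closedBall hz, Metric.ball_subset_closedBall hw⟩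
      have : TendstoUniformlyOn (fun n w => F n (z, w)) (fun w => G (z, w)) atTop (Metric.ball b r) := by
        rw [Metric.tendstoUniformlyOn_iff] at hlim ⊢
        exact fun ε hε => (hlim ε hε).mono fun n hn w hw => hn _ (hsub w hw)
      refine this.tendstoLocallyUniformlyOn.differentiableOn (Eventually.of_forall fun n => ?_)
        Metric.isOpen_ball
      exact (hF n).comp (by fun_prop) hsub
  have h1 := scalar (fun n z => (F n z).1) (fun z => (G z).1) (fun n => (hF n).fst)
    (uniformContinuous_fst.comp_tendstoUniformlyOn hlim)
  have h2 := scalar (fun n z => (F n z).2) (fun z => (G z).2) (fun n => (hF n).snd)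
    (uniformContinuous_snd.comp_tendstoUniformlyOn hlim)
  intro z hz
  exact (h1 z hz).prod (h2 z hz)

/-! ### Torus diffeomorphisms with entire lifts -/

namespace Torus

/-- The translations of `ℂ²` that commute with `F`. -/
def translationSubgroup (F : ℂ × ℂ → ℂ × ℂ) : AddSubgroup (ℂ × ℂ) where
  carrier := {c | ∀ z, F (z + c) = F z + c}
  zero_mem' := by simp
  add_mem' := by
    intro a b ha hb z
    rw [← add_assoc, hb, ha, add_assoc]
  neg_mem' := by
    intro a ha z
    have := ha (z + -a)
    rw [neg_add_cancel_right] at this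
    rw [this]; abel

theorem mem_translationSubgroup {F : ℂ × ℂ → ℂ × ℂ} {c : ℂ × ℂ} :
    c ∈ translationSubgroup F ↔ ∀ z, F (z + c) = F z + c := Iff.rfl

/-- `F : ℂ² → ℂ²` is an entire lift of the torus map `h` which commutes with the translations
by `(1/q, 0)` and `(0, 1)`. Since the lift commutes with integer translations, `h` is homotopic
to the identity. -/
structure IsEntireLift (q : ℕ) (h : Torus → Torus) (F : ℂ × ℂ → ℂ × ℂ) : Prop where
  differentiable : Differentiable ℂ F
  fst_mem : ((1 / q : ℂ), (0 : ℂ)) ∈ translationSubgroup F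
  snd_mem : ((0 : ℂ), (1 : ℂ)) ∈ translationSubgroup F
  real : ∀ x : ℝ × ℝ, ∃ y : ℝ × ℝ, F (toComplex x) = toComplex y ∧ proj y = h (proj x)

/-- `h` is an area-preserving homeomorphism of the torus, `F` is an entire lift of `h`, and `F'`
is an entire lift of its inverse which is inverse to `F`; both commute with the translation by
`(1/q, 0)`. -/
structure IsEntireDiffeo (q : ℕ) (h : Torus ≃ₜ Torus) (F F' : ℂ × ℂ → ℂ × ℂ) : Prop where
  lift : IsEntireLift q h F
  lift_symm : IsEntireLift q h.symm F'
  left_inv : ∀ z, F' (F z) = z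
  right_inv : ∀ z, F (F' z) = z
  measurePreserving : MeasurePreserving h (volume : Measure Torus) volume

theorem proj_surjective : Function.Surjective proj := by
  rintro ⟨a, b⟩
  obtain ⟨a, rfl⟩ := QuotientAddGroup.mk_surjective a
  obtain ⟨b, rfl⟩ := QuotientAddGroup.mk_surjective b
  exact ⟨(a, b), rfl⟩

theorem continuous_proj : Continuous proj :=
  ((AddCircle.continuous_mk' 1).comp continuous_fst).prodMk
    ((AddCircle.continuous_mk' 1).comp continuous_snd)

theorem proj_add (x y : ℝ × ℝ) : proj (x + y) = proj x + proj y := rfl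

theorem shift_apply (t : UnitAddCircle) (x : Torus) : shift t x = (x.1 + t, x.2) := rfl

theorem toComplex_add (x y : ℝ × ℝ) : toComplex (x + y) = toComplex x + toComplex y := by
  simp [toComplex]

theorem toComplex_injective : Function.Injective toComplex := by
  rintro ⟨a, b⟩ ⟨c, d⟩ h
  simpa [toComplex] using h

theorem continuous_toComplex : Continuous toComplex :=
  (Complex.continuous_ofReal.comp continuous_fst).prodMk
    (Complex.continuous_ofReal.comp continuous_snd)

/-- The coordinatewise real part `ℂ² → ℝ²`. -/
def rePart : (ℂ × ℂ) →L[ℝ] ℝ × ℝ := Complex.reCLM.prodMap Complex.reCLM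

@[simp] theorem rePart_toComplex (x : ℝ × ℝ) : rePart (toComplex x) = x := by
  simp [rePart, toComplex]

theorem toComplex_mem_strip {ρ : ℝ} (hρ : 0 < ρ) (x : ℝ × ℝ) : toComplex x ∈ strip ρ := by
  simp [strip, toComplex, hρ]

theorem isOpen_strip (ρ : ℝ) : IsOpen (strip ρ) :=
  (isOpen_lt (f := fun z : ℂ × ℂ => |z.1.im|) (by fun_prop) continuous_const).inter
    (isOpen_lt (f := fun z : ℂ × ℂ => |z.2.im|) (by fun_prop) continuous_const)

/-- The real-analytic lift obtained by restricting a holomorphic lift to `ℝ²`. -/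
theorem isAnalyticMap_of_analyticOnNhd {f : Torus → Torus} {F : ℂ × ℂ → ℂ × ℂ} {ρ : ℝ}
    (hρ : 0 < ρ) (hF : AnalyticOnNhd ℂ F (strip ρ))
    (hlift : ∀ x : ℝ × ℝ, ∃ y : ℝ × ℝ, F (toComplex x) = toComplex y ∧ proj y = f (proj x)) :
    IsAnalyticMap f := by
  refine ⟨fun x => rePart (F (toComplex x)), fun x _ => ?_, fun x => ?_⟩
  · refine (rePart.analyticAt _).fun_comp ?_
    have h1 : AnalyticAt ℝ F (toComplex x) := (hF _ (toComplex_mem_strip hρ x)).restrictScalars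
    refine h1.fun_comp ?_
    exact ((Complex.ofRealCLM.prodMap Complex.ofRealCLM).analyticAt x)
  · obtain ⟨y, hy, hy'⟩ := hlift x
    simp only [hy, rePart_toComplex, hy']

namespace IsEntireLift

variable {q : ℕ} {h : Torus → Torus} {F : ℂ × ℂ → ℂ × ℂ}

theorem analyticOnNhd (hF : IsEntireLift q h F) (U : Set (ℂ × ℂ)) (hU : IsOpen U) :
    AnalyticOnNhd ℂ F U :=
  TendstoUniformlyOn.analyticOnNhd_complex_prod (F := fun _ => F) hU
    (fun _ => hF.differentiable.differentiableOn)
    (fun _ hu => Eventually.of_forall fun _ _ _ => refl_mem_uniformity hu)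

theorem isAnalyticMap (hF : IsEntireLift q h F) : IsAnalyticMap h :=
  isAnalyticMap_of_analyticOnNhd one_pos (hF.analyticOnNhd _ (isOpen_strip 1)) hF.real

theorem fst_zsmul (hF : IsEntireLift q h F) (j : ℤ) (z : ℂ × ℂ) :
    F (z + ((j / q : ℂ), 0)) = F z + ((j / q : ℂ), 0) := by
  have := (translationSubgroup F).zsmul_mem hF.fst_mem j
  rw [mem_translationSubgroup] at this
  simpa [div_eq_mul_inv] using this z

theorem int_add (hq : 0 < q) (hF : IsEntireLift q h F) (a b : ℤ) (z : ℂ × ℂ) :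
    F (z + ((a : ℂ), (b : ℂ))) = F z + ((a : ℂ), (b : ℂ)) := by
  have h1 : ((a : ℂ), (0:ℂ)) ∈ translationSubgroup F := by
    have := (translationSubgroup F).zsmul_mem hF.fst_mem (a * q)
    have hq' : (q : ℂ) ≠ 0 := by exact_mod_cast hq.ne'
    simpa [mul_assoc, hq'] using this
  have h2 : ((0 : ℂ), (b:ℂ)) ∈ translationSubgroup F := by
    simpa using (translationSubgroup F).zsmul_mem hF.snd_mem b
  have := (translationSubgroup F).add_mem h1 h2
  rw [mem_translationSubgroup] at this
  simpa using this z

theorem comp {h₂ : Torus → Torus} {F₂ : ℂ × ℂ → ℂ × ℂ} (hF : IsEntireLift q h F)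
    (hF₂ : IsEntireLift q h₂ F₂) : IsEntireLift q (h ∘ h₂) (F ∘ F₂) where
  differentiable := hF.differentiable.comp hF₂.differentiable
  fst_mem z := by
    rw [Function.comp_apply, hF₂.fst_mem z, hF.fst_mem]; rfl
  snd_mem z := by
    rw [Function.comp_apply, hF₂.snd_mem z, hF.snd_mem]; rfl
  real x := by
    obtain ⟨y, hy, hy'⟩ := hF₂.real x
    obtain ⟨w, hw, hw'⟩ := hF.real y
    exact ⟨w, by rw [Function.comp_apply, hy, hw], by rw [hw', hy', Function.comp_apply]⟩

theorem to_one (hq : 0 < q) (hF : IsEntireLift q h F) : IsEntireLift 1 h F where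
  differentiable := hF.differentiable
  fst_mem z := by simpa using hF.int_add hq 1 0 z
  snd_mem := hF.snd_mem
  real := hF.real

theorem apply_shift (hF : IsEntireLift q h F) (j : ℤ) (x : Torus) :
    h (shift ((j / q : ℝ) : UnitAddCircle) x) = shift ((j / q : ℝ) : UnitAddCircle) (h x) := by
  obtain ⟨x, rfl⟩ := proj_surjective x
  obtain ⟨y, hy, hy'⟩ := hF.real x
  obtain ⟨w, hw, hw'⟩ := hF.real (x + ((j / q : ℝ), 0))
  have e : toComplex (x + ((j / q : ℝ), 0)) = toComplex x + ((j / q : ℂ), 0) := by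
    simp [toComplex]
  rw [e, hF.fst_zsmul, hy] at hw
  have : w = y + ((j / q : ℝ), 0) := by
    apply toComplex_injective
    rw [← hw]; simp [toComplex]
  have e1 : ∀ x : ℝ × ℝ, shift ((j / q : ℝ) : UnitAddCircle) (proj x) = proj (x + ((j / q : ℝ), 0)) := by
    intro x
    simp [shift_apply, proj]
  rw [e1, ← hw', this, ← hy', e1]

/-- Modulo `ℤ²`, the points of a closed strip form a bounded set. Hence compactness arguments apply on
strips to lifts that commute with integer translations. -/
theorem exists_reduction (z : ℂ × ℂ) {C : ℝ} (h₁ : |z.1.im| ≤ C) (h₂ : |z.2.im| ≤ C) :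
    ∃ (a b : ℤ) (w : ℂ × ℂ), z = w + ((a : ℂ), (b : ℂ)) ∧ ‖w‖ ≤ 1 + C := by
  have key : ∀ u : ℂ, |u.im| ≤ C → ‖u - (⌊u.re⌋ : ℂ)‖ ≤ 1 + C := by
    intro u hu
    refine (Complex.norm_le_abs_re_add_abs_im _).trans ?_
    have e1 : (u - (⌊u.re⌋ : ℂ)).re = Int.fract u.re := by simp
    have e2 : (u - (⌊u.re⌋ : ℂ)).im = u.im := by simp
    rw [e1, e2, Int.abs_fract]
    exact add_le_add (Int.fract_lt_one _).le hu
  refine ⟨⌊z.1.re⌋, ⌊z.2.re⌋, (z.1 - ⌊z.1.re⌋, z.2 - ⌊z.2.re⌋), by ext <;> simp, ?_⟩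
  rw [Prod.norm_def]
  exact max_le (key _ h₁) (key _ h₂)

theorem exists_im_bound (hq : 0 < q) (hF : IsEntireLift q h F) (C : ℝ) :
    ∃ C', ∀ z : ℂ × ℂ, |z.1.im| ≤ C → |z.2.im| ≤ C → |(F z).1.im| ≤ C' ∧ |(F z).2.im| ≤ C' := by
  obtain ⟨C', hC'⟩ := (isCompact_closedBall (0 : ℂ × ℂ) (1 + C)).exists_bound_of_continuousOn
    hF.differentiable.continuous.continuousOn
  refine ⟨C', fun z h₁ h₂ => ?_⟩
  obtain ⟨a, b, w, rfl, hw⟩ := exists_reduction z h₁ h₂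
  rw [hF.int_add hq]
  have := hC' w (by simpa using hw)
  have h3 := (norm_fst_le (F w)).trans this
  have h4 := (norm_snd_le (F w)).trans this
  constructor
  · simpa using (Complex.abs_im_le_norm (F w).1).trans h3
  · simpa using (Complex.abs_im_le_norm (F w).2).trans h4

theorem exists_uniform_delta (hq : 0 < q) (hF : IsEntireLift q h F) (C : ℝ) {ε : ℝ} (hε : 0 < ε) :
    ∃ δ > 0, ∀ (z : ℂ × ℂ) (s : ℝ), |z.1.im| ≤ C → |z.2.im| ≤ C → |s| ≤ δ →
      ‖F (z + ((s : ℂ), 0)) - F z‖ ≤ ε := by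
  have huc := (isCompact_closedBall (0 : ℂ × ℂ) (2 + C)).uniformContinuousOn_of_continuous
    hF.differentiable.continuous.continuousOn
  rw [Metric.uniformContinuousOn_iff] at huc
  obtain ⟨δ, hδ, H⟩ := huc ε hε
  refine ⟨min (δ / 2) 1, by positivity, fun z s h₁ h₂ hs => ?_⟩
  obtain ⟨a, b, w, rfl, hw⟩ := exists_reduction z h₁ h₂
  rw [add_right_comm, hF.int_add hq, hF.int_add hq, add_sub_add_right_eq_sub]
  have hs' : ‖((s : ℂ), (0 : ℂ))‖ = |s| := by simp [Prod.norm_def]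
  have := H (w + ((s : ℂ), 0)) (by
      rw [mem_closedBall_zero_iff]
      refine (norm_add_le _ _).trans ?_
      rw [hs']
      linarith [min_le_right (δ / 2) 1]) w (by
      rw [mem_closedBall_zero_iff]; linarith) (by
      rw [dist_eq_norm, add_sub_cancel_left, hs']
      linarith [min_le_left (δ / 2) 1])
  rw [dist_eq_norm] at this
  exact this.le

/-- Each vertical circle is mapped onto a curve that meets every horizontal circle, because the
lift has degree one in the vertical direction. -/
theorem exists_snd_eq (hF : IsEntireLift q h F) (x₁ z₂ : UnitAddCircle) :
    ∃ v, (h (x₁, v)).2 = z₂ := by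
  obtain ⟨a, rfl⟩ := QuotientAddGroup.mk_surjective x₁
  obtain ⟨c, rfl⟩ := QuotientAddGroup.mk_surjective z₂
  let ξ : ℝ → ℝ := fun v => (F (toComplex (a, v))).2.re
  have hξc : Continuous ξ := by
    have := hF.differentiable.continuous
    have h2 : Continuous fun v : ℝ => toComplex (a, v) :=
      continuous_toComplex.comp (by fun_prop)
    exact Complex.continuous_re.comp (continuous_snd.comp (this.comp h2))
  have hξ1 : ∀ n : ℤ, ξ n = ξ 0 + n := by
    intro n
    have h2 := (translationSubgroup F).zsmul_mem hF.snd_mem n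
    rw [mem_translationSubgroup] at h2
    have := h2 (toComplex (a, 0))
    have e : toComplex (a, 0) + n • ((0 : ℂ), (1 : ℂ)) = toComplex (a, n) := by
      simp [toComplex]
    rw [e] at this
    simp only [ξ]
    rw [this]; simp
  have hsurj : ∃ v, ξ v = c := by
    have h1 : ξ (⌊c - ξ 0⌋ : ℤ) ≤ c := by
      rw [hξ1]; linarith [Int.floor_le (c - ξ 0)]
    have h2 : c ≤ ξ (⌈c - ξ 0⌉ : ℤ) := by
      rw [hξ1]; linarith [Int.le_ceil (c - ξ 0)]
    exact mem_range_of_exists_le_of_exists_ge hξc ⟨_, h1⟩ ⟨_, h2⟩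
  obtain ⟨v, hv⟩ := hsurj
  refine ⟨(v : UnitAddCircle), ?_⟩
  obtain ⟨y, hy, hy'⟩ := hF.real (a, v)
  have : y.2 = c := by
    rw [← hv]; simp only [ξ]; rw [hy]; rfl
  change (h (proj (a, v))).2 = _
  rw [← hy', ← this]; rfl

end IsEntireLift

namespace IsEntireDiffeo

variable {q : ℕ} {h : Torus ≃ₜ Torus} {F F' : ℂ × ℂ → ℂ × ℂ}

theorem isAreaPreservingAnalyticDiffeo (H : IsEntireDiffeo q h F F') :
    IsAreaPreservingAnalyticDiffeo h :=
  ⟨H.lift.isAnalyticMap, H.lift_symm.isAnalyticMap, H.measurePreserving⟩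

theorem to_one (hq : 0 < q) (H : IsEntireDiffeo q h F F') : IsEntireDiffeo 1 h F F' :=
  ⟨H.lift.to_one hq, H.lift_symm.to_one hq, H.left_inv, H.right_inv, H.measurePreserving⟩

theorem mul {h₂ : Torus ≃ₜ Torus} {F₂ F₂' : ℂ × ℂ → ℂ × ℂ} (H : IsEntireDiffeo q h F F')
    (H₂ : IsEntireDiffeo q h₂ F₂ F₂') : IsEntireDiffeo q (h * h₂) (F ∘ F₂) (F₂' ∘ F') where
  lift := H.lift.comp H₂.lift
  lift_symm := H₂.lift_symm.comp H.lift_symm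
  left_inv z := by simp [H.left_inv, H₂.left_inv]
  right_inv z := by simp [H.right_inv, H₂.right_inv]
  measurePreserving := H.measurePreserving.comp H₂.measurePreserving

theorem one (q : ℕ) : IsEntireDiffeo q 1 id id where
  lift := ⟨differentiable_id, fun _ => rfl, fun _ => rfl, fun x => ⟨x, rfl, rfl⟩⟩
  lift_symm := ⟨differentiable_id, fun _ => rfl, fun _ => rfl, fun x => ⟨x, rfl, rfl⟩⟩
  left_inv _ := rfl
  right_inv _ := rfl
  measurePreserving := MeasurePreserving.id _

end IsEntireDiffeo

/-- `h` is an area-preserving homeomorphism of the torus commuting with `S_{1/q}`, which has an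
entire lift with entire inverse. -/
def IsEntire (q : ℕ) (h : Torus ≃ₜ Torus) : Prop := ∃ F F', IsEntireDiffeo q h F F'

theorem IsEntire.mul {q : ℕ} {h h₂ : Torus ≃ₜ Torus} (H : IsEntire q h) (H₂ : IsEntire q h₂) :
    IsEntire q (h * h₂) := by
  obtain ⟨F, F', hF⟩ := H
  obtain ⟨F₂, F₂', hF₂⟩ := H₂
  exact ⟨_, _, hF.mul hF₂⟩

theorem IsEntire.one (q : ℕ) : IsEntire q 1 := ⟨_, _, IsEntireDiffeo.one q⟩

/-! ### Shears -/

/-- The horizontal shear `(x₁, x₂) ↦ (x₁ + g x₂, x₂)`. -/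
def shearH (g : UnitAddCircle → UnitAddCircle) (x : Torus) : Torus := (x.1 + g x.2, x.2)

/-- The vertical shear `(x₁, x₂) ↦ (x₁, x₂ + f x₁)`. -/
def shearV (f : UnitAddCircle → UnitAddCircle) (x : Torus) : Torus := (x.1, x.2 + f x.1)

theorem measurePreserving_shearH {g : UnitAddCircle → UnitAddCircle} (hg : Measurable g) :
    MeasurePreserving (shearH g) (volume : Measure Torus) volume := by
  have h := MeasurePreserving.skew_product (μa := (volume : Measure UnitAddCircle))
    (μc := (volume : Measure UnitAddCircle)) (μd := (volume : Measure UnitAddCircle))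
    (MeasurePreserving.id (volume : Measure UnitAddCircle))
    (g := fun a c => c + g a) (by
      simp only [Function.uncurry_def]
      exact measurable_snd.add (hg.comp measurable_fst))
    (Eventually.of_forall fun a => (measurePreserving_add_right volume (g a)).map_eq)
  exact (Measure.measurePreserving_swap.comp h).comp Measure.measurePreserving_swap

theorem measurePreserving_shearV {f : UnitAddCircle → UnitAddCircle} (hf : Measurable f) :
    MeasurePreserving (shearV f) (volume : Measure Torus) volume :=
  MeasurePreserving.skew_product (μa := (volume : Measure UnitAddCircle))
    (μc := (volume : Measure UnitAddCircle)) (μd := (volume : Measure UnitAddCircle))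
    (MeasurePreserving.id (volume : Measure UnitAddCircle))
    (g := fun a c => c + f a) (by
      simp only [Function.uncurry_def]
      exact measurable_snd.add (hf.comp measurable_fst))
    (Eventually.of_forall fun a => (measurePreserving_add_right volume (f a)).map_eq)

/-- The shear `shearH g` for continuous `g`, as a homeomorphism. -/
def shearHHomeo (g : C(UnitAddCircle, UnitAddCircle)) : Torus ≃ₜ Torus where
  toFun := shearH g
  invFun := shearH (fun x => -g x)
  left_inv x := by simp [shearH]
  right_inv x := by simp [shearH]
  continuous_toFun := by unfold shearH; fun_prop
  continuous_invFun := by unfold shearH; fun_prop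

/-- The shear `shearV f` for continuous `f`, as a homeomorphism. -/
def shearVHomeo (f : C(UnitAddCircle, UnitAddCircle)) : Torus ≃ₜ Torus where
  toFun := shearV f
  invFun := shearV (fun x => -f x)
  left_inv x := by simp [shearV]
  right_inv x := by simp [shearV]
  continuous_toFun := by unfold shearV; fun_prop
  continuous_invFun := by unfold shearV; fun_prop

/-- `E : ℂ → ℂ` is an entire `1`-periodic extension of the function `g` on the circle. -/
structure IsEntireExtension (g : UnitAddCircle → ℝ) (E : ℂ → ℂ) : Prop where
  differentiable : Differentiable ℂ E
  periodic : ∀ z, E (z + 1) = E z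
  real : ∀ x : ℝ, E x = g x

theorem IsEntireExtension.neg {g : UnitAddCircle → ℝ} {E : ℂ → ℂ} (H : IsEntireExtension g E) :
    IsEntireExtension (fun x => -g x) (fun z => -E z) :=
  ⟨H.differentiable.neg, fun z => by rw [H.periodic], fun x => by rw [H.real]; push_cast; rfl⟩

theorem IsEntireExtension.isEntireLift_shearH {g : UnitAddCircle → ℝ} {E : ℂ → ℂ}
    (H : IsEntireExtension g E) (q : ℕ) :
    IsEntireLift q (shearH fun x => (g x : UnitAddCircle)) (fun z => (z.1 + E z.2, z.2)) where
  differentiable := by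
    have := H.differentiable
    fun_prop
  fst_mem z := by ext <;> simp; ring
  snd_mem z := by ext <;> simp [H.periodic]
  real x := by
    refine ⟨(x.1 + g x.2, x.2), by simp [toComplex, H.real], by simp [proj, shearH]⟩

theorem IsEntireExtension.isEntireLift_shearV {f : UnitAddCircle → ℝ} {E : ℂ → ℂ}
    (H : IsEntireExtension f E) {q : ℕ} (hq : 0 < q) :
    IsEntireLift q (shearV fun x => (f (q • x) : UnitAddCircle))
      (fun z => (z.1, z.2 + E (q * z.1))) where
  differentiable := by
    have := H.differentiable
    fun_prop
  fst_mem z := by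
    have hq' : (q : ℂ) ≠ 0 := by exact_mod_cast hq.ne'
    ext
    · simp
    · simp [mul_add, hq', H.periodic]
  snd_mem z := by ext <;> simp; ring
  real x := by
    refine ⟨(x.1, x.2 + f (q • (x.1 : UnitAddCircle))), ?_, by simp [proj, shearV]⟩
    have := H.real (q * x.1)
    have e : (((q * x.1 : ℝ)) : UnitAddCircle) = q • (x.1 : UnitAddCircle) := by
      rw [← nsmul_eq_mul]; rfl
    rw [e] at this
    simp [toComplex, ← this]

theorem IsEntireExtension.isEntire_shearH {g : C(UnitAddCircle, ℝ)} {E : ℂ → ℂ}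
    (H : IsEntireExtension g E) (q : ℕ) :
    IsEntire q (shearHHomeo ⟨fun x => (g x : UnitAddCircle),
      (AddCircle.continuous_mk' 1).comp g.continuous⟩) := by
  refine ⟨_, fun z => (z.1 + -E z.2, z.2), H.isEntireLift_shearH q, ?_, ?_, ?_,
    measurePreserving_shearH ?_⟩
  · have := H.neg.isEntireLift_shearH q
    convert this using 1
    ext x <;> simp [shearHHomeo, shearH]
    rfl
  · intro z; simp
  · intro z; simp
  · exact ((AddCircle.continuous_mk' 1).comp g.continuous).measurable

theorem IsEntireExtension.isEntire_shearV {f : C(UnitAddCircle, ℝ)} {E : ℂ → ℂ}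
    (H : IsEntireExtension f E) {q : ℕ} (hq : 0 < q) :
    IsEntire q (shearVHomeo ⟨fun x => (f (q • x) : UnitAddCircle),
      (AddCircle.continuous_mk' 1).comp (f.continuous.comp (continuous_nsmul q))⟩) := by
  refine ⟨_, fun z => (z.1, z.2 + -E (q * z.1)), H.isEntireLift_shearV hq, ?_, ?_, ?_,
    measurePreserving_shearV ?_⟩
  · have := H.neg.isEntireLift_shearV hq
    convert this using 1
    ext x <;> simp [shearVHomeo, shearV]
    rfl
  · intro z; simp
  · intro z; simp
  · exact ((AddCircle.continuous_mk' 1).comp (f.continuous.comp (continuous_nsmul q))).measurable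

instance : IsProbabilityMeasure (volume : Measure UnitAddCircle) := ⟨by simp⟩

instance : IsProbabilityMeasure (volume : Measure Torus) := by
  rw [Measure.volume_eq_prod]; infer_instance

/-! ### Approximation in measure by entire diffeomorphisms -/

/-- A measure-preserving map of the torus that is a limit in measure of entire diffeomorphisms
commuting with `S_{1/q}`. -/
structure IsApproximable (q : ℕ) (Φ : Torus → Torus) : Prop where
  measurePreserving : MeasurePreserving Φ (volume : Measure Torus) volume
  exists_near : ∀ ε > 0, ∃ h : Torus ≃ₜ Torus, IsEntire q h ∧
    volume {x | ε < dist (h x) (Φ x)} ≤ ENNReal.ofReal ε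

/-- The first factor is approximated before the second, so that its modulus of continuity is at
hand when the second is. -/
theorem IsApproximable.comp {q : ℕ} {Φ Ψ : Torus → Torus} (hΦ : IsApproximable q Φ)
    (hΨ : IsApproximable q Ψ) : IsApproximable q (Φ ∘ Ψ) := by
  refine ⟨hΦ.measurePreserving.comp hΨ.measurePreserving, fun ε hε => ?_⟩
  obtain ⟨h₁, hh₁, H₁⟩ := hΦ.exists_near (ε / 2) (by positivity)
  have huc := CompactSpace.uniformContinuous_of_continuous h₁.continuous
  rw [Metric.uniformContinuous_iff] at huc
  obtain ⟨δ, hδ, Hδ⟩ := huc (ε / 2) (by positivity)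
  obtain ⟨h₂, hh₂, H₂⟩ := hΨ.exists_near (min (δ / 2) (ε / 2)) (by positivity)
  refine ⟨h₁ * h₂, hh₁.mul hh₂, ?_⟩
  have hsub : {x | ε < dist ((h₁ * h₂) x) ((Φ ∘ Ψ) x)} ⊆
      {x | min (δ / 2) (ε / 2) < dist (h₂ x) (Ψ x)} ∪ Ψ ⁻¹' {x | ε / 2 < dist (h₁ x) (Φ x)} := by
    intro x hx
    by_contra hcon
    simp only [mem_union, mem_ofPred_eq, mem_preimage, not_or, not_lt] at hcon
    have h3 : dist (h₁ (h₂ x)) (h₁ (Ψ x)) < ε / 2 :=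
      Hδ (lt_of_le_of_lt hcon.1 ((min_le_left _ _).trans_lt (by linarith)))
    have h4 := dist_triangle (h₁ (h₂ x)) (h₁ (Ψ x)) (Φ (Ψ x))
    have h5 : ε < dist (h₁ (h₂ x)) (Φ (Ψ x)) := hx
    linarith [hcon.2]
  refine (measure_mono hsub).trans ((measure_union_le _ _).trans ?_)
  have h6 := (hΨ.measurePreserving.measure_preimage_le {x | ε / 2 < dist (h₁ x) (Φ x)}).trans H₁
  refine (add_le_add H₂ h6).trans ?_
  rw [← ENNReal.ofReal_add (by positivity) (by positivity)]
  apply ENNReal.ofReal_le_ofReal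
  linarith [min_le_right (δ / 2) (ε / 2)]

theorem IsApproximable.id (q : ℕ) : IsApproximable q id :=
  ⟨MeasurePreserving.id _, fun ε hε => ⟨1, IsEntire.one q, by simp [hε.not_gt]⟩⟩

/-- The continuous functions on the circle that have an entire extension form an algebra. -/
def entireAlgebra : Subalgebra ℝ C(UnitAddCircle, ℝ) where
  carrier := {g | ∃ E, IsEntireExtension g E}
  mul_mem' := by
    rintro f g ⟨E, hE⟩ ⟨E', hE'⟩
    exact ⟨fun z => E z * E' z, hE.differentiable.mul hE'.differentiable,
      fun z => by rw [hE.periodic, hE'.periodic], fun x => by rw [hE.real, hE'.real]; simp⟩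
  add_mem' := by
    rintro f g ⟨E, hE⟩ ⟨E', hE'⟩
    exact ⟨fun z => E z + E' z, hE.differentiable.add hE'.differentiable,
      fun z => by rw [hE.periodic, hE'.periodic], fun x => by rw [hE.real, hE'.real]; simp⟩
  algebraMap_mem' := by
    intro c
    exact ⟨fun _ => c, differentiable_const _, fun z => rfl, fun x => by simp⟩

/-- The function `cos (2πx)` on the circle. -/
def circleCos : C(UnitAddCircle, ℝ) := ⟨fun x => (fourier 1 x : ℂ).re, by fun_prop⟩

/-- The function `sin (2πx)` on the circle. -/
def circleSin : C(UnitAddCircle, ℝ) := ⟨fun x => (fourier 1 x : ℂ).im, by fun_prop⟩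

theorem fourier_one_coe (x : ℝ) :
    (fourier 1 (x : UnitAddCircle) : ℂ) = Complex.exp ((2 * Real.pi * x : ℝ) * Complex.I) := by
  rw [fourier_coe_apply]; congr 1; push_cast; ring

theorem circleCos_coe (x : ℝ) : circleCos (x : UnitAddCircle) = Real.cos (2 * Real.pi * x) := by
  change (fourier 1 (x : UnitAddCircle) : ℂ).re = _
  rw [fourier_one_coe, Complex.exp_ofReal_mul_I_re]

theorem circleSin_coe (x : ℝ) : circleSin (x : UnitAddCircle) = Real.sin (2 * Real.pi * x) := by
  change (fourier 1 (x : UnitAddCircle) : ℂ).im = _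
  rw [fourier_one_coe, Complex.exp_ofReal_mul_I_im]

theorem isEntireExtension_circleCos :
    IsEntireExtension circleCos (fun z => Complex.cos (2 * Real.pi * z)) where
  differentiable := by fun_prop
  periodic z := by rw [mul_add, mul_one, Complex.cos_add_two_pi]
  real x := by rw [circleCos_coe]; push_cast; rfl

theorem isEntireExtension_circleSin :
    IsEntireExtension circleSin (fun z => Complex.sin (2 * Real.pi * z)) where
  differentiable := by fun_prop
  periodic z := by rw [mul_add, mul_one, Complex.sin_add_two_pi]
  real x := by rw [circleSin_coe]; push_cast; rfl

theorem entireAlgebra_separatesPoints : entireAlgebra.SeparatesPoints := by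
  intro x y hxy
  by_contra hcon
  push Not at hcon
  have h1 := hcon _ ⟨circleCos, ⟨_, isEntireExtension_circleCos⟩, rfl⟩
  have h2 := hcon _ ⟨circleSin, ⟨_, isEntireExtension_circleSin⟩, rfl⟩
  apply hxy
  apply AddCircle.injective_toCircle (one_ne_zero (α := ℝ))
  have h3 : (fourier 1 x : ℂ) = fourier 1 y := Complex.ext h1 h2
  rw [fourier_one, fourier_one] at h3
  exact Circle.ext h3

/-- Bounded measurable functions on the circle are limits in measure of functions with an entire
extension. -/
theorem exists_entire_near {g : UnitAddCircle → ℝ} (hg : Measurable g) {C : ℝ}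
    (hC : ∀ x, |g x| ≤ C) {ε : ℝ} (hε : 0 < ε) :
    ∃ (p : C(UnitAddCircle, ℝ)) (E : ℂ → ℂ), IsEntireExtension p E ∧
      volume {x | ε < |p x - g x|} ≤ ENNReal.ofReal ε := by
  have hint : Integrable g (volume : Measure UnitAddCircle) :=
    Integrable.of_bound hg.aestronglyMeasurable C (Eventually.of_forall hC)
  obtain ⟨f, hf, hfi⟩ := hint.exists_boundedContinuous_integral_sub_le
    (show 0 < ε / 2 * ε by positivity)
  obtain ⟨⟨p, E, hE⟩, hp⟩ := ContinuousMap.exists_mem_subalgebra_near_continuousMap_of_separatesPoints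
    entireAlgebra entireAlgebra_separatesPoints f.toContinuousMap (ε / 2) (by positivity)
  refine ⟨p, E, hE, ?_⟩
  have hsub : {x | ε < |p x - g x|} ⊆ {x | ε / 2 ≤ ‖g x - f x‖} := by
    intro x hx
    have h1 := (ContinuousMap.norm_coe_le_norm (p - f.toContinuousMap) x).trans hp.le
    simp only [ContinuousMap.sub_apply, Real.norm_eq_abs] at h1
    have h2 : |p x - f x| ≤ ε / 2 := h1
    have h3 : ε < |p x - g x| := hx
    have h4 := abs_sub_le (p x) (f x) (g x)
    simp only [mem_ofPred_eq, Real.norm_eq_abs]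
    rw [abs_sub_comm (g x)]
    linarith
  refine (measure_mono hsub).trans ?_
  have hm := mul_meas_ge_le_integral_of_nonneg (μ := (volume : Measure UnitAddCircle))
    (f := fun x => ‖g x - f x‖) (Eventually.of_forall fun x => norm_nonneg _)
    (hint.sub hfi).norm (ε / 2)
  have : volume.real {x | ε / 2 ≤ ‖g x - f x‖} ≤ ε := by
    have h1 := hm.trans hf
    exact le_of_mul_le_mul_left h1 (by positivity)
  rw [← ofReal_measureReal (measure_ne_top _ _)]
  exact ENNReal.ofReal_le_ofReal this

theorem dist_coe_coe_le (a b : ℝ) : dist (a : UnitAddCircle) (b : UnitAddCircle) ≤ |a - b| := by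
  rw [dist_eq_norm, ← AddCircle.coe_sub]
  exact (QuotientAddGroup.norm_mk_le_norm).trans (le_of_eq (Real.norm_eq_abs _))

theorem measurePreserving_nsmul {q : ℕ} (hq : 0 < q) :
    MeasurePreserving (fun x : UnitAddCircle => q • x) volume volume := by
  rcases Nat.lt_or_ge 1 q with h | h
  · exact (AddCircle.ergodic_nsmul h).toMeasurePreserving
  · obtain rfl : q = 1 := by omega
    simp only [one_smul]
    exact MeasurePreserving.id _

/-- Horizontal shears by bounded measurable functions are approximable. -/
theorem isApproximable_shearH {g : UnitAddCircle → ℝ} (hg : Measurable g) {C : ℝ}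
    (hC : ∀ x, |g x| ≤ C) (q : ℕ) : IsApproximable q (shearH fun x => (g x : UnitAddCircle)) := by
  refine ⟨measurePreserving_shearH (AddCircle.measurable_mk'.comp hg), fun ε hε => ?_⟩
  obtain ⟨p, E, hE, hp⟩ := exists_entire_near hg hC hε
  refine ⟨_, hE.isEntire_shearH q, ?_⟩
  refine le_trans (measure_mono (t := univ ×ˢ {x | ε < |p x - g x|}) ?_) ?_
  · rintro ⟨x, y⟩ hx
    refine ⟨mem_univ _, show ε < |p y - g y| from lt_of_lt_of_le hx ?_⟩
    change dist (x + (p y : UnitAddCircle), y) (x + (g y : UnitAddCircle), y) ≤ _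
    rw [Prod.dist_eq]
    simp only [dist_self, dist_add_left]
    exact max_le (dist_coe_coe_le _ _) (abs_nonneg _)
  · rw [Measure.volume_eq_prod, Measure.prod_prod, measure_univ, one_mul]
    exact hp

/-- Vertical shears by bounded measurable `1/q`-periodic functions are approximable. -/
theorem isApproximable_shearV {f : UnitAddCircle → ℝ} (hf : Measurable f) {C : ℝ}
    (hC : ∀ x, |f x| ≤ C) {q : ℕ} (hq : 0 < q) :
    IsApproximable q (shearV fun x => (f (q • x) : UnitAddCircle)) := by
  have hm : Measurable fun x : UnitAddCircle => q • x := (measurePreserving_nsmul hq).measurable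
  refine ⟨measurePreserving_shearV (AddCircle.measurable_mk'.comp (hf.comp hm)), fun ε hε => ?_⟩
  obtain ⟨p, E, hE, hp⟩ := exists_entire_near hf hC hε
  refine ⟨_, hE.isEntire_shearV hq, ?_⟩
  refine le_trans (measure_mono
    (t := ((fun x : UnitAddCircle => q • x) ⁻¹' {x | ε < |p x - f x|}) ×ˢ univ) ?_) ?_
  · rintro ⟨x, y⟩ hx
    refine ⟨show ε < |p (q • x) - f (q • x)| from lt_of_lt_of_le hx ?_, mem_univ _⟩
    change dist (x, y + (p (q • x) : UnitAddCircle)) (x, y + (f (q • x) : UnitAddCircle)) ≤ _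
    rw [Prod.dist_eq]
    simp only [dist_self, dist_add_left]
    exact max_le (abs_nonneg _) (dist_coe_coe_le _ _)
  · rw [Measure.volume_eq_prod, Measure.prod_prod, measure_univ, mul_one]
    exact ((measurePreserving_nsmul hq).measure_preimage_le _).trans hp

/-! ### Permutations of horizontal rows -/

/-- The representative in `[0, 1)` of a point of the circle. -/
def fr (x : UnitAddCircle) : ℝ := AddCircle.equivIco 1 0 x

theorem fr_nonneg (x : UnitAddCircle) : 0 ≤ fr x := (AddCircle.equivIco 1 0 x).2.1

theorem fr_lt_one (x : UnitAddCircle) : fr x < 1 := by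
  exact lt_of_lt_of_eq (AddCircle.equivIco 1 0 x).2.2 (zero_add 1)

theorem coe_fr (x : UnitAddCircle) : (fr x : UnitAddCircle) = x := AddCircle.coe_equivIco

theorem fr_coe (a : ℝ) : fr (a : UnitAddCircle) = Int.fract a := by
  simp [fr]

theorem measurable_fr : Measurable fr :=
  measurable_subtype_coe.comp (AddCircle.measurableEquivIco 1 0).measurable

theorem fr_add_coe {x : UnitAddCircle} {a : ℝ} (h₀ : 0 ≤ fr x + a) (h₁ : fr x + a < 1) :
    fr (x + a) = fr x + a := by
  conv_lhs => rw [← coe_fr x, ← AddCircle.coe_add, fr_coe]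
  exact Int.fract_eq_self.2 ⟨h₀, h₁⟩

/-- The involution of the circle exchanging `E - s` and `E` by translation. -/
def exchange (E : Set UnitAddCircle) (s : UnitAddCircle) (v : UnitAddCircle) : UnitAddCircle :=
  open scoped Classical in if v ∈ E then v - s else if v + s ∈ E then v + s else v

/-- Exchanging two rows over a set of columns, where the set of columns is invariant under
translation by `1/(2q)`: the resulting map is a composition of shears. It is a product of two
commutators of a horizontal with a vertical shear, each of which permutes three blocks
cyclically. -/
theorem isApproximable_exchange {q : ℕ} (hq : 0 < q) {D E : Set UnitAddCircle}
    (hD : MeasurableSet D) (hE : MeasurableSet E) (s : ℝ)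
    (hdisj : ∀ v ∈ E, v + (s : UnitAddCircle) ∉ E) :
    IsApproximable q (fun x : Torus =>
      open scoped Classical in
      (x.1, if (2 * q) • x.1 ∈ D then exchange E s x.2 else x.2)) := by
  classical
  let P : Set UnitAddCircle := {y | fr y < 1 / 2}
  have hP : MeasurableSet P := measurableSet_lt measurable_fr measurable_const
  let D₀ : Set UnitAddCircle := {y | 2 • y ∈ D}
  have hD₀ : MeasurableSet D₀ := (measurePreserving_nsmul two_pos).measurable hD
  let c : ℝ := 1 / (2 * q)
  have hq' : (q : ℝ) ≠ 0 := by exact_mod_cast hq.ne'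
  have hc : q • (c : UnitAddCircle) = ((1 / 2 : ℝ) : UnitAddCircle) := by
    rw [← AddCircle.coe_nsmul]; congr 1; simp only [nsmul_eq_mul, c]; field_simp
  have hPs : ∀ y : UnitAddCircle, y + ((1 / 2 : ℝ) : UnitAddCircle) ∈ P ↔ y ∉ P := by
    intro y
    have h0 := fr_nonneg y
    have h1 := fr_lt_one y
    rcases lt_or_ge (fr y) (1 / 2) with h | h
    · have : fr (y + ((1 / 2 : ℝ) : UnitAddCircle)) = fr y + 1 / 2 :=
        fr_add_coe (by linarith) (by linarith)
      simp only [P, mem_ofPred_eq, this]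
      constructor <;> intro <;> linarith
    · have e : y + ((1 / 2 : ℝ) : UnitAddCircle) = y + ((-1 / 2 : ℝ) : UnitAddCircle) := by
        have : ((1 / 2 : ℝ) : UnitAddCircle) = ((-1 / 2 : ℝ) : UnitAddCircle) + ((1 : ℝ) : UnitAddCircle) := by
          rw [← AddCircle.coe_add]; norm_num
        rw [this, AddCircle.coe_period, add_zero]
      have : fr (y + ((-1 / 2 : ℝ) : UnitAddCircle)) = fr y + -1 / 2 :=
        fr_add_coe (by linarith) (by linarith)
      rw [e]
      simp only [P, mem_ofPred_eq, this]
      constructor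
      · intro _; linarith
      · intro _; linarith
  have hPm : ∀ y : UnitAddCircle, y - ((1 / 2 : ℝ) : UnitAddCircle) ∈ P ↔ y ∉ P := by
    intro y
    have := hPs (y - ((1 / 2 : ℝ) : UnitAddCircle))
    rw [sub_add_cancel] at this
    tauto
  have hh : (2 : ℕ) • ((1 / 2 : ℝ) : UnitAddCircle) = 0 := by
    rw [← AddCircle.coe_nsmul]
    have : (2 : ℕ) • (1 / 2 : ℝ) = 1 := by norm_num
    rw [this, AddCircle.coe_period]
  have hDs : ∀ y : UnitAddCircle, y + ((1 / 2 : ℝ) : UnitAddCircle) ∈ D₀ ↔ y ∈ D₀ := by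
    intro y; simp only [D₀, mem_ofPred_eq, smul_add, hh, add_zero]
  have hDm : ∀ y : UnitAddCircle, y - ((1 / 2 : ℝ) : UnitAddCircle) ∈ D₀ ↔ y ∈ D₀ := by
    intro y; simp only [D₀, mem_ofPred_eq, smul_sub, hh, sub_zero]
  let g : UnitAddCircle → ℝ := fun v => if v ∈ E then c else 0
  let g' : UnitAddCircle → ℝ := fun v => if v ∈ E then -c else 0
  let f₁ : UnitAddCircle → ℝ := fun y => if y ∈ D₀ then (if y ∈ P then 0 else s) else 0
  let f₂ : UnitAddCircle → ℝ := fun y => if y ∈ D₀ then (if y ∈ P then s else -s) else 0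
  let f₃ : UnitAddCircle → ℝ := fun y => if y ∈ D₀ then (if y ∈ P then -s else 0) else 0
  have hg : Measurable g := Measurable.ite hE measurable_const measurable_const
  have hg' : Measurable g' := Measurable.ite hE measurable_const measurable_const
  have hf : ∀ a b : ℝ, Measurable fun y => if y ∈ D₀ then (if y ∈ P then a else b) else (0 : ℝ) :=
    fun a b => Measurable.ite hD₀ (Measurable.ite hP measurable_const measurable_const)
      measurable_const
  have hgb : ∀ v, |g v| ≤ |c| := by intro v; simp only [g]; split_ifs <;> simp
  have hgb' : ∀ v, |g' v| ≤ |c| := by intro v; simp only [g']; split_ifs <;> simp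
  have hfb₁ : ∀ y, |f₁ y| ≤ |s| := by intro y; simp only [f₁]; split_ifs <;> simp
  have hfb₂ : ∀ y, |f₂ y| ≤ |s| := by intro y; simp only [f₂]; split_ifs <;> simp
  have hfb₃ : ∀ y, |f₃ y| ≤ |s| := by intro y; simp only [f₃]; split_ifs <;> simp
  have main := (isApproximable_shearH hg' hgb' q).comp <|
    (isApproximable_shearV (hf (-s) 0) hfb₃ hq).comp <|
    (isApproximable_shearH hg hgb q).comp <|
    (isApproximable_shearV (hf s (-s)) hfb₂ hq).comp <|
    (isApproximable_shearH hg hgb q).comp <|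
    (isApproximable_shearV (hf 0 s) hfb₁ hq).comp (isApproximable_shearH hg' hgb' q)
  convert main using 1
  funext x
  obtain ⟨x, v⟩ := x
  have e2 : (2 * q) • x ∈ D ↔ q • x ∈ D₀ := by
    simp only [D₀, mem_ofPred_eq, mul_smul]
  have hs : ((-s : ℝ) : UnitAddCircle) = -(s : UnitAddCircle) := AddCircle.coe_neg _
  have hcn : ((-c : ℝ) : UnitAddCircle) = -(c : UnitAddCircle) := AddCircle.coe_neg _
  have h1 : v ∈ E → v + (s : UnitAddCircle) ∉ E := hdisj v
  have h2 : v ∈ E → v + -(s : UnitAddCircle) ∉ E := by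
    intro hv hcon
    have := hdisj _ hcon
    simp [hv] at this
  have h3 : v + (s : UnitAddCircle) ∈ E → v + (s : UnitAddCircle) + (s : UnitAddCircle) ∉ E := hdisj _
  have e4 : q • (x + (c : UnitAddCircle)) = q • x + ((1 / 2 : ℝ) : UnitAddCircle) := by
    rw [smul_add, hc]
  have e5 : q • (x + -(c : UnitAddCircle)) = q • x - ((1 / 2 : ℝ) : UnitAddCircle) := by
    rw [smul_add, smul_neg, hc, sub_eq_add_neg]
  simp only [Function.comp, shearH, shearV, g, g', exchange, e2]
  by_cases hy : q • x ∈ D₀ <;> by_cases hp : q • x ∈ P <;> by_cases hv : v ∈ E <;>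
    by_cases hvs : v + (s : UnitAddCircle) ∈ E <;>
    simp_all [sub_eq_add_neg]

/-- The index in `{0, …, R - 1}` of the row `[i/R, (i+1)/R)` containing a point of the circle. -/
def row (R : ℕ) [NeZero R] (x : UnitAddCircle) : Fin R :=
  ⟨⌊R * fr x⌋₊, by
    have hR : (0 : ℝ) < R := by exact_mod_cast Nat.pos_of_ne_zero (NeZero.ne R)
    rw [Nat.floor_lt (mul_nonneg hR.le (fr_nonneg x))]
    exact mul_lt_of_lt_one_right hR (fr_lt_one x)⟩

theorem row_eq_iff {R : ℕ} [NeZero R] {x : UnitAddCircle} {a : Fin R} :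
    row R x = a ↔ (a : ℝ) ≤ R * fr x ∧ R * fr x < a + 1 := by
  have hR : (0 : ℝ) < R := by exact_mod_cast Nat.pos_of_ne_zero (NeZero.ne R)
  rw [row, Fin.ext_iff, Nat.floor_eq_iff (mul_nonneg hR.le (fr_nonneg x))]

theorem measurableSet_row {R : ℕ} [NeZero R] (a : Fin R) :
    MeasurableSet {x : UnitAddCircle | row R x = a} := by
  simp only [row_eq_iff]
  exact (measurableSet_le measurable_const (measurable_fr.const_mul _)).inter
    (measurableSet_lt (measurable_fr.const_mul _) measurable_const)

theorem measurable_row (R : ℕ) [NeZero R] : Measurable (row R) :=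
  measurable_to_countable' measurableSet_row

/-- The map of the circle permuting the rows `[i/R, (i+1)/R)` by translations. -/
def permRow {R : ℕ} [NeZero R] (σ : Equiv.Perm (Fin R)) (x : UnitAddCircle) : UnitAddCircle :=
  x + ((((σ (row R x) : ℕ) - (row R x : ℕ)) / R : ℝ) : UnitAddCircle)

/-- Translating a point of the row `row R x` by the difference of two row indices does not wrap around
the circle. -/
theorem fr_add_row {R : ℕ} [NeZero R] (x : UnitAddCircle) (b : Fin R) :
    fr (x + ((((b : ℕ) - (row R x : ℕ)) / R : ℝ) : UnitAddCircle)) =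
      fr x + ((b : ℕ) - (row R x : ℕ)) / R := by
  have hR : (0 : ℝ) < R := by exact_mod_cast Nat.pos_of_ne_zero (NeZero.ne R)
  obtain ⟨h1, h2⟩ := row_eq_iff.1 (rfl : row R x = row R x)
  have hb : ((b : ℕ) : ℝ) + 1 ≤ R := by exact_mod_cast b.2
  have e : fr x + ((b : ℕ) - (row R x : ℕ)) / R = (R * fr x + (b : ℕ) - (row R x : ℕ)) / R := by
    field_simp; ring
  apply fr_add_coe
  · rw [e]; apply div_nonneg _ hR.le
    have : (0 : ℝ) ≤ (b : ℕ) := Nat.cast_nonneg _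
    linarith
  · rw [e, div_lt_one hR]; linarith

theorem fr_permRow {R : ℕ} [NeZero R] (σ : Equiv.Perm (Fin R)) (x : UnitAddCircle) :
    fr (permRow σ x) = fr x + ((σ (row R x) : ℕ) - (row R x : ℕ)) / R :=
  fr_add_row x _

theorem row_permRow {R : ℕ} [NeZero R] (σ : Equiv.Perm (Fin R)) (x : UnitAddCircle) :
    row R (permRow σ x) = σ (row R x) := by
  have hR : (0 : ℝ) < R := by exact_mod_cast Nat.pos_of_ne_zero (NeZero.ne R)
  obtain ⟨h1, h2⟩ := row_eq_iff.1 (rfl : row R x = row R x)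
  have e : R * (fr x + ((σ (row R x) : ℕ) - (row R x : ℕ)) / R) =
      R * fr x + (σ (row R x) : ℕ) - (row R x : ℕ) := by
    field_simp; ring
  rw [row_eq_iff, fr_permRow, e]
  constructor <;> linarith

@[simp] theorem permRow_one {R : ℕ} [NeZero R] (x : UnitAddCircle) :
    permRow (1 : Equiv.Perm (Fin R)) x = x := by
  simp [permRow]

theorem permRow_mul {R : ℕ} [NeZero R] (σ τ : Equiv.Perm (Fin R)) (x : UnitAddCircle) :
    permRow (σ * τ) x = permRow σ (permRow τ x) := by
  conv_rhs => rw [permRow, row_permRow]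
  rw [permRow, permRow, add_assoc, ← AddCircle.coe_add, Equiv.Perm.mul_apply]
  congr 2
  ring

theorem row_add_eq_iff {R : ℕ} [NeZero R] (a b : Fin R) (x : UnitAddCircle) :
    row R (x + ((((b : ℕ) - (a : ℕ)) / R : ℝ) : UnitAddCircle)) = b ↔ row R x = a := by
  constructor
  · intro h
    have h3 := row_permRow (Equiv.swap b a) (x + ((((b : ℕ) - (a : ℕ)) / R : ℝ) : UnitAddCircle))
    rw [permRow, h, Equiv.swap_apply_left, add_assoc, ← AddCircle.coe_add] at h3
    have e : ((b : ℕ) - (a : ℕ) : ℝ) / R + ((a : ℕ) - (b : ℕ)) / R = 0 := by ring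
    rw [e] at h3
    simpa using h3
  · intro h
    have h3 := row_permRow (Equiv.swap a b) x
    rwa [permRow, h, Equiv.swap_apply_left] at h3

/-- The fibrewise row permutation: over `x₁` the rows are permuted by `π (2q x₁)`. -/
def fiberPerm (q : ℕ) {R : ℕ} [NeZero R] (π : UnitAddCircle → Equiv.Perm (Fin R)) (x : Torus) :
    Torus :=
  (x.1, permRow (π ((2 * q) • x.1)) x.2)

theorem fiberPerm_mul (q : ℕ) {R : ℕ} [NeZero R] (π π' : UnitAddCircle → Equiv.Perm (Fin R)) :
    fiberPerm q (π * π') = fiberPerm q π ∘ fiberPerm q π' := by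
  funext x
  simp [fiberPerm, permRow_mul]

theorem fiberPerm_one (q : ℕ) {R : ℕ} [NeZero R] :
    fiberPerm q (1 : UnitAddCircle → Equiv.Perm (Fin R)) = id := by
  funext x
  simp [fiberPerm]

/-- A transposition of rows is the exchange of two translated arcs. -/
theorem permRow_swap {R : ℕ} [NeZero R] {a b : Fin R} (x : UnitAddCircle) :
    permRow (Equiv.swap a b) x =
      exchange {x | row R x = b} ((((b : ℕ) - (a : ℕ)) / R : ℝ) : UnitAddCircle) x := by
  classical
  have key := row_add_eq_iff a b x
  unfold exchange
  simp only [mem_ofPred_eq, key]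
  by_cases hb : row R x = b
  · rw [if_pos hb, permRow, hb, Equiv.swap_apply_right, sub_eq_add_neg x, ← AddCircle.coe_neg]
    congr 2; ring
  · rw [if_neg hb]
    by_cases ha : row R x = a
    · rw [if_pos ha, permRow, ha, Equiv.swap_apply_left]
    · rw [if_neg ha, permRow, Equiv.swap_apply_of_ne_of_ne ha hb]; simp

/-- Row permutations over a set of columns are products of exchanges of two rows. -/
theorem isApproximable_fiberPerm_const {q : ℕ} (hq : 0 < q) {R : ℕ} [NeZero R]
    {D : Set UnitAddCircle} (hD : MeasurableSet D) (σ : Equiv.Perm (Fin R)) :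
    IsApproximable q (fiberPerm q (open scoped Classical in fun v => if v ∈ D then σ else 1)) := by
  classical
  induction σ using Equiv.Perm.swap_induction_on with
  | one =>
    convert IsApproximable.id q
    convert fiberPerm_one q (R := R) using 2
    funext v; simp
  | swap_mul σ a b hab ih =>
    have h1 : IsApproximable q (fiberPerm q fun v => if v ∈ D then Equiv.swap a b else 1) := by
      have := isApproximable_exchange hq hD (measurableSet_row b)
        ((((b : ℕ) - (a : ℕ)) / R : ℝ)) (by
          intro v hv hcon
          exact hab (((row_add_eq_iff a b v).1 hcon).symm.trans hv))
      convert this using 2 with x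
      simp only [fiberPerm]
      split_ifs with hx
      · rw [permRow_swap]
      · rw [permRow_one]
    convert h1.comp ih using 1
    rw [← fiberPerm_mul]
    congr 1
    funext v
    simp only [Pi.mul_apply]
    split_ifs <;> simp

/-- Fibrewise row permutations are approximable. -/
theorem isApproximable_fiberPerm {q : ℕ} (hq : 0 < q) {R : ℕ} [NeZero R]
    {π : UnitAddCircle → Equiv.Perm (Fin R)} (hπ : ∀ σ, MeasurableSet {v | π v = σ}) :
    IsApproximable q (fiberPerm q π) := by
  classical
  have key : ∀ S : Finset (Equiv.Perm (Fin R)),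
      IsApproximable q (fiberPerm q fun v => if π v ∈ S then π v else 1) := by
    intro S
    induction S using Finset.induction_on with
    | empty =>
      convert IsApproximable.id q
      convert fiberPerm_one q (R := R) using 2
      funext v; simp
    | insert σ S hσ ih =>
      convert (isApproximable_fiberPerm_const hq (hπ σ) σ).comp ih using 1
      rw [← fiberPerm_mul]
      congr 1
      funext v
      simp only [Pi.mul_apply, Finset.mem_insert, mem_ofPred_eq]
      by_cases h : π v = σ
      · simp [h, hσ]
      · simp [h]
  simpa using key Finset.univ

/-! ### Approximation with dense images of horizontal circles -/

/-- The trigonometric polynomial `2 cos²ᴺ(πx)`, a peak of height `2` at the origin. -/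
def peak (N : ℕ) : C(UnitAddCircle, ℝ) :=
  (2 : ℝ) • ((1 / 2 : ℝ) • (1 + circleCos)) ^ N

theorem peak_mem (N : ℕ) : peak N ∈ entireAlgebra :=
  entireAlgebra.smul_mem (entireAlgebra.pow_mem (entireAlgebra.smul_mem
    (entireAlgebra.add_mem entireAlgebra.one_mem ⟨_, isEntireExtension_circleCos⟩) _) N) _

theorem peak_coe (N : ℕ) (s : ℝ) :
    peak N (s : UnitAddCircle) = 2 * ((1 + Real.cos (2 * Real.pi * s)) / 2) ^ N := by
  simp only [peak, ContinuousMap.smul_apply, ContinuousMap.pow_apply, ContinuousMap.add_apply,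
    ContinuousMap.one_apply, circleCos_coe, smul_eq_mul]
  congr 2; ring

theorem base_nonneg (s : ℝ) : 0 ≤ (1 + Real.cos (2 * Real.pi * s)) / 2 := by
  linarith [Real.neg_one_le_cos (2 * Real.pi * s)]

theorem base_lt_one {s : ℝ} (h₀ : 0 < s) (h₁ : s < 1) :
    (1 + Real.cos (2 * Real.pi * s)) / 2 < 1 := by
  have hpi := Real.pi_pos
  have : Real.cos (2 * Real.pi * s) ≠ 1 := by
    intro h
    have := (Real.cos_eq_one_iff_of_lt_of_lt (x := 2 * Real.pi * s - 2 * Real.pi * round s)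
      (by
        have := abs_sub_round s
        rw [abs_le] at this
        nlinarith) (by
        have := abs_sub_round s
        rw [abs_le] at this
        nlinarith)).1 (by
          rw [← h, mul_comm (2 * Real.pi) (round s : ℝ)]
          exact Real.cos_sub_int_mul_two_pi _ _)
    have hs : s = round s := by
      have h2 : 2 * Real.pi * (s - round s) = 0 := by linarith
      have h3 := (mul_eq_zero.1 h2).resolve_left (by positivity)
      linarith
    rw [hs] at h₀ h₁
    have h4 : 0 < round s := by exact_mod_cast h₀
    have h5 : round s < 1 := by exact_mod_cast h₁
    omega
  have h2 := lt_of_le_of_ne (Real.cos_le_one _) this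
  linarith

/-- Away from the origin the peaks tend to zero. -/
theorem tendsto_peak (y : UnitAddCircle) (hy : y ≠ 0) :
    Tendsto (fun N => peak N y) atTop (𝓝 0) := by
  have h0 : 0 < fr y := by
    rcases (fr_nonneg y).eq_or_lt with h | h
    · exfalso; apply hy; rw [← coe_fr y, ← h]; rfl
    · exact h
  have := (tendsto_pow_atTop_nhds_zero_of_lt_one (base_nonneg _)
    (base_lt_one h0 (fr_lt_one y))).const_mul 2
  rw [mul_zero] at this
  refine this.congr fun N => ?_
  rw [← peak_coe, coe_fr]

theorem exists_peak_small {δ : ℝ} (hδ : 0 < δ) :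
    ∀ᶠ N in atTop, volume {y : UnitAddCircle | δ < |peak N y|} ≤ ENNReal.ofReal δ := by
  have h1 : TendstoInMeasure (volume : Measure UnitAddCircle) (fun N y => peak N y) atTop
      (fun _ => (0 : ℝ)) := by
    apply tendstoInMeasure_of_tendsto_ae
    · intro N; exact (peak N).continuous.aestronglyMeasurable
    · have : ∀ᵐ y : UnitAddCircle, y ≠ 0 := by
        rw [ae_iff]
        have := AddCircle.volume_closedBall (T := 1) (x := 0) 0
        simpa using this
      filter_upwards [this] with y hy using tendsto_peak y hy
  rw [tendstoInMeasure_iff_norm] at h1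
  have h2 := (h1 δ hδ).eventually (gt_mem_nhds (ENNReal.ofReal_pos.2 hδ))
  filter_upwards [h2] with N hN
  refine (measure_mono ?_).trans hN.le
  intro y hy
  have hy : δ < |peak N y| := hy
  change δ ≤ ‖peak N y - 0‖
  rw [sub_zero, Real.norm_eq_abs]; exact hy.le

theorem exists_int_div_near {q : ℕ} (hq : 0 < q) (a b : UnitAddCircle) :
    ∃ j : ℤ, dist (a + ((j / q : ℝ) : UnitAddCircle)) b ≤ 1 / q := by
  have hq' : (0 : ℝ) < q := by exact_mod_cast hq
  refine ⟨⌊q * fr (b - a)⌋, ?_⟩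
  have hb : b = a + (fr (b - a) : UnitAddCircle) := by rw [coe_fr]; abel
  conv_lhs => rw [hb]
  rw [dist_add_left]
  rw [← hb]
  refine (dist_coe_coe_le _ _).trans ?_
  have h1 := Int.floor_le (q * fr (b - a))
  have h2 := Int.lt_floor_add_one (q * fr (b - a))
  have e : (⌊q * fr (b - a)⌋ : ℝ) / q - fr (b - a) = (⌊q * fr (b - a)⌋ - q * fr (b - a)) / q := by
    field_simp
  rw [e, abs_div, abs_of_pos hq']
  gcongr
  rw [abs_le]; constructor <;> linarith

/-- An approximable map can be approximated in measure by entire diffeomorphisms that map every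
horizontal circle onto an almost dense curve: a shear with a thin peak drives each horizontal
circle around a vertical circle. -/
theorem IsApproximable.exists_dense {q : ℕ} (hq : 0 < q) {Φ : Torus → Torus}
    (hΦ : IsApproximable q Φ) {ε : ℝ} (hε : 0 < ε) :
    ∃ h : Torus ≃ₜ Torus, IsEntire q h ∧ volume {x | ε < dist (h x) (Φ x)} ≤ ENNReal.ofReal ε ∧
      ∀ (x₂ : UnitAddCircle) (z : Torus), ∃ x₁, dist (h (x₁, x₂)) z ≤ ε + 1 / q := by
  obtain ⟨h', hh', H⟩ := hΦ.exists_near (ε / 2) (by positivity)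
  have huc := CompactSpace.uniformContinuous_of_continuous h'.continuous
  rw [Metric.uniformContinuous_iff] at huc
  obtain ⟨η, hη, Hη⟩ := huc (ε / 2) (by positivity)
  let s₀ := min (η / 2) (1 / 2)
  have hs₀ : 0 < s₀ := by positivity
  have hs₁ : s₀ < 1 := (min_le_right _ _).trans_lt (by norm_num)
  have hev := (((tendsto_pow_atTop_nhds_zero_of_lt_one (base_nonneg _)
    (base_lt_one hs₀ hs₁)).const_mul 2).eventually (gt_mem_nhds (show (2 * 0 : ℝ) < 1 by norm_num)))
  obtain ⟨N, hN1, hN2⟩ := (hev.and (exists_peak_small (δ := min (η / 2) (ε / 2)) (by positivity))).exists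
  obtain ⟨E, hE⟩ := peak_mem N
  obtain hB := hE.isEntire_shearV hq
  set B := shearVHomeo ⟨fun x => (peak N (q • x) : UnitAddCircle),
      (AddCircle.continuous_mk' 1).comp ((peak N).continuous.comp (continuous_nsmul q))⟩ with hBdef
  have hBa : ∀ x : Torus, B x = (x.1, x.2 + (peak N (q • x.1) : UnitAddCircle)) := fun x => rfl
  have hBmp : MeasurePreserving B (volume : Measure Torus) volume := by
    obtain ⟨_, _, h⟩ := hB; exact h.measurePreserving
  have hent := hh'.mul hB
  refine ⟨h' * B, hent, ?_, ?_⟩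
  · have hsub : {x | ε < dist ((h' * B) x) (Φ x)} ⊆ {x | ε / 2 < dist (h' x) (Φ x)} ∪
        ((fun x : UnitAddCircle => q • x) ⁻¹' {y | min (η / 2) (ε / 2) < |peak N y|}) ×ˢ univ := by
      intro x hx
      by_contra hcon
      simp only [mem_union, mem_ofPred_eq, mem_prod, mem_preimage, mem_univ, and_true, not_or,
        not_lt] at hcon
      have h3 : dist (h' (B x)) (h' x) < ε / 2 := by
        apply Hη
        rw [hBa, Prod.dist_eq]
        simp only [dist_self]
        have : dist (x.2 + (peak N (q • x.1) : UnitAddCircle)) x.2 ≤ |peak N (q • x.1)| := by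
          have := dist_coe_coe_le (peak N (q • x.1)) 0
          rw [sub_zero] at this
          refine le_trans (le_of_eq ?_) this
          rw [AddCircle.coe_zero, dist_self_add_left, dist_zero_right]
        refine max_lt hη (this.trans_lt (hcon.2.trans_lt ((min_le_left _ _).trans_lt (by linarith))))
      have h4 := dist_triangle (h' (B x)) (h' x) (Φ x)
      have h5 : ε < dist (h' (B x)) (Φ x) := hx
      linarith [hcon.1]
    refine (measure_mono hsub).trans ((measure_union_le _ _).trans ?_)
    have h6 : volume (((fun x : UnitAddCircle => q • x) ⁻¹'
        {y | min (η / 2) (ε / 2) < |peak N y|}) ×ˢ (univ : Set UnitAddCircle)) ≤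
        ENNReal.ofReal (ε / 2) := by
      rw [Measure.volume_eq_prod, Measure.prod_prod, measure_univ, mul_one]
      refine ((measurePreserving_nsmul hq).measure_preimage_le _).trans (hN2.trans ?_)
      exact ENNReal.ofReal_le_ofReal (min_le_right _ _)
    refine (add_le_add H h6).trans ?_
    rw [← ENNReal.ofReal_add (by positivity) (by positivity), add_halves]
  · intro x₂ z
    obtain ⟨F, F', hF⟩ := hh'
    obtain ⟨v, hv⟩ := hF.lift.exists_snd_eq 0 z.2
    have hivt : ∃ s ∈ Icc 0 s₀, peak N (s : UnitAddCircle) = 1 + fr (v - x₂) := by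
      have hcont : ContinuousOn (fun s : ℝ => peak N (s : UnitAddCircle)) (Icc 0 s₀) :=
        ((peak N).continuous.comp (AddCircle.continuous_mk' 1)).continuousOn
      have := intermediate_value_Icc' hs₀.le hcont
      have hmem : 1 + fr (v - x₂) ∈ Icc (peak N (s₀ : UnitAddCircle)) (peak N ((0 : ℝ) : UnitAddCircle)) := by
        rw [peak_coe, peak_coe]
        constructor
        · linarith [fr_nonneg (v - x₂)]
        · norm_num; linarith [fr_lt_one (v - x₂)]
      exact this hmem
    obtain ⟨s, ⟨hs0, hs1⟩, hs⟩ := hivt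
    have hq' : (0 : ℝ) < q := by exact_mod_cast hq
    have hq1 : (1 : ℝ) ≤ q := by exact_mod_cast hq
    have hBu : B (((s / q : ℝ) : UnitAddCircle), x₂) = (((s / q : ℝ) : UnitAddCircle), v) := by
      rw [hBa]
      have e1 : q • ((s / q : ℝ) : UnitAddCircle) = (s : UnitAddCircle) := by
        rw [← AddCircle.coe_nsmul]; congr 1; rw [nsmul_eq_mul]; field_simp
      simp only [e1, hs, AddCircle.coe_add, coe_fr]
      rw [show ((1 : ℝ) : UnitAddCircle) = 0 from AddCircle.coe_period 1]
      simp
    have hd : dist (h' (((s / q : ℝ) : UnitAddCircle), v)) (h' (0, v)) < ε / 2 := by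
      apply Hη
      rw [Prod.dist_eq]
      simp only [dist_self]
      have h1 := dist_coe_coe_le (s / q) 0
      rw [sub_zero, AddCircle.coe_zero, abs_of_nonneg (by positivity)] at h1
      have h2 : s / q ≤ s := div_le_self hs0 hq1
      have h3 : s₀ ≤ η / 2 := min_le_left _ _
      exact max_lt (by linarith) hη
    obtain ⟨j, hj⟩ := exists_int_div_near hq (h' (0, v)).1 z.1
    refine ⟨((s / q : ℝ) : UnitAddCircle) + ((j / q : ℝ) : UnitAddCircle), ?_⟩
    obtain ⟨_, _, hent'⟩ := hent
    have e1 := hent'.lift.apply_shift j (((s / q : ℝ) : UnitAddCircle), x₂)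
    rw [shift_apply] at e1
    rw [e1]
    have e2 : (h' * B) (((s / q : ℝ) : UnitAddCircle), x₂) = h' (((s / q : ℝ) : UnitAddCircle), v) := by
      change h' (B _) = _
      rw [hBu]
    rw [e2]
    refine (dist_triangle _ (shift ((j / q : ℝ) : UnitAddCircle) (h' (0, v))) _).trans ?_
    apply add_le_add
    · rw [shift_apply, shift_apply, Prod.dist_eq]
      simp only [dist_add_right]
      rw [Prod.dist_eq] at hd
      linarith
    · rw [shift_apply, Prod.dist_eq]
      simp only [hv, dist_self]
      exact max_le hj (by positivity)

/-! ### Rows: measure, averages, boundaries -/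

theorem _root_.MeasureTheory.MeasurePreserving.integral_comp_of_aestronglyMeasurable
    {α β : Type*} [MeasurableSpace α] [MeasurableSpace β] {μ : Measure α} {ν : Measure β}
    {φ : α → β} (h : MeasurePreserving φ μ ν) {g : β → ℝ} (hg : AEStronglyMeasurable g ν) :
    ∫ x, g (φ x) ∂μ = ∫ y, g y ∂ν := by
  have h2 := hg
  rw [← h.map_eq] at h2 ⊢
  exact (integral_map h.measurable.aemeasurable h2).symm

theorem volume_row {R : ℕ} [NeZero R] (a : Fin R) :
    volume.real {x : UnitAddCircle | row R x = a} = 1 / R := by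
  have hR : (0 : ℝ) < R := by exact_mod_cast Nat.pos_of_ne_zero (NeZero.ne R)
  have heq : ∀ b : Fin R, volume.real {x : UnitAddCircle | row R x = b} =
      volume.real {x : UnitAddCircle | row R x = a} := by
    intro b
    have hmp := measurePreserving_add_right (volume : Measure UnitAddCircle)
      ((((b : ℕ) - (a : ℕ)) / R : ℝ) : UnitAddCircle)
    rw [measureReal_def, measureReal_def, ← hmp.measure_preimage (measurableSet_row b).nullMeasurableSet]
    congr 2
    ext x
    exact row_add_eq_iff a b x
  have hsum : ∑ b : Fin R, volume.real {x : UnitAddCircle | row R x = b} = 1 := by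
    rw [← measureReal_biUnion_finset]
    · have : (⋃ b ∈ (Finset.univ : Finset (Fin R)), {x : UnitAddCircle | row R x = b}) = univ := by
        ext x; simp
      rw [this, probReal_univ]
    · intro b _ c _ hbc
      rw [Function.onFun, Set.disjoint_left]
      intro x hx hx'
      exact hbc (hx.symm.trans hx')
    · intro b _; exact measurableSet_row b
  simp only [heq, Finset.sum_const, Finset.card_univ, Fintype.card_fin, nsmul_eq_mul] at hsum
  field_simp
  linarith

theorem measurePreserving_permRow {R : ℕ} [NeZero R] (σ : Equiv.Perm (Fin R)) :
    MeasurePreserving (permRow σ) (volume : Measure UnitAddCircle) volume := by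
  have h1 := (isApproximable_fiberPerm one_pos (π := fun _ => σ) (fun τ => by
    by_cases h : σ = τ <;> simp [h])).measurePreserving
  have hfst : MeasurePreserving (Prod.snd : Torus → UnitAddCircle) volume volume :=
    measurePreserving_snd
  have h2 := hfst.comp h1
  have hm : Measurable (permRow σ) := by
    unfold permRow
    refine measurable_id.add (AddCircle.measurable_mk'.comp ?_)
    exact (Measurable.of_discrete (f := fun a : Fin R => (((σ a : ℕ) - (a : ℕ)) / R : ℝ))).comp
      (measurable_row R)
  refine ⟨hm, ?_⟩
  have h3 := h2.map_eq
  have : (Prod.snd ∘ fiberPerm 1 fun _ => σ) = permRow σ ∘ (Prod.snd : Torus → UnitAddCircle) := rfl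
  rw [this, ← Measure.map_map hm measurable_snd, hfst.map_eq] at h3
  exact h3

/-- The Riemann sum of `g` along a family of row permutations acting transitively on the rows in
`S` is close to the mean of `g` on the union of these rows. -/
theorem abs_sum_permRow_sub_integral_le {R M : ℕ} [NeZero R] (σ : Fin M → Equiv.Perm (Fin R))
    (S : Set (Fin R)) (hS : ∀ k a, σ k a ∈ S ↔ a ∈ S)
    (hσ : ∀ a ∈ S, ∀ b ∈ S, ∃ e : Equiv.Perm (Fin M), ∀ k, σ k a = σ (e k) b)
    {g : UnitAddCircle → ℝ} (hg : Continuous g) {ε : ℝ}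
    (hgε : ∀ x y, dist x y ≤ 1 / R → |g x - g y| ≤ ε) {x : UnitAddCircle} (hx : row R x ∈ S) :
    |(∑ k, g (permRow (σ k) x)) * volume.real {y : UnitAddCircle | row R y ∈ S} -
      M * ∫ y in {y : UnitAddCircle | row R y ∈ S}, g y| ≤
      M * ε * volume.real {y : UnitAddCircle | row R y ∈ S} := by
  have hR : (0 : ℝ) < R := by exact_mod_cast Nat.pos_of_ne_zero (NeZero.ne R)
  set A : Set UnitAddCircle := {y | row R y ∈ S} with hA
  have hAm : MeasurableSet A := measurable_row R (MeasurableSet.of_discrete (s := S))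
  have hgi : ∀ k, IntegrableOn (fun y => g (permRow (σ k) y)) A := by
    intro k
    have h1 : Integrable g := hg.integrable_of_hasCompactSupport (HasCompactSupport.of_compactSpace _)
    exact ((measurePreserving_permRow (σ k)).integrable_comp_of_integrable h1).integrableOn
  have h1 : ∀ k, ∫ y in A, g (permRow (σ k) y) = ∫ y in A, g y := by
    intro k
    have hpre : permRow (σ k) ⁻¹' A = A := by
      ext y
      change row R (permRow (σ k) y) ∈ S ↔ row R y ∈ S
      rw [row_permRow, hS]
    have := (measurePreserving_permRow (σ k)).restrict_preimage hAm
    rw [hpre] at this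
    exact this.integral_comp_of_aestronglyMeasurable hg.aestronglyMeasurable
  have h2 : (M : ℝ) * ∫ y in A, g y = ∫ y in A, ∑ k, g (permRow (σ k) y) := by
    rw [integral_finsetSum _ (fun k _ => hgi k), Finset.sum_congr rfl fun k _ => h1 k]
    simp
  have h3 : ∀ y ∈ A, |(∑ k, g (permRow (σ k) x)) - ∑ k, g (permRow (σ k) y)| ≤ M * ε := by
    intro y hy
    obtain ⟨e, he⟩ := hσ _ hx _ hy
    rw [← Equiv.sum_comp e fun k => g (permRow (σ k) y), ← Finset.sum_sub_distrib]
    refine (Finset.abs_sum_le_sum_abs _ _).trans ?_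
    have : ∀ k ∈ (Finset.univ : Finset (Fin M)),
        |g (permRow (σ k) x) - g (permRow (σ (e k)) y)| ≤ ε := by
      intro k _
      apply hgε
      have e1 := row_eq_iff.1 ((row_permRow (σ k) x).trans (he k))
      have e2 := row_eq_iff.1 (row_permRow (σ (e k)) y)
      rw [← coe_fr (permRow (σ k) x), ← coe_fr (permRow (σ (e k)) y)]
      refine (dist_coe_coe_le _ _).trans ?_
      have e3 : |fr (permRow (σ k) x) - fr (permRow (σ (e k)) y)| * R =
          |R * fr (permRow (σ k) x) - R * fr (permRow (σ (e k)) y)| := by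
        rw [← mul_sub, abs_mul, abs_of_pos hR, mul_comm]
      rw [le_div_iff₀ hR, e3, abs_le]
      constructor <;> linarith
    refine (Finset.sum_le_sum this).trans ?_
    simp
  rw [h2]
  have h4 : (∑ k, g (permRow (σ k) x)) * volume.real A = ∫ y in A, ∑ k, g (permRow (σ k) x) := by
    rw [setIntegral_const, smul_eq_mul, mul_comm]
  rw [h4, ← integral_sub (integrable_const _) (integrable_finsetSum _ fun k _ => hgi k)]
  exact norm_setIntegral_le_of_norm_le_const (measure_lt_top _ _)
    (f := fun y => (∑ k, g (permRow (σ k) x)) - ∑ k, g (permRow (σ k) y)) h3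

theorem exists_coe_abs_eq (x y : UnitAddCircle) :
    ∃ t : ℝ, y = x + (t : UnitAddCircle) ∧ |t| = dist x y := by
  refine ⟨fr (y - x) - round (fr (y - x)), ?_, ?_⟩
  · have : ((round (fr (y - x)) : ℝ) : UnitAddCircle) = 0 := by
      have h := AddCircle.coe_eq_zero_iff (1 : ℝ) (x := (round (fr (y - x)) : ℝ))
      exact h.2 ⟨round (fr (y - x)), by simp⟩
    rw [AddCircle.coe_sub, this, sub_zero, coe_fr]
    abel
  · rw [dist_comm, dist_eq_norm]
    conv_rhs => rw [← coe_fr (y - x)]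
    rw [UnitAddCircle.norm_eq]

/-- Two points of the circle in different rows are separated by the boundary of a row. -/
theorem norm_nsmul_le_of_row_ne {r : ℕ} [NeZero r] {x y : UnitAddCircle}
    (h : row r y ≠ row r x) : ‖r • x‖ ≤ r * dist x y := by
  have hr : (0 : ℝ) < r := by exact_mod_cast Nat.pos_of_ne_zero (NeZero.ne r)
  by_contra hcon
  rw [not_le] at hcon
  apply h
  obtain ⟨t, rfl, ht⟩ := exists_coe_abs_eq x y
  rw [← ht] at hcon
  obtain ⟨h1, h2⟩ := row_eq_iff.1 (rfl : row r x = row r x)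
  set n := row r x
  have hle : ∀ k : ℤ, ‖r • x‖ ≤ |r * fr x - k| := by
    intro k
    have e : r • x = ((r * fr x - k : ℝ) : UnitAddCircle) := by
      have hk : ((k : ℝ) : UnitAddCircle) = 0 :=
        (AddCircle.coe_eq_zero_iff (1 : ℝ)).2 ⟨k, by simp⟩
      rw [AddCircle.coe_sub, hk, sub_zero, ← nsmul_eq_mul, AddCircle.coe_nsmul, coe_fr]
    rw [e]
    exact QuotientAddGroup.norm_mk_le_norm
  have h3 := hcon.trans_le (hle (n : ℕ))
  have h4 := hcon.trans_le (hle ((n : ℕ) + 1))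
  push_cast at h3 h4
  rw [abs_of_nonneg (show 0 ≤ r * fr x - (n : ℕ) by linarith)] at h3
  rw [abs_of_neg (show r * fr x - ((n : ℕ) + 1) < 0 by linarith)] at h4
  have h5 := neg_abs_le t
  have h6 := le_abs_self t
  have h7 : ((n : ℕ) : ℝ) < r * (fr x + t) := by nlinarith
  have h8 : r * (fr x + t) < (n : ℕ) + 1 := by nlinarith
  have hn : ((n : ℕ) : ℝ) + 1 ≤ r := by exact_mod_cast n.2
  have h9 : fr (x + (t : UnitAddCircle)) = fr x + t := by
    apply fr_add_coe
    · by_contra hneg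
      rw [not_le] at hneg
      have : r * (fr x + t) < 0 := mul_neg_of_pos_of_neg hr hneg
      have : (0 : ℝ) ≤ (n : ℕ) := Nat.cast_nonneg _
      linarith
    · by_contra hge
      rw [not_lt] at hge
      nlinarith
  rw [row_eq_iff, h9]
  exact ⟨h7.le, h8⟩

theorem volume_norm_nsmul_le {r : ℕ} (hr : 0 < r) (δ : ℝ) :
    volume {x : UnitAddCircle | ‖r • x‖ ≤ δ} ≤ ENNReal.ofReal (2 * δ) := by
  have h1 : {x : UnitAddCircle | ‖r • x‖ ≤ δ} = (fun x => r • x) ⁻¹' Metric.closedBall 0 δ := by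
    ext x; simp
  rw [h1, (measurePreserving_nsmul hr).measure_preimage
    Metric.isClosed_closedBall.measurableSet.nullMeasurableSet, AddCircle.volume_closedBall]
  exact ENNReal.ofReal_le_ofReal (min_le_right _ _)

theorem row_mul {r M : ℕ} [NeZero r] [NeZero M] (x : UnitAddCircle) :
    row r x = (row (r * M) x).divNat := by
  have hM : (M : ℝ) ≠ 0 := by exact_mod_cast NeZero.ne M
  rw [Fin.ext_iff, Fin.coe_divNat]
  simp only [row]
  rw [← Nat.floor_div_natCast]
  congr 1
  push_cast
  field_simp

theorem _root_.Continuous.integrable_torus {F : Torus → ℝ} (hF : Continuous F) : Integrable F :=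
  hF.integrable_of_hasCompactSupport (HasCompactSupport.of_compactSpace _)

theorem _root_.Continuous.integrable_circle {F : UnitAddCircle → ℝ} (hF : Continuous F) :
    Integrable F :=
  hF.integrable_of_hasCompactSupport (HasCompactSupport.of_compactSpace _)

/-- The annulus `𝕋 × [i/r, (i+1)/r)`. -/
def annulus (r : ℕ) [NeZero r] (i : Fin r) : Set Torus := {x | row r x.2 = i}

theorem measurableSet_annulus {r : ℕ} [NeZero r] (i : Fin r) : MeasurableSet (annulus r i) :=
  measurable_snd (measurableSet_row i)

theorem annulus_eq_prod {r : ℕ} [NeZero r] (i : Fin r) :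
    annulus r i = univ ×ˢ {v | row r v = i} := by
  ext x; simp [annulus]

theorem volume_annulus {r : ℕ} [NeZero r] (i : Fin r) : volume.real (annulus r i) = 1 / r := by
  rw [annulus_eq_prod, measureReal_def, Measure.volume_eq_prod, Measure.prod_prod, measure_univ,
    one_mul, ← measureReal_def, volume_row]

theorem setIntegral_annulus {r : ℕ} [NeZero r] (i : Fin r) {F : Torus → ℝ}
    (hF : IntegrableOn F (annulus r i)) :
    ∫ x in annulus r i, F x = ∫ a, ∫ v in {v | row r v = i}, F (a, v) := by
  rw [annulus_eq_prod] at hF ⊢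
  rw [Measure.volume_eq_prod, setIntegral_prod _ hF, setIntegral_univ]

/-- Averages over steeply sheared vertical segments approach averages over annuli. -/
theorem eventually_sheared_average {r : ℕ} [NeZero r] {F : Torus → ℝ} (hF : Continuous F)
    (hF1 : ∀ x, |F x| ≤ 1) {ε : ℝ} (hε : 0 < ε) :
    ∀ᶠ m : ℕ in atTop, ∀ (i : Fin r) (a : UnitAddCircle),
      |(∫ v in {v | row r v = i}, F (a + m • v, v)) - ∫ x in annulus r i, F x| ≤ ε := by
  have hr : (0 : ℝ) < r := by exact_mod_cast Nat.pos_of_ne_zero (NeZero.ne r)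
  have huc := CompactSpace.uniformContinuous_of_continuous hF
  rw [Metric.uniformContinuous_iff] at huc
  obtain ⟨δ, hδ, Hδ⟩ := huc (ε / 2) (by positivity)
  have hev : ∀ᶠ m : ℕ in atTop, 1 / (m : ℝ) < min δ (ε / (4 * r)) :=
    tendsto_one_div_atTop_nhds_zero_nat.eventually (gt_mem_nhds (by positivity))
  filter_upwards [hev, eventually_gt_atTop 0] with m hm hm0 i a
  have hm0' : (0 : ℝ) < m := by exact_mod_cast hm0
  set A : Set UnitAddCircle := {v | row r v = i} with hA
  have hAm : MeasurableSet A := measurableSet_row i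
  let B : UnitAddCircle → ℝ := fun a => ∫ v in A, F (a + m • v, v)
  have hmeas : Measurable fun v : UnitAddCircle => m • v := (measurePreserving_nsmul hm0).measurable
  have hcont : Continuous fun x : Torus => F (x.1 + m • x.2, x.2) := by fun_prop
  -- the average over `a` is exact
  have hB : ∫ a, B a = ∫ x in annulus r i, F x := by
    have h1 := setIntegral_annulus i (F := fun x => F (x.1 + m • x.2, x.2))
      hcont.integrable_torus.integrableOn
    have h2 := measurePreserving_shearH hmeas
    have hpre : shearH (fun v => m • v) ⁻¹' annulus r i = annulus r i := rfl
    have h3 := h2.restrict_preimage (measurableSet_annulus i)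
    rw [hpre] at h3
    rw [← h3.integral_comp_of_aestronglyMeasurable hF.aestronglyMeasurable]
    exact h1.symm
  have hBdiff : ∀ b, |B a - B b| ≤ ε := by
    intro b
    obtain ⟨s, hs0, hs1, rfl⟩ : ∃ s : ℝ, 0 ≤ s ∧ s < 1 ∧ b = a + (s : UnitAddCircle) :=
      ⟨fr (b - a), fr_nonneg _, fr_lt_one _, by rw [coe_fr]; abel⟩
    let w : UnitAddCircle := ((s / m : ℝ) : UnitAddCircle)
    have hw : m • w = (s : UnitAddCircle) := by
      rw [← AddCircle.coe_nsmul]; congr 1; rw [nsmul_eq_mul]; field_simp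
    have hwn : ‖w‖ ≤ 1 / m := by
      refine (QuotientAddGroup.norm_mk_le_norm).trans ?_
      rw [Real.norm_eq_abs, abs_of_nonneg (by positivity)]
      gcongr
    have e1 : B (a + (s : UnitAddCircle)) = ∫ v, A.indicator (fun v => F (a + m • (v + w), v)) v := by
      rw [integral_indicator hAm]
      simp only [B, smul_add, hw, add_comm (m • _) (s : UnitAddCircle), add_assoc]
    have e2 : B (a + (s : UnitAddCircle)) =
        ∫ v, A.indicator (fun v => F (a + m • (v + w), v)) (v - w) := by
      rw [e1]
      exact (integral_sub_right_eq_self _ w).symm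
    have e3 : B a = ∫ v, A.indicator (fun v => F (a + m • v, v)) v := by
      rw [integral_indicator hAm]
    have hi1 : Integrable (A.indicator (fun v => F (a + m • v, v))) :=
      (Continuous.integrable_circle (by fun_prop)).indicator hAm
    have hi2 : Integrable fun v => A.indicator (fun v => F (a + m • (v + w), v)) (v - w) :=
      ((Continuous.integrable_circle (F := fun v => F (a + m • (v + w), v))
        (by fun_prop)).indicator hAm).comp_sub_right w
    rw [e3, e2, ← integral_sub hi1 hi2]
    let Z : Set UnitAddCircle := {v | ‖r • v‖ ≤ r * (1 / m)}
    have hZm : MeasurableSet Z :=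
      (isClosed_le (by fun_prop) continuous_const).measurableSet
    have hpt : ∀ v, ‖A.indicator (fun v => F (a + m • v, v)) v -
        A.indicator (fun v => F (a + m • (v + w), v)) (v - w)‖ ≤
        ε / 2 + Z.indicator (fun _ => (1 : ℝ)) v := by
      intro v
      have hd : dist v (v - w) ≤ 1 / m := by
        rw [dist_eq_norm]; simpa using hwn
      by_cases hrow : row r (v - w) = row r v
      · have hZ0 : 0 ≤ Z.indicator (fun _ => (1 : ℝ)) v := indicator_nonneg (fun _ _ => zero_le_one) _
        by_cases hv : v ∈ A
        · have hv' : v - w ∈ A := hrow.trans hv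
          rw [indicator_of_mem hv, indicator_of_mem hv', sub_add_cancel]
          have := Hδ (a := (a + m • v, v)) (b := (a + m • v, v - w)) (by
            rw [Prod.dist_eq]
            simp only [dist_self]
            exact max_lt hδ (hd.trans_lt (hm.trans_le (min_le_left _ _))))
          rw [Real.dist_eq] at this
          rw [Real.norm_eq_abs]
          linarith
        · have hv' : v - w ∉ A := fun h => hv (hrow.symm.trans h)
          rw [indicator_of_notMem hv, indicator_of_notMem hv']
          simp only [sub_zero, norm_zero]
          positivity
      · have hZ : v ∈ Z := by
          refine (norm_nsmul_le_of_row_ne hrow).trans ?_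
          gcongr
        rw [indicator_of_mem hZ]
        have hne : v ∈ A → v - w ∉ A := fun h h' => hrow (h'.trans h.symm)
        by_cases hv : v ∈ A
        · rw [indicator_of_mem hv, indicator_of_notMem (hne hv), sub_zero, Real.norm_eq_abs]
          linarith [hF1 (a + m • v, v)]
        · rw [indicator_of_notMem hv, zero_sub, norm_neg]
          by_cases hv' : v - w ∈ A
          · rw [indicator_of_mem hv', Real.norm_eq_abs]
            linarith [hF1 (a + m • (v - w + w), v - w)]
          · rw [indicator_of_notMem hv', norm_zero]; positivity
    have hiZ : Integrable fun v => ε / 2 + Z.indicator (fun _ => (1 : ℝ)) v :=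
      (integrable_const _).add ((integrable_const _).indicator hZm)
    refine (norm_integral_le_of_norm_le hiZ (Eventually.of_forall hpt)).trans ?_
    rw [integral_add (integrable_const _) ((integrable_const _).indicator hZm), integral_const,
      integral_indicator hZm, setIntegral_const]
    simp only [probReal_univ, smul_eq_mul, one_mul, mul_one]
    have hZv : volume.real Z ≤ 2 * (r * (1 / m)) := by
      rw [measureReal_def]
      exact ENNReal.toReal_le_of_le_ofReal (by positivity)
        (volume_norm_nsmul_le (Nat.pos_of_ne_zero (NeZero.ne r)) _)
    have : r * (1 / (m : ℝ)) ≤ ε / 4 := by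
      have h := hm.le.trans (min_le_right _ _)
      calc r * (1 / (m : ℝ)) ≤ r * (ε / (4 * r)) := by gcongr
        _ = ε / 4 := by field_simp
    linarith
  have hBi : Integrable B := by
    have := (hcont.integrable_torus.integrableOn (s := annulus r i))
    rw [annulus_eq_prod, Measure.volume_eq_prod, IntegrableOn, ← Measure.prod_restrict,
      Measure.restrict_univ] at this
    exact this.integral_prod_left
  have h5 : B a - ∫ x in annulus r i, F x = ∫ b, (B a - B b) := by
    rw [integral_sub (integrable_const _) hBi, hB, integral_const]; simp
  change |B a - _| ≤ ε
  rw [h5]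
  refine (norm_integral_le_of_norm_le_const (f := fun b => B a - B b)
    (Eventually.of_forall hBdiff)).trans ?_
  simp

/-! ### A mixing model map -/

/-- The permutation of `r * M` rows, in `r` groups of `M` rows each, that rotates every group by
`k`. -/
def rotPerm (r : ℕ) {M : ℕ} [NeZero M] (k : Fin M) : Equiv.Perm (Fin (r * M)) :=
  finProdFinEquiv.permCongr ((Equiv.refl (Fin r)).prodCongr (Equiv.addRight k))

theorem divNat_rotPerm {r M : ℕ} [NeZero M] (k : Fin M) (a : Fin (r * M)) :
    (rotPerm r k a).divNat = a.divNat := by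
  have := congrArg Prod.fst (finProdFinEquiv.symm_apply_apply
    (((Equiv.refl (Fin r)).prodCongr (Equiv.addRight k)) (finProdFinEquiv.symm a)))
  exact this

@[simp] theorem rotPerm_zero (r : ℕ) {M : ℕ} [NeZero M] : rotPerm r (0 : Fin M) = 1 := by
  ext a
  simp [rotPerm, Equiv.permCongr_apply, Nat.mod_add_div]

theorem exists_rotPerm_eq {r M : ℕ} [NeZero M] {a b : Fin (r * M)} (h : a.divNat = b.divNat) :
    ∃ e : Equiv.Perm (Fin M), ∀ k, rotPerm r k a = rotPerm r (e k) b := by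
  refine ⟨Equiv.addRight (a.modNat - b.modNat), fun k => ?_⟩
  simp only [rotPerm, Equiv.permCongr_apply, finProdFinEquiv_symm_apply, Equiv.prodCongr_apply,
    Prod.map_apply, Equiv.coe_addRight, h, Equiv.refl_apply]
  congr 2
  abel

/-- Averages of `F` along the rotated rows of a steeply sheared vertical line approach averages
over annuli. -/
theorem eventually_row_average {r : ℕ} [NeZero r] {F : Torus → ℝ} (hF : Continuous F)
    (hF1 : ∀ x, |F x| ≤ 1) {ε : ℝ} (hε : 0 < ε) :
    ∀ᶠ m : ℕ in atTop, ∃ M₀ : ℕ, ∀ (M : ℕ) [NeZero M], M₀ ≤ M → ∀ (a x : UnitAddCircle),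
      |(∑ k : Fin M, F (a + m • permRow (rotPerm r k) x, permRow (rotPerm r k) x)) -
        M * (r * ∫ y in annulus r (row r x), F y)| ≤ M * ε := by
  have hr : (0 : ℝ) < r := by exact_mod_cast Nat.pos_of_ne_zero (NeZero.ne r)
  filter_upwards [eventually_sheared_average (r := r) hF hF1 (ε := ε / 2 / r) (by positivity)] with m hm
  have hcont : Continuous fun x : Torus => F (x.1 + m • x.2, x.2) := by fun_prop
  have huc := CompactSpace.uniformContinuous_of_continuous hcont
  rw [Metric.uniformContinuous_iff] at huc
  obtain ⟨δ, hδ, Hδ⟩ := huc (ε / 2) (by positivity)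
  obtain ⟨M₀, hM₀⟩ := exists_nat_gt (1 / δ)
  refine ⟨M₀, fun M _ hM a x => ?_⟩
  have hMpos : (0 : ℝ) < M := by exact_mod_cast Nat.pos_of_ne_zero (NeZero.ne M)
  have hr1 : (1 : ℝ) ≤ r := by exact_mod_cast Nat.pos_of_ne_zero (NeZero.ne r)
  have hRδ : 1 / ((r * M : ℕ) : ℝ) < δ := by
    have h1 : 1 / δ < M := hM₀.trans_le (by exact_mod_cast hM)
    rw [div_lt_iff₀ hδ] at h1
    push_cast
    rw [div_lt_iff₀ (by positivity)]
    nlinarith [mul_pos hMpos hδ]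
  have hset : {y : UnitAddCircle | row (r * M) y ∈ {b : Fin (r * M) | b.divNat = row r x}} =
      {y | row r y = row r x} := by
    ext y
    change (row (r * M) y).divNat = row r x ↔ row r y = row r x
    rw [← row_mul]
  have key := abs_sum_permRow_sub_integral_le (fun k : Fin M => rotPerm r k)
    {b : Fin (r * M) | b.divNat = row r x} (fun k b => by
      simp only [mem_ofPred_eq, divNat_rotPerm]) (by
      intro b hb c hc
      exact exists_rotPerm_eq (hb.trans hc.symm))
    (g := fun v => F (a + m • v, v)) (by fun_prop) (ε := ε / 2) (by
      intro u v huv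
      have := Hδ (a := (a, u)) (b := (a, v)) (by
        rw [Prod.dist_eq]; simp only [dist_self]
        exact max_lt hδ (huv.trans_lt hRδ))
      exact this.le) (x := x) (by
        change (row (r * M) x).divNat = row r x
        rw [← row_mul])
  rw [hset, volume_row] at key
  have h2 := hm (row r x) a
  set S := ∑ k : Fin M, F (a + m • permRow (rotPerm r k) x, permRow (rotPerm r k) x)
  set I := ∫ v in {v | row r v = row r x}, F (a + m • v, v)
  set A := ∫ y in annulus r (row r x), F y
  have h3 : |S - M * (r * I)| ≤ M * (ε / 2) := by
    have e : S * (1 / r) - M * I = (S - M * (r * I)) / r := by field_simp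
    rw [e, abs_div, abs_of_pos hr, div_le_iff₀ hr] at key
    refine key.trans (le_of_eq ?_)
    field_simp
  have h4 : |M * (r * I) - M * (r * A)| ≤ M * (ε / 2) := by
    rw [← mul_sub, ← mul_sub, abs_mul, abs_mul, abs_of_pos hMpos, abs_of_pos hr]
    have : r * |I - A| ≤ r * (ε / 2 / r) := by gcongr
    have e : r * (ε / 2 / r) = ε / 2 := by field_simp
    rw [e] at this
    gcongr
  have h5 := abs_sub_le S (M * (r * I)) (M * (r * A))
  linarith

theorem row_add_div {R : ℕ} [NeZero R] (k : Fin R) (x : UnitAddCircle) :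
    row R (x + (((k : ℕ) / R : ℝ) : UnitAddCircle)) = row R x + k := by
  have hR : (R : ℝ) ≠ 0 := by exact_mod_cast NeZero.ne R
  have h := (row_add_eq_iff (row R x) (row R x + k) x).2 rfl
  rw [← h]
  congr 2
  rw [← sub_eq_zero, ← AddCircle.coe_sub, AddCircle.coe_eq_zero_iff]
  rw [Fin.val_add_eq_ite]
  split_ifs with hc
  · refine ⟨1, ?_⟩
    rw [Nat.cast_sub hc]
    push_cast
    field_simp
    ring
  · refine ⟨0, ?_⟩
    push_cast
    field_simp
    ring

/-- The amount of rotation over the column with index `c` among `M + M` columns: none over the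
first `M` columns, and every amount once over the others. -/
def rotIdx (M : ℕ) [NeZero M] (c : Fin (M + M)) : Fin M := Fin.addCases (fun _ => 0) (fun j => j) c

/-- Half of the number of columns. -/
def halfIdx (M : ℕ) [NeZero M] : Fin (M + M) :=
  ⟨M, by have := Nat.pos_of_ne_zero (NeZero.ne M); omega⟩

instance (M : ℕ) [NeZero M] : NeZero (M + M) := ⟨by have := NeZero.ne M; omega⟩

theorem castAdd_add_halfIdx {M : ℕ} [NeZero M] (j : Fin M) :
    Fin.castAdd M j + halfIdx M = Fin.natAdd M j := by
  ext
  have := j.2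
  rw [Fin.val_add_eq_ite, if_neg (by simp only [halfIdx, Fin.val_castAdd]; omega)]
  simp only [halfIdx, Fin.val_castAdd, Fin.val_natAdd]
  omega

theorem natAdd_add_halfIdx {M : ℕ} [NeZero M] (j : Fin M) :
    Fin.natAdd M j + halfIdx M = Fin.castAdd M j := by
  ext
  have := j.2
  rw [Fin.val_add_eq_ite, if_pos (by simp only [halfIdx, Fin.val_natAdd]; omega)]
  simp only [halfIdx, Fin.val_castAdd, Fin.val_natAdd]
  omega

/-- The model map: in a column, each annulus is rotated by a number of rows that depends on the
column, and then the torus is sheared horizontally. -/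
def modelMap (q r M m : ℕ) [NeZero r] [NeZero M] (x : Torus) : Torus :=
  shearH (fun v => m • v)
    (fiberPerm q (fun v => rotPerm r (rotIdx M (row (M + M) v))) x)

theorem measurableSet_fiber_of_row {R : ℕ} [NeZero R] {α : Type*} (G : Fin R → α) (a : α) :
    MeasurableSet {v : UnitAddCircle | G (row R v) = a} :=
  measurable_row R (MeasurableSet.of_discrete (s := {c | G c = a}))

theorem measurePreserving_modelMap {q : ℕ} (hq : 0 < q) (r M : ℕ) [NeZero r] [NeZero M] {m : ℕ}
    (hm : 0 < m) : MeasurePreserving (modelMap q r M m) (volume : Measure Torus) volume :=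
  (measurePreserving_shearH (measurePreserving_nsmul hm).measurable).comp
    (isApproximable_fiberPerm hq fun σ => measurableSet_fiber_of_row
      (fun c => rotPerm r (rotIdx M c)) σ).measurePreserving

theorem row_snd_modelMap (q r M m : ℕ) [NeZero r] [NeZero M] (x : Torus) :
    row r (modelMap q r M m x).2 = row r x.2 := by
  rw [row_mul (r := r) (M := M), row_mul (r := r) (M := M) (x := x.2)]
  simp only [modelMap, shearH, fiberPerm, row_permRow, divNat_rotPerm]

theorem measurePreserving_shift_annulus {r : ℕ} [NeZero r] (i : Fin r) (t : UnitAddCircle) :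
    MeasurePreserving (shift t) ((volume : Measure Torus).restrict (annulus r i))
      (volume.restrict (annulus r i)) :=
  (measurePreserving_shearH (g := fun _ => t) measurable_const).restrict_preimage
    (measurableSet_annulus i)

theorem measurePreserving_shift (t : UnitAddCircle) :
    MeasurePreserving (shift t) (volume : Measure Torus) volume :=
  measurePreserving_shearH (g := fun _ => t) measurable_const

/-- The quarter period `1/(4q)`: translating by it exchanges the two halves of the columns. -/
def quarter (q : ℕ) : UnitAddCircle := ((1 / (4 * q) : ℝ) : UnitAddCircle)

/-- Under the model map, a point and its translate by `1/(4q)` are almost independently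
distributed in each annulus. -/
theorem abs_integral_modelMap_sub_le {q r M m : ℕ} (hq : 0 < q) [NeZero r] [NeZero M] (hm : 0 < m)
    {F G : Torus → ℝ} (hF : Continuous F) (hG : Continuous G) (hF1 : ∀ x, |F x| ≤ 1)
    (hG1 : ∀ x, |G x| ≤ 1) {ε : ℝ}
    (hFq : ∀ x y, dist x y ≤ 1 / q → |F x - F y| ≤ ε)
    (hGq : ∀ x y, dist x y ≤ 1 / q → |G x - G y| ≤ ε)
    (hFM : ∀ (a x : UnitAddCircle),
      |(∑ k : Fin M, F (a + m • permRow (rotPerm r k) x, permRow (rotPerm r k) x)) -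
        M * (r * ∫ y in annulus r (row r x), F y)| ≤ M * ε)
    (hGM : ∀ (a x : UnitAddCircle),
      |(∑ k : Fin M, G (a + m • permRow (rotPerm r k) x, permRow (rotPerm r k) x)) -
        M * (r * ∫ y in annulus r (row r x), G y)| ≤ M * ε) (i : Fin r) :
    |(∫ x in annulus r i, F (modelMap q r M m (shift (quarter q) x)) * G (modelMap q r M m x)) -
      r * (∫ x in annulus r i, F x) * ∫ x in annulus r i, G x| ≤ 4 * ε := by
  have hMpos : (0 : ℝ) < M := by exact_mod_cast Nat.pos_of_ne_zero (NeZero.ne M)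
  have hqpos : (0 : ℝ) < q := by exact_mod_cast hq
  set μ : Measure Torus := volume.restrict (annulus r i) with hμ
  let P : Fin M → UnitAddCircle → UnitAddCircle := fun k => permRow (rotPerm r k)
  let Fm : UnitAddCircle → UnitAddCircle → ℝ := fun a v => F (a + m • v, v)
  let Gm : UnitAddCircle → UnitAddCircle → ℝ := fun a v => G (a + m • v, v)
  let col : UnitAddCircle → Fin (M + M) := fun a => row (M + M) ((2 * q) • a)
  let Θ : UnitAddCircle → Fin (M + M) → UnitAddCircle → ℝ := fun a c v =>
    Fm (a + quarter q) (P (rotIdx M (c + halfIdx M)) v) * Gm a (P (rotIdx M c) v)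
  let s : Fin (M + M) → UnitAddCircle := fun k => (((k : ℕ) / (2 * q * ((M + M : ℕ) : ℝ)) : ℝ) : UnitAddCircle)
  have hcol : ∀ k a, col (a + s k) = col a + k := by
    intro k a
    have : (2 * q) • s k = (((k : ℕ) / ((M + M : ℕ) : ℝ) : ℝ) : UnitAddCircle) := by
      rw [← AddCircle.coe_nsmul]; congr 1; rw [nsmul_eq_mul]; push_cast; field_simp
    simp only [col, smul_add, this, row_add_div]
  have hquarter : quarter q = s (halfIdx M) := by
    simp only [quarter, s, halfIdx]
    congr 1; push_cast; field_simp; norm_num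
  have hΘ : ∀ x : Torus, F (modelMap q r M m (shift (quarter q) x)) * G (modelMap q r M m x) =
      Θ x.1 (col x.1) x.2 := by
    intro x
    have h1 : col (x.1 + quarter q) = col x.1 + halfIdx M := by rw [hquarter, hcol]
    simp only [modelMap, shearH, fiberPerm, shift_apply]
    simp only [Θ, Fm, Gm, P, ← h1]
    rfl
  have hΦ := (measurePreserving_modelMap hq r M hm).measurable
  let J : Torus → ℝ := fun x => F (modelMap q r M m (shift (quarter q) x)) * G (modelMap q r M m x)
  have hJm : Measurable J :=
    (hF.measurable.comp (hΦ.comp (shift _).continuous.measurable)).mul (hG.measurable.comp hΦ)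
  have hprod : ∀ a b : ℝ, |a| ≤ 1 → |b| ≤ 1 → |a * b| ≤ 1 := by
    intro a b ha hb
    rw [abs_mul]
    exact mul_le_one₀ ha (abs_nonneg _) hb
  have hdiff : ∀ a b a' b' : ℝ, |a| ≤ 1 → |b'| ≤ 1 → |a - a'| ≤ ε → |b - b'| ≤ ε →
      |a * b - a' * b'| ≤ 2 * ε := by
    intro a b a' b' ha hb' h1 h2
    have e : a * b - a' * b' = a * (b - b') + (a - a') * b' := by ring
    rw [e]
    refine (abs_add_le _ _).trans ?_
    rw [abs_mul, abs_mul]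
    nlinarith [abs_nonneg (b - b'), abs_nonneg (a - a'), abs_nonneg a, abs_nonneg b']
  have hJ1 : ∀ x, |J x| ≤ 1 := fun x => hprod _ _ (hF1 _) (hG1 _)
  have hJi : Integrable J μ := Integrable.of_bound hJm.aestronglyMeasurable 1 (Eventually.of_forall hJ1)
  -- average over translations of the columns
  have hI : ∀ k, ∫ x, J (shift (s k) x) ∂μ = ∫ x, J x ∂μ := fun k =>
    (measurePreserving_shift_annulus i (s k)).integral_comp_of_aestronglyMeasurable
      hJm.aestronglyMeasurable
  have hJki : ∀ k, Integrable (fun x => J (shift (s k) x)) μ := fun k =>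
    (measurePreserving_shift_annulus i (s k)).integrable_comp_of_integrable hJi
  have hsum : ((M + M : ℕ) : ℝ) * ∫ x, J x ∂μ = ∫ x, ∑ k, J (shift (s k) x) ∂μ := by
    rw [integral_finsetSum _ (fun k _ => hJki k), Finset.sum_congr rfl fun k _ => hI k]
    simp
  let AF := ∫ x in annulus r i, F x
  let AG := ∫ x in annulus r i, G x
  let W : Torus → ℝ := fun x => M * (r * AF) * Gm x.1 x.2 + M * (r * AG) * Fm (x.1 + quarter q) x.2
  have hFmc : Continuous fun x : Torus => Fm (x.1 + quarter q) x.2 := by fun_prop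
  have hGmc : Continuous fun x : Torus => Gm x.1 x.2 := by fun_prop
  have hWc : Continuous W := by fun_prop
  have hWint : ∫ x, W x ∂μ = ((M + M : ℕ) : ℝ) * (r * AF * AG) := by
    have hmeas : Measurable fun v : UnitAddCircle => m • v := (measurePreserving_nsmul hm).measurable
    have h3 : MeasurePreserving (shearH fun v => m • v) μ μ :=
      (measurePreserving_shearH hmeas).restrict_preimage (measurableSet_annulus i)
    have h4 : ∫ x, Gm x.1 x.2 ∂μ = AG :=
      h3.integral_comp_of_aestronglyMeasurable hG.aestronglyMeasurable
    have h5 : ∫ x, Fm (x.1 + quarter q) x.2 ∂μ = AF :=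
      (h3.comp (measurePreserving_shift_annulus i (quarter q))).integral_comp_of_aestronglyMeasurable
        hF.aestronglyMeasurable
    simp only [W]
    rw [integral_add (hGmc.integrable_torus.integrableOn.const_mul _)
      (hFmc.integrable_torus.integrableOn.const_mul _), integral_const_mul, integral_const_mul, h4, h5]
    push_cast; ring
  have hpt : ∀ x ∈ annulus r i, |(∑ k, J (shift (s k) x)) - W x| ≤ M * (8 * ε) := by
    intro x hx
    have hx : row r x.2 = i := hx
    have e1 : ∀ k, J (shift (s k) x) = Θ (x.1 + s k) (col x.1 + k) x.2 := by
      intro k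
      rw [← hcol]; exact hΘ _
    have hsk : ∀ k, ‖s k‖ ≤ 1 / q := by
      intro k
      refine (QuotientAddGroup.norm_mk_le_norm).trans ?_
      rw [Real.norm_eq_abs, abs_of_nonneg (by positivity)]
      have : ((k : ℕ) : ℝ) ≤ ((M + M : ℕ) : ℝ) := by exact_mod_cast k.2.le
      have hMM : (0 : ℝ) < ((M + M : ℕ) : ℝ) := by push_cast; positivity
      rw [div_le_div_iff₀ (by positivity) hqpos]
      nlinarith [mul_nonneg hqpos.le (show (0 : ℝ) ≤ ((M + M : ℕ) : ℝ) by positivity)]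
    have e2 : ∀ k, |Θ (x.1 + s k) (col x.1 + k) x.2 - Θ x.1 (col x.1 + k) x.2| ≤ 2 * ε := by
      intro k
      apply hdiff _ _ _ _ (hF1 _) (hG1 _)
      · apply hFq
        rw [Prod.dist_eq]
        simp only [dist_self, dist_add_right, dist_self_add_left]
        exact max_le (hsk k) (by positivity)
      · apply hGq
        rw [Prod.dist_eq]
        simp only [dist_self, dist_add_right, dist_self_add_left]
        exact max_le (hsk k) (by positivity)
    have e3 : ∑ k, Θ x.1 (col x.1 + k) x.2 = ∑ c, Θ x.1 c x.2 :=
      Equiv.sum_comp (Equiv.addLeft (col x.1)) fun c => Θ x.1 c x.2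
    have e4 : ∑ c, Θ x.1 c x.2 = (∑ k : Fin M, Fm (x.1 + quarter q) (P k x.2)) * Gm x.1 x.2 +
        Fm (x.1 + quarter q) x.2 * ∑ k : Fin M, Gm x.1 (P k x.2) := by
      rw [Fin.sum_univ_add, Finset.sum_mul, Finset.mul_sum]
      simp only [Θ, castAdd_add_halfIdx, natAdd_add_halfIdx, rotIdx, Fin.addCases_left,
        Fin.addCases_right, P, rotPerm_zero, permRow_one]
    have e5 := hFM (x.1 + quarter q) x.2
    have e6 := hGM x.1 x.2
    rw [hx] at e5 e6
    have e7 : |(∑ k, J (shift (s k) x)) - ∑ c, Θ x.1 c x.2| ≤ M * (4 * ε) := by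
      rw [← e3, ← Finset.sum_sub_distrib]
      refine (Finset.abs_sum_le_sum_abs _ _).trans ?_
      refine (Finset.sum_le_sum (g := fun _ => 2 * ε) fun k _ => ?_).trans (le_of_eq ?_)
      · rw [e1]; exact e2 k
      · simp; ring
    have e8 : |(∑ c, Θ x.1 c x.2) - W x| ≤ M * (2 * ε) := by
      have e : (∑ c, Θ x.1 c x.2) - W x =
          ((∑ k : Fin M, Fm (x.1 + quarter q) (P k x.2)) - M * (r * AF)) * Gm x.1 x.2 +
          Fm (x.1 + quarter q) x.2 * ((∑ k : Fin M, Gm x.1 (P k x.2)) - M * (r * AG)) := by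
        rw [e4]; simp only [W]; ring
      rw [e]
      refine (abs_add_le _ _).trans ?_
      rw [abs_mul, abs_mul]
      have h1 : |Gm x.1 x.2| ≤ 1 := hG1 _
      have h2 : |Fm (x.1 + quarter q) x.2| ≤ 1 := hF1 _
      have h3 := mul_le_mul e5 h1 (abs_nonneg _) ((abs_nonneg _).trans e5)
      have h4 := mul_le_mul h2 e6 (abs_nonneg _) zero_le_one
      linarith
    have hε : 0 ≤ M * ε := (abs_nonneg _).trans e5
    have := abs_sub_le (∑ k, J (shift (s k) x)) (∑ c, Θ x.1 c x.2) (W x)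
    linarith
  have hfin : |(∫ x, ∑ k, J (shift (s k) x) ∂μ) - ∫ x, W x ∂μ| ≤ M * (8 * ε) := by
    have hε : 0 ≤ M * (8 * ε) := by
      have := (abs_nonneg _).trans (hFM 0 0)
      linarith
    rw [← integral_sub (integrable_finsetSum _ fun k _ => hJki k) hWc.integrable_torus.integrableOn]
    refine (norm_setIntegral_le_of_norm_le_const (measure_lt_top _ _)
      (f := fun x => (∑ k, J (shift (s k) x)) - W x) hpt).trans ?_
    exact mul_le_of_le_one_right hε measureReal_le_one
  rw [← hsum, hWint, ← mul_sub, abs_mul] at hfin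
  have h2M : |((M + M : ℕ) : ℝ)| = 2 * M := by
    rw [abs_of_nonneg (by positivity)]; push_cast; ring
  rw [h2M] at hfin
  have h9 : 2 * M * |∫ x, J x ∂μ - r * AF * AG| ≤ 2 * M * (4 * ε) := by linarith
  exact le_of_mul_le_mul_left h9 (by positivity)

/-! ### Running averages along a circle -/

theorem integral_eq_floor_mul_add {f : ℝ → ℝ} (hf : Function.Periodic f 1)
    (hfi : ∀ a b, IntervalIntegrable f volume a b) (V : ℝ) :
    ∫ u in 0..V, f u = ⌊V⌋ * (∫ u in 0..1, f u) + ∫ u in 0..Int.fract V, f u := by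
  have h1 := hf.intervalIntegral_add_zsmul_eq ⌊V⌋ (Int.fract V) hfi
  rw [hf.intervalIntegral_add_eq (Int.fract V) 0, zero_add, zsmul_eq_mul, zsmul_eq_mul, mul_one,
    Int.fract_add_floor] at h1
  rw [← h1, add_comm, intervalIntegral.integral_add_adjacent_intervals (hfi _ _) (hfi _ _)]

/-- A periodic function of small mean has small running averages from some small starting time
on: a maximum point of `u ↦ ∫₀ᵘ (f - η)`. -/
theorem exists_running_average_le {f : ℝ → ℝ} (hf : Function.Periodic f 1)
    (hfi : ∀ a b, IntervalIntegrable f volume a b) (hf0 : ∀ u, 0 ≤ f u) {η₀ η : ℝ}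
    (hη₀ : ∫ u in 0..1, f u ≤ η₀) (hη : η₀ ≤ η) :
    ∃ u₀, 0 ≤ u₀ ∧ η * u₀ ≤ η₀ ∧ ∀ s, 0 ≤ s → ∫ u in u₀..u₀ + s, f u ≤ η * s := by
  let B : ℝ → ℝ := fun V => (∫ u in 0..V, f u) - η * V
  have hBc : Continuous B := (intervalIntegral.continuous_primitive hfi 0).sub (by fun_prop)
  obtain ⟨u₀, hu₀, hmax⟩ := isCompact_Icc.exists_isMaxOn (s := Icc (0 : ℝ) 1) ⟨0, by simp⟩
    hBc.continuousOn
  have hB : ∀ V, 0 ≤ V → B V ≤ B u₀ := by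
    intro V hV
    have h1 : B (Int.fract V) ≤ B u₀ := hmax ⟨Int.fract_nonneg V, (Int.fract_lt_one V).le⟩
    refine le_trans ?_ h1
    simp only [B]
    rw [integral_eq_floor_mul_add hf hfi V]
    have h2 : (0 : ℝ) ≤ ⌊V⌋ := by exact_mod_cast Int.floor_nonneg.2 hV
    have h3 := Int.floor_add_fract V
    have h4 : (⌊V⌋ : ℝ) * ∫ u in 0..1, f u ≤ ⌊V⌋ * η := by gcongr; linarith
    linear_combination h4 + η * h3
  refine ⟨u₀, hu₀.1, ?_, fun s hs => ?_⟩
  · have h0 : B 0 ≤ B u₀ := hB 0 le_rfl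
    simp only [B, intervalIntegral.integral_same] at h0
    have h1 : ∫ u in 0..u₀, f u ≤ ∫ u in 0..1, f u :=
      intervalIntegral.integral_mono_interval le_rfl hu₀.1 hu₀.2
        (Eventually.of_forall hf0) (hfi _ _)
    linarith
  · have h0 := hB (u₀ + s) (by linarith [hu₀.1])
    simp only [B] at h0
    rw [← intervalIntegral.integral_add_adjacent_intervals (hfi 0 u₀) (hfi u₀ (u₀ + s))] at h0
    linarith

/-- A function that vanishes on the first `D`-th part of every period and then runs through whole
periods of a function of mean zero has a small primitive. -/
theorem abs_integral_linger_le {g : ℝ → ℝ} (hg : Function.Periodic g 1) (hgc : Continuous g)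
    (hg0 : ∫ u in 0..1, g u = 0) {C : ℝ} (hgC : ∀ u, |g u| ≤ C) {D L : ℕ} (hD : 0 < D) (hL : 0 < L)
    {V : ℝ} :
    |∫ v in 0..V, if Int.fract v < 1 / D then 0 else g (D * L * v)| ≤ C / (D * L) ∧
      (0 ≤ V → V ≤ 1 / D → ∫ v in 0..V, (if Int.fract v < 1 / D then 0 else g (D * L * v)) = 0) := by
  have hD' : (0 : ℝ) < D := by exact_mod_cast hD
  have hD1 : (1 : ℝ) ≤ D := by exact_mod_cast hD
  have hL' : (0 : ℝ) < L := by exact_mod_cast hL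
  have hC : 0 ≤ C := (abs_nonneg _).trans (hgC 0)
  set G : ℝ → ℝ := fun v => if Int.fract v < 1 / D then 0 else g (D * L * v) with hG
  have hGm : Measurable G := Measurable.ite (measurableSet_lt measurable_fract measurable_const)
    measurable_const (by fun_prop)
  have hGb : ∀ v, |G v| ≤ C := by
    intro v; simp only [hG]; split_ifs
    · simpa using hC
    · exact hgC _
  have hGi : ∀ a b, IntervalIntegrable G volume a b := fun a b =>
    (intervalIntegrable_const (c := C)).mono_fun hGm.aestronglyMeasurable
      (Eventually.of_forall fun v => (hGb v).trans (le_abs_self C))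
  have hgi : ∀ a b, IntervalIntegrable g volume a b := fun a b => hgc.intervalIntegrable a b
  have hGp : Function.Periodic G 1 := by
    intro v
    simp only [hG, Int.fract_add_one]
    have e : (D : ℝ) * L * (v + 1) = D * L * v + ((D * L : ℕ) : ℤ) • (1 : ℝ) := by
      push_cast; simp; ring
    rw [e, hg.zsmul _ _]
  -- whole periods of `g` do not contribute to its primitive
  have hgint : ∀ k : ℕ, ∫ u in 0..(k : ℝ), g u = 0 := by
    intro k
    rw [integral_eq_floor_mul_add hg hgi]; simp [hg0]
  have hgb : ∀ V, |∫ u in 0..V, g u| ≤ C := by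
    intro V
    rw [integral_eq_floor_mul_add hg hgi, hg0, mul_zero, zero_add]
    refine (intervalIntegral.norm_integral_le_of_norm_le_const (f := g) (C := C) fun u _ => hgC u).trans ?_
    rw [sub_zero, abs_of_nonneg (Int.fract_nonneg V)]
    exact mul_le_of_le_one_right hC (Int.fract_lt_one V).le
  have hzero : ∀ w : ℝ, 0 ≤ w → w ≤ 1 / D → ∫ v in 0..w, G v = 0 := by
    intro w hw0 hw
    rw [intervalIntegral.integral_congr_Ioo_of_le (g := fun _ => (0 : ℝ)) hw0]
    · simp
    · intro v hv
      have hv1 : v < 1 / D := hv.2.trans_le hw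
      have : Int.fract v = v := Int.fract_eq_self.2 ⟨hv.1.le, hv1.trans_le (by
        rw [div_le_one hD']; exact hD1)⟩
      simp only [hG, this, hv1, if_true]
  have hlate : ∀ w : ℝ, 1 / D ≤ w → w ≤ 1 → ∫ v in (1 / D : ℝ)..w, G v =
      (D * L : ℝ)⁻¹ * ∫ u in 0..D * L * w, g u := by
    intro w hw0 hw
    rw [intervalIntegral.integral_congr_Ioo_of_le (g := fun v => g (D * L * v)) hw0,
      intervalIntegral.integral_comp_mul_left _ (by positivity), smul_eq_mul]
    · have e : (D : ℝ) * L * (1 / D) = L := by field_simp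
      rw [e, ← intervalIntegral.integral_add_adjacent_intervals (hgi 0 L) (hgi _ _), hgint, zero_add]
    · intro v hv
      have : Int.fract v = v := Int.fract_eq_self.2
        ⟨(by positivity : (0 : ℝ) ≤ 1 / D).trans hv.1.le, hv.2.trans_le hw⟩
      simp only [hG, this, hv.1.not_gt, if_false]
  have hone : ∫ v in 0..1, G v = 0 := by
    rw [← intervalIntegral.integral_add_adjacent_intervals (hGi 0 (1 / D)) (hGi _ _),
      hzero _ (by positivity) le_rfl, hlate 1 (by rw [div_le_one hD']; exact hD1) le_rfl, mul_one]
    have := hgint (D * L)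
    push_cast at this
    rw [this]; simp
  refine ⟨?_, hzero V⟩
  rw [integral_eq_floor_mul_add hGp hGi, hone, mul_zero, zero_add]
  rcases le_total (Int.fract V) (1 / D) with h | h
  · rw [hzero _ (Int.fract_nonneg V) h, abs_zero]; positivity
  · rw [← intervalIntegral.integral_add_adjacent_intervals (hGi 0 (1 / D)) (hGi _ _),
      hzero _ (by positivity) le_rfl, hlate _ h (Int.fract_lt_one V).le, zero_add, abs_mul,
      abs_of_pos (by positivity), inv_mul_eq_div]
    gcongr
    exact hgb _

/-- Running averages along an orbit that lingers at the height `c₀` during the first `D`-th part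
of every period `1/(2q)` and then sweeps quickly through all heights, up to an error on a set `B`
of small running averages. -/
theorem abs_integral_running_le {ψ : UnitAddCircle → ℝ} (hψ : Continuous ψ) (hψ1 : ∀ x, |ψ x| ≤ 1)
    (c₀ : UnitAddCircle) {q D L : ℕ} (hq : 0 < q) (hD : 0 < D) (hL : 0 < L) {ε : ℝ} (hε : 0 < ε)
    (hLε : 8 / ε ≤ L) {P : ℝ → ℝ} (hP : Continuous P) {B : Set ℝ}
    (hB : MeasurableSet B) (hP1 : ∀ u, |P u| ≤ 1)
    (hPQ : ∀ u, u ∉ B → |P u - if Int.fract (2 * q * u) < 1 / D then ψ c₀ else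
      ψ ((D * L * (2 * q * u) : ℝ) : UnitAddCircle)| ≤ ε)
    {u₀ : ℝ} (hu₀ : 0 ≤ u₀) (hu₀' : 2 * q * u₀ ≤ 1 / (2 * D))
    (hBavg : ∀ s, 0 ≤ s → ∫ u in u₀..u₀ + s, B.indicator 1 u ≤ ε * s) {s : ℝ} (hs : 0 ≤ s) :
    |∫ u in u₀..u₀ + s, (P u - ∫ x, ψ x)| ≤ s * (|ψ c₀ - ∫ x, ψ x| + 4 * ε) := by
  have hq' : (0 : ℝ) < q := by exact_mod_cast hq
  have hD' : (0 : ℝ) < D := by exact_mod_cast hD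
  have hL' : (0 : ℝ) < L := by exact_mod_cast hL
  set A := ∫ x, ψ x with hA
  have hA1 : |A| ≤ 1 := by
    have := norm_integral_le_of_norm_le_const (μ := (volume : Measure UnitAddCircle)) (f := ψ)
      (C := 1) (Eventually.of_forall hψ1)
    simpa using this
  let g : ℝ → ℝ := fun u => ψ u - A
  have hgc : Continuous g := (hψ.comp (AddCircle.continuous_mk' 1)).sub continuous_const
  have hgp : Function.Periodic g 1 := by
    intro u; simp only [g]; rw [AddCircle.coe_add_period]
  have hg0 : ∫ u in 0..1, g u = 0 := by
    have h1 := UnitAddCircle.intervalIntegral_preimage 0 ψ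
    rw [zero_add] at h1
    have hc : Continuous fun u : ℝ => ψ u := hψ.comp (AddCircle.continuous_mk' 1)
    simp only [g]
    rw [intervalIntegral.integral_sub (hc.intervalIntegrable _ _) intervalIntegrable_const, h1]
    simp [hA]
  have hg2 : ∀ u, |g u| ≤ 2 := fun u => (abs_sub _ _).trans (by linarith [hψ1 u])
  let Q : ℝ → ℝ := fun u => if Int.fract (2 * q * u) < 1 / D then ψ c₀ else
      ψ ((D * L * (2 * q * u) : ℝ) : UnitAddCircle)
  let G : ℝ → ℝ := fun v => if Int.fract v < 1 / D then 0 else g (D * L * v)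
  let N : ℝ → ℝ := fun v => if Int.fract v < 1 / D then ψ c₀ - A else 0
  have hGm : Measurable G := Measurable.ite (measurableSet_lt measurable_fract measurable_const)
    measurable_const (by fun_prop)
  have hNm : Measurable N := Measurable.ite (measurableSet_lt measurable_fract measurable_const)
    measurable_const measurable_const
  have hG2 : ∀ v, |G v| ≤ 2 := by
    intro v; simp only [G]; split_ifs
    · simp
    · exact hg2 _
  have hN2 : ∀ v, |N v| ≤ |ψ c₀ - A| := by
    intro v; simp only [N]; split_ifs
    · exact le_rfl
    · simp
  have hQ : ∀ u, Q u - A = N (2 * q * u) + G (2 * q * u) := by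
    intro u; simp only [Q, N, G, g]; split_ifs <;> ring
  have hBi : ∀ a b, IntervalIntegrable (B.indicator (1 : ℝ → ℝ)) volume a b := fun a b =>
    (intervalIntegrable_const (c := (1 : ℝ))).mono_fun
      (measurable_one.indicator hB).aestronglyMeasurable
      (Eventually.of_forall fun v => by
        rw [norm_one]; exact (norm_indicator_le_norm_self _ _).trans (by simp))
  have bdd : ∀ (f : ℝ → ℝ) (C : ℝ), Measurable f → (∀ u, |f u| ≤ C) → ∀ a b,
      IntervalIntegrable f volume a b := fun f C hf hfC a b =>
    (intervalIntegrable_const (c := C)).mono_fun hf.aestronglyMeasurable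
      (Eventually.of_forall fun v => (hfC v).trans (le_abs_self C))
  have hGi : ∀ a b, IntervalIntegrable (fun u => G (2 * q * u)) volume a b := bdd _ 2 (hGm.comp (g := G) (f := fun u : ℝ => 2 * q * u) (by fun_prop)) fun u => hG2 _
  have hNi : ∀ a b, IntervalIntegrable (fun u => N (2 * q * u)) volume a b := bdd _ _ (hNm.comp (g := N) (f := fun u : ℝ => 2 * q * u) (by fun_prop)) fun u => hN2 _
  have hE : ∀ u, |P u - A - (N (2 * q * u) + G (2 * q * u))| ≤ ε + 2 * B.indicator 1 u := by
    intro u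
    rw [← hQ]
    have e : P u - A - (Q u - A) = P u - Q u := by ring
    rw [e]
    by_cases hu : u ∈ B
    · have : |Q u| ≤ 1 := by simp only [Q]; split_ifs <;> exact hψ1 _
      rw [indicator_of_mem hu]
      simp only [Pi.one_apply]
      linarith [abs_sub (P u) (Q u), hP1 u]
    · rw [indicator_of_notMem hu]
      rw [mul_zero, add_zero]
      exact hPQ u hu
  have hb : u₀ ≤ u₀ + s := by linarith
  have hEi : IntervalIntegrable (fun u => P u - A - (N (2 * q * u) + G (2 * q * u))) volume u₀ (u₀ + s) :=
    ((hP.sub continuous_const).intervalIntegrable _ _).sub ((hNi _ _).add (hGi _ _))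
  have h1 : |∫ u in u₀..u₀ + s, (P u - A - (N (2 * q * u) + G (2 * q * u)))| ≤ 3 * ε * s := by
    refine (intervalIntegral.abs_integral_le_integral_abs hb).trans ?_
    refine (intervalIntegral.integral_mono_on hb hEi.abs
      (intervalIntegrable_const.add ((hBi _ _).const_mul 2)) fun u _ => hE u).trans ?_
    rw [intervalIntegral.integral_add intervalIntegrable_const ((hBi _ _).const_mul 2),
      intervalIntegral.integral_const_mul, intervalIntegral.integral_const, smul_eq_mul]
    linarith [hBavg s hs]
  have h2 : |∫ u in u₀..u₀ + s, N (2 * q * u)| ≤ s * |ψ c₀ - A| := by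
    have := intervalIntegral.norm_integral_le_of_norm_le_const (a := u₀) (b := u₀ + s)
      (f := fun u => N (2 * q * u)) (C := |ψ c₀ - A|) fun u _ => hN2 _
    rw [add_sub_cancel_left, abs_of_nonneg hs] at this
    exact this.trans_eq (mul_comm _ _)
  have h3 : |∫ u in u₀..u₀ + s, G (2 * q * u)| ≤ s * ε := by
    rw [intervalIntegral.integral_comp_mul_left _ (by positivity), smul_eq_mul, abs_mul,
      abs_of_pos (by positivity)]
    have hGi' := bdd G 2 hGm hG2
    have hlin := fun V => abs_integral_linger_le hgp hgc hg0 hg2 hD hL (V := V)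
    have h4 : 2 * q * u₀ ≤ 1 / D := hu₀'.trans (by gcongr; linarith)
    have e := intervalIntegral.integral_add_adjacent_intervals (hGi' 0 (2 * q * u₀))
      (hGi' _ (2 * q * (u₀ + s)))
    have e0 : ∫ v in 0..2 * q * u₀, G v = 0 := (hlin _).2 (by positivity) h4
    rw [e0, zero_add] at e
    rw [e]
    rcases le_total (2 * q * (u₀ + s)) (1 / D) with h | h
    · have e1 : ∫ v in 0..2 * q * (u₀ + s), G v = 0 := (hlin _).2 (by positivity) h
      rw [e1, abs_zero, mul_zero]; positivity
    · -- the time `s` is at least half of the lingering time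
      have h5 : |∫ v in 0..2 * q * (u₀ + s), G v| ≤ 2 / (D * L) := (hlin _).1
      have h6 : 1 / (2 * D) ≤ 2 * q * s := by
        have : (1 : ℝ) / D = 1 / (2 * D) + 1 / (2 * D) := by field_simp; norm_num
        linarith
      have h7 : 2 / (D * L) ≤ ε * (1 / (2 * D)) := by
        rw [div_le_iff₀ hε] at hLε
        rw [mul_one_div, div_le_div_iff₀ (by positivity) (by positivity)]
        nlinarith
      rw [inv_mul_le_iff₀ (by positivity)]
      nlinarith
  have hsplit : ∫ u in u₀..u₀ + s, (P u - A) =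
      (∫ u in u₀..u₀ + s, (P u - A - (N (2 * q * u) + G (2 * q * u)))) +
        ((∫ u in u₀..u₀ + s, N (2 * q * u)) + ∫ u in u₀..u₀ + s, G (2 * q * u)) := by
    rw [← intervalIntegral.integral_add (hNi _ _) (hGi _ _),
      ← intervalIntegral.integral_add hEi ((hNi _ _).add (hGi _ _))]
    congr 1; ext u; ring
  rw [hsplit]
  refine (abs_add_le _ _).trans ((add_le_add h1 ((abs_add_le _ _).trans (add_le_add h2 h3))).trans ?_)
  linarith

/-! ### Averages over horizontal circles -/

/-- The average of `F` over the horizontal circle at height `v`. -/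
def heightAverage (F : Torus → ℝ) (v : UnitAddCircle) : ℝ := ∫ u : UnitAddCircle, F (u, v)

theorem _root_.MeasureTheory.abs_integral_sub_integral_le {α : Type*} [MeasurableSpace α]
    {μ : Measure α} [IsFiniteMeasure μ] (hμ : μ.real univ ≤ 1) {f g : α → ℝ} (hf : Measurable f)
    (hg : Measurable g) (hf1 : ∀ x, |f x| ≤ 1) (hg1 : ∀ x, |g x| ≤ 1) {E : Set α} {δ : ℝ}
    (hE : MeasurableSet E) (hδ : 0 ≤ δ) (h : ∀ x ∉ E, |f x - g x| ≤ δ) :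
    |(∫ x, f x ∂μ) - ∫ x, g x ∂μ| ≤ δ + 2 * μ.real E := by
  have hfi : Integrable f μ := Integrable.of_bound hf.aestronglyMeasurable 1 (Eventually.of_forall hf1)
  have hgi : Integrable g μ := Integrable.of_bound hg.aestronglyMeasurable 1 (Eventually.of_forall hg1)
  have hEi : Integrable (E.indicator (1 : α → ℝ)) μ := (integrable_const 1).indicator hE
  rw [← integral_sub hfi hgi]
  refine abs_integral_le_integral_abs.trans ((integral_mono (g := fun x => δ + 2 * E.indicator 1 x)
    (hfi.sub hgi).abs ((integrable_const δ).add (hEi.const_mul 2)) fun x => ?_).trans ?_)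
  · change |f x - g x| ≤ δ + 2 * E.indicator 1 x
    by_cases hx : x ∈ E
    · rw [indicator_of_mem hx]
      simp only [Pi.one_apply]
      linarith [abs_sub (f x) (g x), hf1 x, hg1 x]
    · rw [indicator_of_notMem hx]
      simpa using h x hx
  · rw [integral_add (integrable_const δ) (hEi.const_mul 2), integral_const_mul,
      integral_indicator_one hE, integral_const, smul_eq_mul]
    nlinarith

theorem integrable_slice {F : Torus → ℝ} (hF : Continuous F) (v : UnitAddCircle) :
    Integrable (fun u : UnitAddCircle => F (u, v)) :=
  Continuous.integrable_circle (by fun_prop)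

theorem abs_heightAverage_le {F : Torus → ℝ} (hF1 : ∀ x, |F x| ≤ 1) (v : UnitAddCircle) :
    |heightAverage F v| ≤ 1 := by
  have := norm_integral_le_of_norm_le_const (μ := (volume : Measure UnitAddCircle))
    (f := fun u => F (u, v)) (C := 1) (Eventually.of_forall fun u => hF1 _)
  simpa [heightAverage] using this

theorem abs_heightAverage_sub_le {F : Torus → ℝ} (hF : Continuous F) {δ ε : ℝ}
    (h : ∀ x y, dist x y ≤ δ → |F x - F y| ≤ ε) {v w : UnitAddCircle} (hvw : dist v w ≤ δ) :
    |heightAverage F v - heightAverage F w| ≤ ε := by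
  rw [heightAverage, heightAverage, ← integral_sub (integrable_slice hF v) (integrable_slice hF w)]
  have := norm_integral_le_of_norm_le_const (μ := (volume : Measure UnitAddCircle))
    (f := fun u => F (u, v) - F (u, w)) (C := ε) (Eventually.of_forall fun u => h _ _ (by
      rw [Prod.dist_eq]; simp only [dist_self]; exact max_le (dist_nonneg.trans hvw) hvw))
  simpa using this

theorem continuous_heightAverage {F : Torus → ℝ} (hF : Continuous F) :
    Continuous (heightAverage F) := by
  have huc := CompactSpace.uniformContinuous_of_continuous hF
  rw [Metric.uniformContinuous_iff] at huc
  rw [Metric.continuous_iff]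
  intro v ε hε
  obtain ⟨δ, hδ, H⟩ := huc (ε / 2) (by positivity)
  refine ⟨δ / 2, by positivity, fun w hw => ?_⟩
  have h1 := abs_heightAverage_sub_le hF (δ := δ / 2) (ε := ε / 2) (fun x y hxy =>
    (H (a := x) (b := y) (by linarith)).le) hw.le
  rw [Real.dist_eq]; linarith

theorem integral_heightAverage {F : Torus → ℝ} (hF : Continuous F) :
    ∫ v, heightAverage F v = ∫ x, F x := by
  rw [Measure.volume_eq_prod, integral_prod_symm _ hF.integrable_torus]
  rfl

/-! ### A model map with a generic orbit -/

theorem dist_le_of_row_eq {R : ℕ} [NeZero R] {x y : UnitAddCircle} (h : row R x = row R y) :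
    dist x y ≤ 1 / R := by
  have hR : (0 : ℝ) < R := by exact_mod_cast Nat.pos_of_ne_zero (NeZero.ne R)
  obtain ⟨h1, h2⟩ := row_eq_iff.1 h
  obtain ⟨h3, h4⟩ := row_eq_iff.1 (rfl : row R y = row R y)
  rw [← coe_fr x, ← coe_fr y]
  refine (dist_coe_coe_le _ _).trans ?_
  rw [abs_le]
  constructor
  · rw [neg_le, le_div_iff₀ hR]; linarith
  · rw [le_div_iff₀ hR]; linarith

theorem isApproximable_modelMap {q : ℕ} (hq : 0 < q) (r M m : ℕ) [NeZero r] [NeZero M] :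
    IsApproximable q (modelMap q r M m) := by
  have h1 : (shearH fun v => m • v) = shearH fun v => ((m * fr v : ℝ) : UnitAddCircle) := by
    funext x
    simp only [shearH]
    rw [← nsmul_eq_mul, AddCircle.coe_nsmul, coe_fr]
  have h2 : IsApproximable q (shearH fun v => m • v) := by
    rw [h1]
    refine isApproximable_shearH (measurable_fr.const_mul _) (C := m) (fun x => ?_) q
    rw [abs_of_nonneg (mul_nonneg (Nat.cast_nonneg _) (fr_nonneg x))]
    exact mul_le_of_le_one_right (Nat.cast_nonneg _) (fr_lt_one x).le
  exact h2.comp (isApproximable_fiberPerm hq fun σ => measurableSet_fiber_of_row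
    (fun c => rotPerm r (rotIdx M c)) σ)

/-- The height at which the distinguished orbit is to be found over the column coordinate `v`:
it lingers at `c₀` and then sweeps through all heights. -/
def targetHeight (c₀ : UnitAddCircle) (D L : ℕ) (v : UnitAddCircle) : UnitAddCircle :=
  if fr v < 1 / D then c₀ else (D * L) • v

theorem measurable_targetHeight (c₀ : UnitAddCircle) (D L : ℕ) :
    Measurable (targetHeight c₀ D L) :=
  Measurable.ite (measurableSet_lt measurable_fr measurable_const) measurable_const
    (continuous_nsmul _).measurable

/-- The exchange of the row of `c₀` with the row that the model map moves to the target height. -/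
def detourPerm (r M D L : ℕ) [NeZero r] [NeZero M] (c₀ : UnitAddCircle) (v : UnitAddCircle) :
    Equiv.Perm (Fin (r * M)) :=
  Equiv.swap (row (r * M) c₀)
    ((rotPerm r (rotIdx M (row (M + M) v)))⁻¹ (row (r * M) (targetHeight c₀ D L v)))

/-- The model map, modified so that the orbit of the horizontal circles in the row of `c₀` follows
the target height. -/
def detourMap (q r M m D L : ℕ) [NeZero r] [NeZero M] (c₀ : UnitAddCircle) : Torus → Torus :=
  modelMap q r M m ∘ fiberPerm q (detourPerm r M D L c₀)

theorem measurableSet_detourPerm (r M D L : ℕ) [NeZero r] [NeZero M] (c₀ : UnitAddCircle)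
    (σ : Equiv.Perm (Fin (r * M))) : MeasurableSet {v | detourPerm r M D L c₀ v = σ} := by
  have h1 : Measurable fun v : UnitAddCircle =>
      (row (M + M) v, row (r * M) (targetHeight c₀ D L v)) :=
    (measurable_row _).prodMk ((measurable_row _).comp (measurable_targetHeight _ _ _))
  exact h1 (MeasurableSet.of_discrete (s := {c : Fin (M + M) × Fin (r * M) |
    Equiv.swap (row (r * M) c₀) ((rotPerm r (rotIdx M c.1))⁻¹ c.2) = σ}))

theorem isApproximable_detourMap {q : ℕ} (hq : 0 < q) (r M m D L : ℕ) [NeZero r] [NeZero M]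
    (c₀ : UnitAddCircle) : IsApproximable q (detourMap q r M m D L c₀) :=
  (isApproximable_modelMap hq r M m).comp
    (isApproximable_fiberPerm hq (measurableSet_detourPerm r M D L c₀))

theorem row_detourMap {q r M m D L : ℕ} [NeZero r] [NeZero M] {c₀ : UnitAddCircle} {x : Torus}
    (hx : row (r * M) x.2 = row (r * M) c₀) :
    row (r * M) (detourMap q r M m D L c₀ x).2 =
      row (r * M) (targetHeight c₀ D L ((2 * q) • x.1)) := by
  simp only [detourMap, Function.comp_apply, modelMap, shearH, fiberPerm, row_permRow, hx,
    detourPerm, Equiv.swap_apply_left]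
  rw [← Equiv.Perm.mul_apply, mul_inv_cancel, Equiv.Perm.one_apply]

theorem volume_row_snd {R : ℕ} [NeZero R] (a : Fin R) :
    volume {x : Torus | row R x.2 = a} = ENNReal.ofReal (1 / R) := by
  rw [← volume_annulus a, ofReal_measureReal]; rfl

/-- The modification changes at most two rows in every column. -/
theorem volume_detourMap_ne_le {q : ℕ} (hq : 0 < q) (r M m D L : ℕ) [NeZero r] [NeZero M]
    (c₀ : UnitAddCircle) :
    volume {x | detourMap q r M m D L c₀ x ≠ modelMap q r M m x} ≤
      ENNReal.ofReal (2 / (r * M : ℕ)) := by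
  set E : Set Torus := {x | row (r * M) x.2 = row (r * M) c₀}
  have hE : MeasurableSet E := measurableSet_annulus _
  have hp := (isApproximable_fiberPerm hq (measurableSet_detourPerm r M D L c₀)).measurePreserving
  have hsub : {x | detourMap q r M m D L c₀ x ≠ modelMap q r M m x} ⊆
      E ∪ fiberPerm q (detourPerm r M D L c₀) ⁻¹' E := by
    intro x hx
    by_contra hcon
    apply hx
    simp only [mem_union, not_or] at hcon
    obtain ⟨h1, h2⟩ := hcon
    have h1' : row (r * M) x.2 ≠ row (r * M) c₀ := h1
    have h2' : row (r * M) (fiberPerm q (detourPerm r M D L c₀) x).2 ≠ row (r * M) c₀ := h2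
    simp only [fiberPerm, row_permRow] at h2'
    have h3 : detourPerm r M D L c₀ ((2 * q) • x.1) (row (r * M) x.2) = row (r * M) x.2 := by
      apply Equiv.swap_apply_of_ne_of_ne h1'
      rintro h4
      apply h2'
      rw [h4]
      exact Equiv.swap_apply_right _ _
    have h4 : fiberPerm q (detourPerm r M D L c₀) x = x := by
      ext
      · rfl
      · simp only [fiberPerm, permRow, h3, sub_self, zero_div, AddCircle.coe_zero, add_zero]
    simp only [detourMap, Function.comp_apply, h4]
  refine (measure_mono hsub).trans ((measure_union_le _ _).trans ?_)
  rw [hp.measure_preimage hE.nullMeasurableSet, volume_row_snd, ← ENNReal.ofReal_add (by positivity)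
    (by positivity)]
  apply ENNReal.ofReal_le_ofReal
  rw [← add_div]; norm_num

/-- A set of small measure has a small slice in every row. -/
theorem exists_slice_le {R : ℕ} [NeZero R] (a : Fin R) {E : Set Torus} (hE : MeasurableSet E) {ε : ℝ}
    (hε : 0 ≤ ε) (h : volume E ≤ ENNReal.ofReal ε) :
    ∃ c, row R c = a ∧ volume.real {u : UnitAddCircle | (u, c) ∈ E} ≤ R * ε := by
  have hR : (0 : ℝ) < R := by exact_mod_cast Nat.pos_of_ne_zero (NeZero.ne R)
  have hv := volume_row a
  have hv' : volume {x : UnitAddCircle | row R x = a} = ENNReal.ofReal (1 / R) := by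
    rw [← hv, ofReal_measureReal]
  have hm := measurable_measure_prodMk_right (μ := (volume : Measure UnitAddCircle)) hE
  obtain ⟨c, hc, hle⟩ := exists_le_setLAverage (μ := (volume : Measure UnitAddCircle))
    (s := {x : UnitAddCircle | row R x = a})
    (f := fun c => volume ((fun u : UnitAddCircle => (u, c)) ⁻¹' E))
    (by rw [hv']; simpa using NeZero.ne R) (measure_ne_top _ _) hm.aemeasurable
  refine ⟨c, hc, ?_⟩
  rw [setLAverage_eq] at hle
  have h2 : ∫⁻ c in {x : UnitAddCircle | row R x = a},
      volume ((fun u : UnitAddCircle => (u, c)) ⁻¹' E) ≤ ENNReal.ofReal ε := by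
    refine (setLIntegral_le_lintegral _ _).trans ?_
    rw [← Measure.prod_apply_symm hE, ← Measure.volume_eq_prod]
    exact h
  have h3 := hle.trans (ENNReal.div_le_div_right h2 _)
  rw [hv', ← ENNReal.ofReal_div_of_pos (by positivity)] at h3
  have h4 := ENNReal.toReal_le_of_le_ofReal (by positivity) h3
  refine h4.trans (le_of_eq ?_)
  field_simp

/-! ### Properties of diffeomorphisms close to a model map -/

theorem measurableSet_dist_gt {f h : Torus → Torus} (hf : Measurable f) (hh : Measurable h) (δ : ℝ) :
    MeasurableSet {x | δ < dist (h x) (f x)} :=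
  measurableSet_lt measurable_const (hh.dist hf)

/-- A map close in measure to one that preserves the annuli almost preserves them. -/
theorem volume_row_ne_le {r : ℕ} [NeZero r] {f h : Torus → Torus}
    (hf : MeasurePreserving f (volume : Measure Torus) volume)
    (hrow : ∀ x, row r (f x).2 = row r x.2) {δ : ℝ} (hδ : 0 ≤ δ)
    (hvol : volume {x | δ < dist (h x) (f x)} ≤ ENNReal.ofReal δ) :
    volume {x | row r (h x).2 ≠ row r x.2} ≤ ENNReal.ofReal (δ + 2 * (r * δ)) := by
  have hr : 0 < r := Nat.pos_of_ne_zero (NeZero.ne r)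
  have hsub : {x | row r (h x).2 ≠ row r x.2} ⊆
      {x | δ < dist (h x) (f x)} ∪ f ⁻¹' (univ ×ˢ {v | ‖r • v‖ ≤ r * δ}) := by
    intro x hx
    by_cases hd : δ < dist (h x) (f x)
    · exact Or.inl hd
    · right
      rw [not_lt] at hd
      refine ⟨mem_univ _, ?_⟩
      have hx' : row r (h x).2 ≠ row r (f x).2 := by rw [hrow]; exact hx
      refine (norm_nsmul_le_of_row_ne hx').trans ?_
      gcongr
      refine le_trans ?_ hd
      rw [dist_comm, Prod.dist_eq]
      exact le_max_right _ _
  have hm : MeasurableSet {v : UnitAddCircle | ‖r • v‖ ≤ r * δ} :=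
    (isClosed_le (by fun_prop) continuous_const).measurableSet
  refine (measure_mono hsub).trans ((measure_union_le _ _).trans ?_)
  rw [hf.measure_preimage (MeasurableSet.univ.prod hm).nullMeasurableSet, Measure.volume_eq_prod,
    Measure.prod_prod, measure_univ, one_mul, ENNReal.ofReal_add hδ (by positivity)]
  exact add_le_add hvol (volume_norm_nsmul_le hr _)

/-- Correlations over an annulus hardly change under an approximation in measure. -/
theorem abs_correlation_sub_le {r : ℕ} [NeZero r] (i : Fin r) {f h : Torus → Torus}
    (hf : Measurable f) (hh : Measurable h) (t : UnitAddCircle) {F G : Torus → ℝ}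
    (hF : Continuous F) (hG : Continuous G) (hF1 : ∀ x, |F x| ≤ 1) (hG1 : ∀ x, |G x| ≤ 1)
    {δ ε : ℝ} (hδ : 0 ≤ δ) (hε : 0 ≤ ε)
    (hvol : volume {x | δ < dist (h x) (f x)} ≤ ENNReal.ofReal δ)
    (hFδ : ∀ x y, dist x y ≤ δ → |F x - F y| ≤ ε) (hGδ : ∀ x y, dist x y ≤ δ → |G x - G y| ≤ ε) :
    |(∫ x in annulus r i, F (h (shift t x)) * G (h x)) -
      ∫ x in annulus r i, F (f (shift t x)) * G (f x)| ≤ 2 * ε + 4 * δ := by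
  set E : Set Torus := {x | δ < dist (h x) (f x)} with hEdef
  have hE : MeasurableSet E := measurableSet_dist_gt hf hh δ
  have hS := measurePreserving_shift t
  have hE' : MeasurableSet (E ∪ shift t ⁻¹' E) := hE.union (hS.measurable hE)
  have hprod : ∀ a b : ℝ, |a| ≤ 1 → |b| ≤ 1 → |a * b| ≤ 1 := by
    intro a b ha hb
    rw [abs_mul]
    exact mul_le_one₀ ha (abs_nonneg _) hb
  have hEr : volume.real E ≤ δ := ENNReal.toReal_le_of_le_ofReal hδ hvol
  have hEr' : (volume.restrict (annulus r i)).real (E ∪ shift t ⁻¹' E) ≤ 2 * δ := by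
    have h1 : (volume.restrict (annulus r i)).real (E ∪ shift t ⁻¹' E) ≤
        volume.real (E ∪ shift t ⁻¹' E) :=
      ENNReal.toReal_mono (measure_ne_top _ _) (Measure.restrict_apply_le _ _)
    have h2 : volume.real (shift t ⁻¹' E) = volume.real E := by
      rw [measureReal_def, hS.measure_preimage hE.nullMeasurableSet, measureReal_def]
    have h3 := measureReal_union_le (μ := (volume : Measure Torus)) E (shift t ⁻¹' E)
    linarith
  have key := abs_integral_sub_integral_le (μ := volume.restrict (annulus r i))
    (f := fun x => F (h (shift t x)) * G (h x)) (g := fun x => F (f (shift t x)) * G (f x))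
    (E := E ∪ shift t ⁻¹' E) (δ := 2 * ε) (by
      rw [measureReal_restrict_apply_univ]; exact measureReal_le_one)
    ((hF.measurable.comp (hh.comp hS.measurable)).mul (hG.measurable.comp hh))
    ((hF.measurable.comp (hf.comp hS.measurable)).mul (hG.measurable.comp hf))
    (fun x => hprod _ _ (hF1 _) (hG1 _)) (fun x => hprod _ _ (hF1 _) (hG1 _)) hE' (by positivity) (by
      intro x hx
      simp only [mem_union, not_or] at hx
      have h1 : dist (h x) (f x) ≤ δ := not_lt.1 hx.1
      have h2 : dist (h (shift t x)) (f (shift t x)) ≤ δ := not_lt.1 hx.2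
      have e : F (h (shift t x)) * G (h x) - F (f (shift t x)) * G (f x) =
        F (h (shift t x)) * (G (h x) - G (f x)) +
          (F (h (shift t x)) - F (f (shift t x))) * G (f x) := by ring
      rw [e]
      refine (abs_add_le _ _).trans ?_
      rw [abs_mul, abs_mul]
      have h3 := mul_le_mul (hF1 (h (shift t x))) (hGδ _ _ h1) (abs_nonneg _) zero_le_one
      have h4 := mul_le_mul (hFδ _ _ h2) (hG1 (f x)) (abs_nonneg _) hε
      linarith)
  linarith

/-- A diffeomorphism close in measure to the detour map has an orbit of horizontal translations
whose running height averages are controlled by the average at the starting height. -/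
theorem exists_generic_start {q r M m D L : ℕ} [NeZero r] [NeZero M] (hq : 0 < q) (hD : 0 < D)
    (hL : 0 < L) {c₀ : UnitAddCircle} {h : Torus ≃ₜ Torus} {ε ε' δ : ℝ} (hε : 0 < ε) (hε1 : ε < 1)
    (hε' : 0 ≤ ε') (hRε : (r * M : ℕ) * ε' ≤ ε / (4 * q * D)) (hδ : ε' + 1 / (r * M : ℕ) ≤ δ)
    (hLε : 8 / ε ≤ L) (hDε : 1 / D ≤ ε)
    (hvol : volume {x | ε' < dist (h x) (detourMap q r M m D L c₀ x)} ≤ ENNReal.ofReal ε') :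
    ∃ z : Torus, dist (h z).2 c₀ ≤ δ ∧ ∀ ψ : UnitAddCircle → ℝ, Continuous ψ → (∀ v, |ψ v| ≤ 1) →
      (∀ v w, dist v w ≤ δ → |ψ v - ψ w| ≤ ε) →
      (∀ s, 0 ≤ s → |∫ u in 0..s, (ψ (h (shift (u : ℝ) z)).2 - ∫ v, ψ v)| ≤
        s * (|ψ c₀ - ∫ v, ψ v| + 4 * ε)) ∧
      |(∫ u : UnitAddCircle, ψ (h (u, z.2)).2) - ∫ v, ψ v| ≤ 5 * ε := by
  have hq' : (0 : ℝ) < q := by exact_mod_cast hq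
  have hD' : (0 : ℝ) < D := by exact_mod_cast hD
  have hD1 : (1 : ℝ) ≤ D := by exact_mod_cast hD
  have hq1 : (1 : ℝ) ≤ q := by exact_mod_cast hq
  have hΦ := (isApproximable_detourMap hq r M m D L c₀).measurePreserving.measurable
  obtain ⟨c, hc, hslice⟩ := exists_slice_le (row (r * M) c₀)
    (measurableSet_dist_gt hΦ h.continuous.measurable ε') hε' hvol
  set E : Set UnitAddCircle :=
    {u | ε' < dist (h (u, c)) (detourMap q r M m D L c₀ (u, c))} with hEdef
  have hE : MeasurableSet E :=
    measurable_prodMk_right (measurableSet_dist_gt hΦ h.continuous.measurable ε')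
  have hslice : volume.real E ≤ ε / (4 * q * D) := hslice.trans hRε
  have hη : ε / (4 * q * D) ≤ ε := div_le_self hε.le (by nlinarith)
  -- off the exceptional set, the height follows the target
  have hnear : ∀ u, u ∉ E → dist (h (u, c)).2 (targetHeight c₀ D L ((2 * q) • u)) ≤ δ := by
    intro u hu
    have h1 : dist (h (u, c)) (detourMap q r M m D L c₀ (u, c)) ≤ ε' := not_lt.1 hu
    have h2 := dist_le_of_row_eq (row_detourMap (q := q) (m := m) (D := D) (L := L) (x := (u, c)) hc)
    have h3 : dist (h (u, c)).2 (detourMap q r M m D L c₀ (u, c)).2 ≤ ε' :=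
      (le_max_right _ _).trans h1
    exact (dist_triangle _ _ _).trans ((add_le_add h3 h2).trans hδ)
  let B : Set ℝ := (fun u : ℝ => (u : UnitAddCircle)) ⁻¹' E
  have hB : MeasurableSet B := AddCircle.measurable_mk' hE
  have hBi : ∀ a b, IntervalIntegrable (B.indicator (1 : ℝ → ℝ)) volume a b := fun a b =>
    (intervalIntegrable_const (c := (1 : ℝ))).mono_fun
      (measurable_one.indicator hB).aestronglyMeasurable
      (Eventually.of_forall fun v => by
        rw [norm_one]; exact (norm_indicator_le_norm_self _ _).trans (by simp))
  have hBp : Function.Periodic (B.indicator (1 : ℝ → ℝ)) 1 := by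
    intro u
    have e : (u + 1 ∈ B) ↔ u ∈ B := by
      simp only [B, mem_preimage]; rw [AddCircle.coe_add_period]
    by_cases hu : u ∈ B
    · rw [indicator_of_mem hu, indicator_of_mem (e.2 hu)]; rfl
    · rw [indicator_of_notMem hu, indicator_of_notMem (fun h => hu (e.1 h))]
  have hB1 : ∫ u in 0..1, B.indicator (1 : ℝ → ℝ) u = volume.real E := by
    have h1 := UnitAddCircle.intervalIntegral_preimage 0 (E.indicator (1 : UnitAddCircle → ℝ))
    rw [zero_add, integral_indicator_one hE] at h1
    exact h1
  obtain ⟨u₀, hu₀, hηu₀, hrun⟩ := exists_running_average_le hBp hBi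
    (fun u => indicator_nonneg (fun _ _ => zero_le_one) u) (hB1.trans_le hslice) hη
  have hu₀D : u₀ ≤ 1 / (4 * q * D) := by
    have : ε * u₀ ≤ ε * (1 / (4 * q * D)) := by rw [mul_one_div]; exact hηu₀
    exact le_of_mul_le_mul_left this hε
  have hu₀' : 2 * q * u₀ ≤ 1 / (2 * D) := by
    have : 2 * q * u₀ ≤ 2 * q * (1 / (4 * q * D)) := by gcongr
    refine this.trans (le_of_eq ?_)
    field_simp; norm_num
  have hfr : ∀ u : ℝ, fr ((2 * q) • (u : UnitAddCircle)) = Int.fract (2 * q * u) := by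
    intro u
    rw [← AddCircle.coe_nsmul, fr_coe, nsmul_eq_mul]; push_cast; rfl
  have hmul : ∀ u : ℝ, (D * L) • (2 * q) • (u : UnitAddCircle) =
      ((D * L * (2 * q * u) : ℝ) : UnitAddCircle) := by
    intro u
    rw [← AddCircle.coe_nsmul, ← AddCircle.coe_nsmul, nsmul_eq_mul, nsmul_eq_mul]; push_cast; rfl
  refine ⟨((u₀ : UnitAddCircle), c), ?_, fun ψ hψ hψ1 hψδ => ⟨fun s hs => ?_, ?_⟩⟩
  · by_contra hcon
    rw [not_le] at hcon
    have hcont : Continuous fun u : ℝ => dist (h ((u : UnitAddCircle), c)).2 c₀ := by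
      have := h.continuous
      have := AddCircle.continuous_mk' (1 : ℝ)
      fun_prop
    obtain ⟨ρ, hρ, H⟩ := Metric.eventually_nhds_iff.1
      (hcont.continuousAt.eventually (lt_mem_nhds hcon))
    set s := min (ρ / 2) (1 / (8 * q * D)) with hs
    have hs0 : 0 < s := lt_min (by positivity) (by positivity)
    have hall : ∀ u ∈ Icc u₀ (u₀ + s), u ∈ B := by
      intro u hu
      by_contra huB
      have h1 := H (y := u) (by
        rw [Real.dist_eq, abs_of_nonneg (by linarith [hu.1])]
        linarith [hu.2, min_le_left (ρ / 2) (1 / (8 * q * D) : ℝ)])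
      have h2 := hnear _ huB
      have h3 : 2 * q * u < 1 / D := by
        have h4 : u ≤ 1 / (4 * q * D) + 1 / (8 * q * D) := by
          linarith [hu.2, min_le_right (ρ / 2) (1 / (8 * q * D) : ℝ)]
        have h5 : 2 * q * u ≤ 2 * q * (1 / (4 * q * D) + 1 / (8 * q * D)) := by gcongr
        refine h5.trans_lt ?_
        have : 2 * q * (1 / (4 * q * D) + 1 / (8 * q * D)) = 3 / 4 * (1 / (D : ℝ)) := by
          field_simp; norm_num
        rw [this]
        have : (0 : ℝ) < 1 / D := by positivity
        linarith
      have h6 : targetHeight c₀ D L ((2 * q) • (u : UnitAddCircle)) = c₀ := by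
        rw [targetHeight, if_pos]
        rw [hfr, Int.fract_eq_self.2 ⟨by nlinarith [hu.1], h3.trans_le (by
          rw [div_le_one hD']; exact hD1)⟩]
        exact h3
      rw [h6] at h2
      linarith
    have h1 := hrun s hs0.le
    rw [intervalIntegral.integral_congr (g := fun _ => (1 : ℝ)) (fun u hu => by
      rw [uIcc_of_le (by linarith)] at hu
      exact indicator_of_mem (hall u hu) _)] at h1
    simp only [intervalIntegral.integral_const, add_sub_cancel_left, smul_eq_mul, mul_one] at h1
    nlinarith
  · have hP : Continuous fun u : ℝ => ψ (h ((u : UnitAddCircle), c)).2 := by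
      have := h.continuous
      have := AddCircle.continuous_mk' (1 : ℝ)
      fun_prop
    have h1 := abs_integral_running_le hψ hψ1 c₀ hq hD hL hε hLε hP hB (fun _ => hψ1 _) (by
      intro u hu
      have h2 := hψδ _ _ (hnear u hu)
      rw [targetHeight, hfr, hmul, apply_ite ψ] at h2
      exact h2) hu₀ hu₀' hrun hs
    refine le_trans (le_of_eq ?_) h1
    have h3 := intervalIntegral.integral_comp_add_left (a := 0) (b := s)
      (fun u : ℝ => ψ (h ((u : UnitAddCircle), c)).2 - ∫ x, ψ x) u₀
    rw [add_zero] at h3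
    rw [← h3]
    rfl
  · have h1 : ∫ v, ψ v = ∫ u : UnitAddCircle, ψ ((D * L) • (2 * q) • u) := by
      have hDL : 0 < D * L := Nat.mul_pos hD hL
      rw [(measurePreserving_nsmul (q := 2 * q) (by omega)).integral_comp_of_aestronglyMeasurable
        (g := fun v => ψ ((D * L) • v)) (by
          exact (hψ.comp (continuous_nsmul _)).aestronglyMeasurable)]
      rw [(measurePreserving_nsmul hDL).integral_comp_of_aestronglyMeasurable
        hψ.aestronglyMeasurable]
    have hDn : NeZero D := ⟨hD.ne'⟩
    set E₂ : Set UnitAddCircle := (fun u => (2 * q) • u) ⁻¹' {v | row D v = 0} with hE₂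
    have hE₂v : volume.real E₂ = 1 / D := by
      rw [measureReal_def, (measurePreserving_nsmul (q := 2 * q) (by omega)).measure_preimage
        (measurableSet_row _).nullMeasurableSet, ← measureReal_def, volume_row]
    have hE₂m : MeasurableSet E₂ := (continuous_nsmul _).measurable (measurableSet_row _)
    rw [h1]
    have key := abs_integral_sub_integral_le (μ := (volume : Measure UnitAddCircle))
      (f := fun u => ψ (h (u, c)).2) (g := fun u => ψ ((D * L) • (2 * q) • u)) (E := E ∪ E₂)
      (δ := ε) measureReal_le_one (by
        have := h.continuous
        exact Continuous.measurable (by fun_prop)) (by exact Continuous.measurable (by fun_prop))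
      (fun _ => hψ1 _) (fun _ => hψ1 _) (hE.union hE₂m) hε.le (by
        intro u hu
        simp only [mem_union, not_or] at hu
        have h2 := hψδ _ _ (hnear u hu.1)
        rw [targetHeight, if_neg] at h2
        · exact h2
        · intro hlt
          apply hu.2
          change row D ((2 * q) • u) = 0
          rw [row_eq_iff]
          rw [lt_div_iff₀ hD'] at hlt
          simp only [Fin.val_zero, Nat.cast_zero, zero_add]
          exact ⟨mul_nonneg hD'.le (fr_nonneg _), by linarith⟩)
    have h3 := measureReal_union_le (μ := (volume : Measure UnitAddCircle)) E E₂
    have h4 : volume.real E ≤ ε / 4 := by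
      refine hslice.trans ?_
      gcongr
      nlinarith
    linarith

/-! ### The conjugating diffeomorphism of one step -/

/-- For a finite family of functions that vary slowly at the scale `1/q`, there is an entire
diffeomorphism commuting with `S_{1/q}` that maps horizontal circles to dense curves, almost
preserves the annuli, decorrelates points from their translates by `1/(4q)` inside every annulus,
and has an orbit of translations along which all height averages are controlled. -/
theorem exists_design (r : ℕ) [NeZero r] {q : ℕ} (hq : 0 < q) {ι : Type*} [Finite ι]
    {F : ι → Torus → ℝ} (hF : ∀ j, Continuous (F j)) (hF1 : ∀ j x, |F j x| ≤ 1) {ε : ℝ} (hε : 0 < ε)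
    (hε1 : ε < 1) {κ : ℝ} (hκ : 0 < κ) (hslow : ∀ j x y, dist x y ≤ 1 / q → |F j x - F j y| ≤ ε) (y : Torus) :
    ∃ h : Torus ≃ₜ Torus, IsEntire q h ∧
      (∀ (x₂ : UnitAddCircle) (z : Torus), ∃ x₁, dist (h (x₁, x₂)) z ≤ κ + 1 / q) ∧
      volume {x | row r (h x).2 ≠ row r x.2} ≤ ENNReal.ofReal κ ∧
      (∀ j k i, |(∫ x in annulus r i, F j (h (shift (quarter q) x)) * F k (h x)) -
        r * (∫ x in annulus r i, F j x) * ∫ x in annulus r i, F k x| ≤ 10 * ε) ∧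
      ∃ z : Torus, dist (h z) y ≤ κ + 1 / q ∧
        (∀ j s, 0 ≤ s →
          |∫ u in 0..s, (heightAverage (F j) (h (shift (u : ℝ) z)).2 - ∫ x, F j x)| ≤
            s * (|heightAverage (F j) y.2 - ∫ x, F j x| + 4 * ε)) ∧
        ∀ j, |(∫ u : UnitAddCircle, heightAverage (F j) (h (u, z.2)).2) - ∫ x, F j x| ≤ 5 * ε := by
  cases nonempty_fintype ι
  have hq' : (0 : ℝ) < q := by exact_mod_cast hq
  have hr1 : (1 : ℝ) ≤ r := by exact_mod_cast Nat.pos_of_ne_zero (NeZero.ne r)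
  -- a common modulus of continuity `δ`, small compared with the size of the annuli
  obtain ⟨δ₀, hδ₀, Hδ₀⟩ := Metric.uniformContinuous_iff.1
    (CompactSpace.uniformContinuous_of_continuous (continuous_pi hF)) ε hε
  set δ : ℝ := min (δ₀ / 2) (min ε κ / (4 * r)) with hδdef
  have hεκ : 0 < min ε κ := lt_min hε hκ
  have hδ : 0 < δ := lt_min (by positivity) (by positivity)
  have hδε : 4 * (r * δ) ≤ min ε κ := by
    have : δ ≤ min ε κ / (4 * r) := min_le_right _ _
    rw [le_div_iff₀ (by positivity)] at this
    linarith
  have hδε' : 4 * δ ≤ ε := by nlinarith [min_le_left ε κ]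
  have hδκ : 4 * δ ≤ κ := by nlinarith [min_le_right ε κ]
  have hFδ : ∀ j x y, dist x y ≤ δ → |F j x - F j y| ≤ ε := by
    intro j x y hxy
    have h1 : dist (fun j => F j x) (fun j => F j y) < ε :=
      Hδ₀ (by linarith [min_le_left (δ₀ / 2) (min ε κ / (4 * r))])
    exact (dist_le_pi_dist (fun j => F j x) (fun j => F j y) j).trans h1.le
  obtain ⟨m, hm, hm0⟩ := ((eventually_all.2 fun j =>
    eventually_row_average (r := r) (hF j) (hF1 j) hε).and (eventually_gt_atTop 0)).exists
  choose M₀ hM₀ using hm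
  obtain ⟨M, hMsup, hM0, hMδ⟩ : ∃ M : ℕ, Finset.univ.sup M₀ ≤ M ∧ 0 < M ∧ 4 / δ ≤ M := by
    obtain ⟨M₁, hM₁⟩ := exists_nat_ge (4 / δ)
    refine ⟨max (max (Finset.univ.sup M₀) M₁) 1, by simp, by simp, hM₁.trans ?_⟩
    exact_mod_cast (le_max_right _ _).trans (le_max_left _ _)
  have : NeZero M := ⟨hM0.ne'⟩
  have hM0' : (0 : ℝ) < M := by exact_mod_cast hM0
  have hMj : ∀ j, M₀ j ≤ M := fun j => (Finset.le_sup (Finset.mem_univ j)).trans hMsup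
  have hR0 : (0 : ℝ) < (r * M : ℕ) := by push_cast; positivity
  have hR : 4 / δ ≤ (r * M : ℕ) := by
    push_cast
    nlinarith
  have hR' : 4 / ((r * M : ℕ) : ℝ) ≤ δ := by
    rw [div_le_iff₀ hδ] at hR
    rw [div_le_iff₀ hR0]; linarith
  obtain ⟨D, hD⟩ := exists_nat_gt (1 / ε)
  have hD0 : (0 : ℝ) < D := (by positivity : (0 : ℝ) < 1 / ε).trans hD
  obtain ⟨L, hL⟩ := exists_nat_gt (8 / ε)
  have hL0 : (0 : ℝ) < L := (by positivity : (0 : ℝ) < 8 / ε).trans hL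
  have hDε : 1 / (D : ℝ) ≤ ε := by
    rw [div_le_iff₀ hD0]; rw [div_lt_iff₀ hε] at hD; linarith
  set ε' : ℝ := min (δ / 2) (ε / (4 * q * D) / (r * M : ℕ)) with hε'
  have hε'0 : 0 < ε' := lt_min (by positivity) (by positivity)
  have hε'1 : ε' ≤ δ / 2 := min_le_left _ _
  have hRε : (r * M : ℕ) * ε' ≤ ε / (4 * q * D) := by
    have h1 : ε' ≤ ε / (4 * q * D) / (r * M : ℕ) := min_le_right _ _
    rw [le_div_iff₀ hR0] at h1
    linarith
  have hinv : 1 / ((r * M : ℕ) : ℝ) = 4 / ((r * M : ℕ) : ℝ) / 4 := by ring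
  have hinv2 : 2 / ((r * M : ℕ) : ℝ) = 4 / ((r * M : ℕ) : ℝ) / 2 := by ring
  have happ := isApproximable_detourMap hq r M m D L y.2
  obtain ⟨h, hh, hvol, hmin⟩ := happ.exists_dense hq hε'0
  have hmod := (isApproximable_modelMap hq r M m).measurePreserving
  -- the model map itself is also close to `h` in measure
  have hvol' : volume {x | δ < dist (h x) (modelMap q r M m x)} ≤ ENNReal.ofReal δ := by
    have hsub : {x | δ < dist (h x) (modelMap q r M m x)} ⊆
        {x | ε' < dist (h x) (detourMap q r M m D L y.2 x)} ∪
          {x | detourMap q r M m D L y.2 x ≠ modelMap q r M m x} := by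
      intro x hx
      by_contra hcon
      simp only [mem_union, not_or] at hcon
      have h1 : dist (h x) (detourMap q r M m D L y.2 x) ≤ ε' := not_lt.1 hcon.1
      have h2 : detourMap q r M m D L y.2 x = modelMap q r M m x := not_not.1 hcon.2
      rw [h2] at h1
      have hx' : δ < dist (h x) (modelMap q r M m x) := hx
      linarith
    refine (measure_mono hsub).trans ((measure_union_le _ _).trans ((add_le_add hvol
      (volume_detourMap_ne_le hq r M m D L y.2)).trans ?_))
    rw [← ENNReal.ofReal_add hε'0.le (by positivity)]
    apply ENNReal.ofReal_le_ofReal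
    linarith
  obtain ⟨z₀, hz₀, hgen⟩ := exists_generic_start hq (by exact_mod_cast hD0) (by exact_mod_cast hL0)
    hε hε1 hε'0.le hRε (δ := δ) (by linarith) hL.le hDε hvol
  obtain ⟨Φ, Φ', hΦ⟩ := hh
  obtain ⟨j, hj⟩ := exists_int_div_near hq (h z₀).1 y.1
  have hψ1 : ∀ j v, |heightAverage (F j) v| ≤ 1 := fun j => abs_heightAverage_le (hF1 j)
  have hψδ : ∀ j v w, dist v w ≤ δ → |heightAverage (F j) v - heightAverage (F j) w| ≤ ε :=
    fun j v w => abs_heightAverage_sub_le (hF j) (hFδ j)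
  refine ⟨h, ⟨Φ, Φ', hΦ⟩, fun x₂ z => ?_, ?_, fun j k i => ?_,
    shift ((j / q : ℝ) : UnitAddCircle) z₀, ?_, fun j' s hs => ?_, fun j' => ?_⟩
  · obtain ⟨x₁, hx₁⟩ := hmin x₂ z
    exact ⟨x₁, hx₁.trans (by linarith)⟩
  · refine (volume_row_ne_le hmod (row_snd_modelMap q r M m) hδ.le hvol').trans
      (ENNReal.ofReal_le_ofReal ?_)
    nlinarith [min_le_right ε κ]
  · have h1 := abs_correlation_sub_le i hmod.measurable h.continuous.measurable (quarter q) (hF j)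
      (hF k) (hF1 j) (hF1 k) hδ.le hε.le hvol' (hFδ j) (hFδ k)
    have h2 := abs_integral_modelMap_sub_le hq hm0 (hF j) (hF k) (hF1 j) (hF1 k) (hslow j) (hslow k)
      (hM₀ j M (hMj j)) (hM₀ k M (hMj k)) i
    refine (abs_sub_le _ _ _).trans ((add_le_add h1 h2).trans ?_)
    linarith
  · rw [hΦ.lift.apply_shift, shift_apply, Prod.dist_eq]
    exact max_le (hj.trans (by linarith)) (hz₀.trans (by
      have : (0 : ℝ) < 1 / q := by positivity
      linarith))
  · have h1 := (hgen _ (continuous_heightAverage (hF j')) (hψ1 j') (hψδ j')).1 s hs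
    rw [integral_heightAverage (hF j')] at h1
    refine le_trans (le_of_eq ?_) h1
    congr 2
    ext u
    have e : shift (u : UnitAddCircle) (shift ((j / q : ℝ) : UnitAddCircle) z₀) =
        shift ((j / q : ℝ) : UnitAddCircle) (shift (u : UnitAddCircle) z₀) := by
      simp only [shift_apply]; rw [add_right_comm]
    rw [e, hΦ.lift.apply_shift]
    rfl
  · have h1 := (hgen _ (continuous_heightAverage (hF j')) (hψ1 j') (hψδ j')).2
    rw [integral_heightAverage (hF j')] at h1
    exact h1

/-! ### Riemann sums and orbits of rational rotations -/

/-- Riemann sums with spacing `1/Q` of a function that varies little at this scale. -/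
theorem abs_sum_sub_integral_le {φ : ℝ → ℝ} (hφ : Continuous φ) {Q : ℕ} (hQ : 0 < Q) {ε : ℝ}
    (h : ∀ u v : ℝ, |u - v| ≤ 1 / Q → |φ u - φ v| ≤ ε) (N : ℕ) :
    |(∑ i ∈ Finset.range N, φ (i / Q)) - Q * ∫ u in 0..N / Q, φ u| ≤ N * ε := by
  have hQ' : (0 : ℝ) < Q := by exact_mod_cast hQ
  induction N with
  | zero => simp
  | succ N ih =>
    have h1 : |φ (N / Q) - Q * ∫ u in (N / Q : ℝ)..(N + 1 : ℕ) / Q, φ u| ≤ ε := by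
      have e : φ (N / Q) - Q * ∫ u in (N / Q : ℝ)..(N + 1 : ℕ) / Q, φ u =
          Q * ∫ u in (N / Q : ℝ)..(N + 1 : ℕ) / Q, (φ (N / Q) - φ u) := by
        rw [intervalIntegral.integral_sub intervalIntegrable_const (hφ.intervalIntegrable _ _),
          intervalIntegral.integral_const, smul_eq_mul]
        push_cast; field_simp; ring
      have hle : (N / Q : ℝ) ≤ (N + 1 : ℕ) / Q := by gcongr; simp
      have h2 := intervalIntegral.norm_integral_le_of_norm_le_const (a := (N / Q : ℝ))
        (b := (N + 1 : ℕ) / Q) (f := fun u => φ (N / Q) - φ u) (C := ε) (fun u hu => by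
          rw [uIoc_of_le hle] at hu
          apply h
          have h3 : ((N + 1 : ℕ) : ℝ) / Q = N / Q + 1 / Q := by push_cast; ring
          rw [abs_le]
          constructor <;> linarith [hu.1, hu.2, (by positivity : (0 : ℝ) < 1 / Q)])
      have h3 : ((N + 1 : ℕ) : ℝ) / Q - N / Q = 1 / Q := by push_cast; ring
      rw [h3, abs_of_pos (by positivity)] at h2
      rw [e, abs_mul, abs_of_pos hQ']
      calc Q * |∫ u in (N / Q : ℝ)..(N + 1 : ℕ) / Q, (φ (N / Q) - φ u)| ≤ Q * (ε * (1 / Q)) := by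
            gcongr; exact h2
        _ = ε := by field_simp
    rw [Finset.sum_range_succ, ← intervalIntegral.integral_add_adjacent_intervals
      (hφ.intervalIntegrable 0 (N / Q)) (hφ.intervalIntegrable _ _)]
    have e2 : ∀ a b c d : ℝ, a + b - Q * (c + d) = (a - Q * c) + (b - Q * d) := by intros; ring
    rw [e2]
    refine (abs_add_le _ _).trans ((add_le_add ih h1).trans (le_of_eq ?_))
    push_cast; ring

/-- Replacing a bounded sequence by its moving averages of length `q` changes its partial sums by
at most `2q`. -/
theorem abs_sum_sub_sum_average_le {a : ℕ → ℝ} (ha : ∀ i, |a i| ≤ 1) {q : ℕ} (hq : 0 < q) (N : ℕ) :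
    |(∑ i ∈ Finset.range N, a i) -
      ∑ i ∈ Finset.range N, (q : ℝ)⁻¹ * ∑ b ∈ Finset.range q, a (i + b)| ≤ 2 * q := by
  have hq' : (0 : ℝ) < q := by exact_mod_cast hq
  have h1 : ∀ b : ℕ, |(∑ i ∈ Finset.range N, a i) - ∑ i ∈ Finset.range N, a (i + b)| ≤ 2 * b := by
    intro b
    induction b with
    | zero => simp
    | succ b ih =>
      have h2 : (∑ i ∈ Finset.range N, a (i + (b + 1))) - ∑ i ∈ Finset.range N, a (i + b) =
          a (N + b) - a b := by
        rw [← Finset.sum_sub_distrib]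
        have := Finset.sum_range_sub (fun i => a (i + b)) N
        simpa [add_assoc, add_comm 1 b] using this
      have e : (∑ i ∈ Finset.range N, a i) - ∑ i ∈ Finset.range N, a (i + (b + 1)) =
          ((∑ i ∈ Finset.range N, a i) - ∑ i ∈ Finset.range N, a (i + b)) - (a (N + b) - a b) := by
        rw [← h2]; ring
      rw [e]
      refine (abs_sub _ _).trans ((add_le_add ih ((abs_sub _ _).trans
        (add_le_add (ha _) (ha _)))).trans (le_of_eq ?_))
      push_cast; ring
  have e : (∑ i ∈ Finset.range N, a i) -
      ∑ i ∈ Finset.range N, (q : ℝ)⁻¹ * ∑ b ∈ Finset.range q, a (i + b) =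
      (q : ℝ)⁻¹ * ∑ b ∈ Finset.range q,
        ((∑ i ∈ Finset.range N, a i) - ∑ i ∈ Finset.range N, a (i + b)) := by
    rw [← Finset.mul_sum, Finset.sum_comm, Finset.sum_sub_distrib, Finset.sum_const,
      Finset.card_range, nsmul_eq_mul]
    field_simp
  rw [e, abs_mul, abs_of_pos (by positivity), inv_mul_le_iff₀ hq']
  refine (Finset.abs_sum_le_sum_abs _ _).trans ((Finset.sum_le_sum fun b hb => (h1 b).trans
    (?_ : _ ≤ 2 * (q : ℝ))).trans (le_of_eq ?_))
  · have : (b : ℝ) ≤ q := by exact_mod_cast (Finset.mem_range.1 hb).le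
    linarith
  · simp

theorem toAddCircle_mul_intCast {q : ℕ} [NeZero q] (p : ℤ) (c : ZMod q) :
    ZMod.toAddCircle (c * (p : ZMod q)) = c.val • ((p / q : ℝ) : UnitAddCircle) := by
  conv_lhs => rw [← ZMod.natCast_zmod_val c]
  rw [← nsmul_eq_mul, map_nsmul, ZMod.toAddCircle_intCast]

theorem isUnit_intCast_zmod {q : ℕ} {p : ℤ} (h : IsCoprime p (q : ℤ)) : IsUnit (p : ZMod q) := by
  obtain ⟨a, b, hab⟩ := h
  have := congrArg (Int.cast : ℤ → ZMod q) hab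
  push_cast at this
  rw [ZMod.natCast_self, mul_zero, add_zero] at this
  exact IsUnit.of_mul_eq_one_right _ this

theorem exists_nsmul_eq {q : ℕ} (hq : 0 < q) {p : ℤ} (h : IsCoprime p (q : ℤ)) (j : ℤ) :
    ∃ i < q, i • ((p / q : ℝ) : UnitAddCircle) = ((j / q : ℝ) : UnitAddCircle) := by
  have : NeZero q := ⟨hq.ne'⟩
  obtain ⟨u, hu⟩ := isUnit_intCast_zmod h
  refine ⟨((j : ZMod q) * (u⁻¹ : (ZMod q)ˣ)).val, ZMod.val_lt _, ?_⟩
  rw [← toAddCircle_mul_intCast, ← hu, mul_assoc, Units.inv_mul, mul_one, ZMod.toAddCircle_intCast]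

theorem sum_range_nsmul {q : ℕ} (hq : 0 < q) {p : ℤ} (h : IsCoprime p (q : ℤ))
    (g : UnitAddCircle → ℝ) :
    ∑ b ∈ Finset.range q, g (b • ((p / q : ℝ) : UnitAddCircle)) =
      ∑ b ∈ Finset.range q, g ((b / q : ℝ) : UnitAddCircle) := by
  have : NeZero q := ⟨hq.ne'⟩
  obtain ⟨u, hu⟩ := isUnit_intCast_zmod h
  have key : ∀ g : ℕ → ℝ, ∑ b ∈ Finset.range q, g b = ∑ c : ZMod q, g c.val := by
    intro g
    refine Finset.sum_nbij' (fun b => (b : ZMod q)) ZMod.val (by simp) (fun c _ => by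
      simpa using ZMod.val_lt c) (fun b hb => ZMod.val_cast_of_lt (Finset.mem_range.1 hb))
      (fun c _ => ZMod.natCast_zmod_val c) fun b hb => by
        rw [ZMod.val_cast_of_lt (Finset.mem_range.1 hb)]
  rw [key, key]
  simp only [← toAddCircle_mul_intCast, ← hu]
  rw [← Equiv.sum_comp (Units.mulRight u) fun c : ZMod q => g ((c.val / q : ℝ) : UnitAddCircle)]
  refine Finset.sum_congr rfl fun c _ => ?_
  rw [Units.mulRight_apply, ← ZMod.toAddCircle_apply]

/-- The average over a periodic orbit of a function that varies slowly at the scale of the orbit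
is close to the average over the horizontal circle. -/
theorem abs_orbit_average_sub_heightAverage_le {F : Torus → ℝ} (hF : Continuous F) {q : ℕ}
    (hq : 0 < q) {p : ℤ} (hpq : IsCoprime p (q : ℤ)) {ε : ℝ}
    (hslow : ∀ x y, dist x y ≤ 1 / q → |F x - F y| ≤ ε) (w : Torus) :
    |(q : ℝ)⁻¹ * (∑ b ∈ Finset.range q, F (shift (b • ((p / q : ℝ) : UnitAddCircle)) w)) -
      heightAverage F w.2| ≤ ε := by
  have hq' : (0 : ℝ) < q := by exact_mod_cast hq
  rw [sum_range_nsmul hq hpq fun t => F (shift t w)]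
  have hc : Continuous fun t : UnitAddCircle => F (shift t w) := by
    simp only [shift_apply]; fun_prop
  have h1 := abs_sum_sub_integral_le (φ := fun u : ℝ => F (shift (u : UnitAddCircle) w))
    (hc.comp (AddCircle.continuous_mk' 1)) hq (ε := ε) (fun u v huv => hslow _ _ (by
      simp only [shift_apply]
      rw [Prod.dist_eq]
      simp only [dist_self, dist_add_left]
      exact max_le ((dist_coe_coe_le _ _).trans huv) (by positivity))) q
  have h2 : ∫ u in 0..(q / q : ℝ), F (shift (u : UnitAddCircle) w) = heightAverage F w.2 := by
    rw [div_self hq'.ne']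
    have h3 := UnitAddCircle.intervalIntegral_preimage 0 fun t => F (shift t w)
    rw [zero_add] at h3
    rw [h3, heightAverage, ← integral_add_left_eq_self (fun u => F (u, w.2)) w.1]
    rfl
  rw [h2] at h1
  have e : (q : ℝ)⁻¹ * (∑ b ∈ Finset.range q, F (shift ((b / q : ℝ) : UnitAddCircle) w)) -
      heightAverage F w.2 = (q : ℝ)⁻¹ * ((∑ b ∈ Finset.range q,
        F (shift ((b / q : ℝ) : UnitAddCircle) w)) - q * heightAverage F w.2) := by
    field_simp
  rw [e, abs_mul, abs_of_pos (by positivity), inv_mul_le_iff₀ hq']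
  exact h1

/-! ### The inductive step -/

theorem mul_shift_apply (H : Torus ≃ₜ Torus) (t : UnitAddCircle) (w : Torus) :
    (H * shift t * H⁻¹) (H w) = H (shift t w) := by
  change H (shift t (H.symm (H w))) = _
  rw [H.symm_apply_apply]

theorem iterate_mul_shift_apply (H : Torus ≃ₜ Torus) (t : UnitAddCircle) (i : ℕ) (w : Torus) :
    (H * shift t * H⁻¹ : Torus ≃ₜ Torus)^[i] (H w) = H (shift (i • t) w) := by
  induction i with
  | zero => simp [shift_apply]
  | succ i ih =>
    rw [Function.iterate_succ_apply', ih, mul_shift_apply]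
    simp only [shift_apply, succ_nsmul, add_assoc]

theorem dist_shift_shift (t u : UnitAddCircle) (w : Torus) :
    dist (shift t w) (shift u w) = dist t u := by
  rw [shift_apply, shift_apply, Prod.dist_eq]
  simp

/-- Birkhoff sums along the orbit of a rotation by `p/q + 1/q'`, seen through a diffeomorphism `h`
commuting with the rotation by `1/q`, follow the height averages along the orbit of horizontal
translations. -/
theorem abs_birkhoffSum_sub_le {F : Torus → ℝ} (hF : Continuous F) (hF1 : ∀ x, |F x| ≤ 1)
    {h : Torus ≃ₜ Torus} {q q' : ℕ} {p : ℤ} (hq : 0 < q) (hq' : 0 < q') (hpq : IsCoprime p (q : ℤ))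
    (hcomm : ∀ (j : ℤ) x, h (shift ((j / q : ℝ) : UnitAddCircle) x) =
      shift ((j / q : ℝ) : UnitAddCircle) (h x)) {ε B A : ℝ}
    (hslow : ∀ x y, dist x y ≤ 1 / q → |F x - F y| ≤ ε) {y z : Torus}
    (hmod : ∀ w w', dist w w' ≤ q / q' → |F (h w) - F (h w')| ≤ ε)
    (hyz : ∀ u, |heightAverage F (h (shift u y)).2 - heightAverage F (h (shift u z)).2| ≤ ε)
    (hψ : ∀ w w', dist w w' ≤ 1 / q' →
      |heightAverage F (h w).2 - heightAverage F (h w').2| ≤ ε)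
    (hrun : ∀ s : ℝ, 0 ≤ s → |∫ u in 0..s, (heightAverage F (h (shift (u : ℝ) z)).2 - A)| ≤ s * B)
    (N : ℕ) :
    |(∑ i ∈ Finset.range N, F (h (shift (i • (((p / q : ℝ) : UnitAddCircle) +
      ((1 / q' : ℝ) : UnitAddCircle))) y))) - N * A| ≤ 2 * q + N * (4 * ε + B) := by
  have hq0 : (0 : ℝ) < q := by exact_mod_cast hq
  have hq0' : (0 : ℝ) < q' := by exact_mod_cast hq'
  set α : UnitAddCircle := ((p / q : ℝ) : UnitAddCircle) with hα
  set β : UnitAddCircle := ((1 / q' : ℝ) : UnitAddCircle) with hβ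
  have hcommα : ∀ (b : ℕ) x, h (shift (b • α) x) = shift (b • α) (h x) := by
    intro b x
    have e : b • α = (((b * p : ℤ) / q : ℝ) : UnitAddCircle) := by
      rw [hα, ← AddCircle.coe_nsmul, nsmul_eq_mul]; congr 1; push_cast; ring
    rw [e]; exact hcomm _ _
  have hβi : ∀ i : ℕ, i • β = ((i / q' : ℝ) : UnitAddCircle) := by
    intro i
    rw [hβ, ← AddCircle.coe_nsmul, nsmul_eq_mul, mul_one_div]
  let a : ℕ → ℝ := fun i => F (h (shift (i • (α + β)) y))
  have ha : ∀ i, a i = F (shift (i • α) (h (shift (i • β) y))) := by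
    intro i
    simp only [a]
    rw [← hcommα]
    congr 2
    simp only [shift_apply, smul_add]
    rw [add_assoc, add_comm (i • β)]
  let φ : ℝ → ℝ := fun u => heightAverage F (h (shift (u : UnitAddCircle) z)).2
  have hφ : Continuous φ := by
    have h1 := continuous_heightAverage hF
    have h2 := h.continuous
    have h3 := AddCircle.continuous_mk' (1 : ℝ)
    simp only [φ, shift_apply]
    fun_prop
  -- moving averages over `q` steps are height averages
  have h1 : ∀ i, |(q : ℝ)⁻¹ * (∑ b ∈ Finset.range q, a (i + b)) - φ (i / q')| ≤ 3 * ε := by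
    intro i
    set w : Torus := shift (i • α) (h (shift (i • β) y)) with hw
    have e1 : |(q : ℝ)⁻¹ * (∑ b ∈ Finset.range q, a (i + b)) -
        (q : ℝ)⁻¹ * ∑ b ∈ Finset.range q, F (shift (b • α) w)| ≤ ε := by
      rw [← mul_sub, ← Finset.sum_sub_distrib, abs_mul, abs_of_pos (by positivity),
        inv_mul_le_iff₀ hq0]
      refine (Finset.abs_sum_le_sum_abs _ _).trans ((Finset.sum_le_sum (g := fun _ => ε)
        fun b hb => ?_).trans (le_of_eq (by simp)))
      have e2 : shift (b • α) w = h (shift ((i + b) • α) (shift (i • β) y)) := by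
        rw [hcommα, hw]
        simp only [shift_apply, add_smul, add_assoc]
      have e3 : a (i + b) = F (h (shift ((i + b) • α) (shift ((i + b) • β) y))) := by
        rw [ha, hcommα]
      rw [e2, e3]
      apply hmod
      have e4 : ∀ t : UnitAddCircle, shift ((i + b) • α) (shift t y) =
          shift (t) (shift ((i + b) • α) y) := by
        intro t; simp only [shift_apply]; rw [add_right_comm]
      rw [e4, e4, dist_shift_shift, add_smul, dist_self_add_left, hβi]
      refine (QuotientAddGroup.norm_mk_le_norm).trans ?_
      rw [Real.norm_eq_abs, abs_of_nonneg (by positivity)]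
      have : (b : ℝ) ≤ q := by exact_mod_cast (Finset.mem_range.1 hb).le
      gcongr
    have e5 := abs_orbit_average_sub_heightAverage_le hF hq hpq hslow w
    have e6 := hyz (i • β)
    have e7 : w.2 = (h (shift (i • β) y)).2 := rfl
    have e8 : φ (i / q') = heightAverage F (h (shift (i • β) z)).2 := by simp only [φ, hβi]
    rw [e7] at e5
    rw [e8]
    rw [abs_le] at e1 e5 e6 ⊢
    constructor <;> linarith
  have h2 := abs_sum_sub_sum_average_le (a := a) (fun i => hF1 _) hq N
  have h3 := abs_sum_sub_integral_le hφ hq' (ε := ε) (fun u v huv => hψ _ _ (by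
    rw [dist_shift_shift]; exact (dist_coe_coe_le _ _).trans huv)) N
  have h4 : |(∑ i ∈ Finset.range N, (q : ℝ)⁻¹ * ∑ b ∈ Finset.range q, a (i + b)) -
      ∑ i ∈ Finset.range N, φ (i / q')| ≤ N * (3 * ε) := by
    rw [← Finset.sum_sub_distrib]
    refine (Finset.abs_sum_le_sum_abs _ _).trans ((Finset.sum_le_sum (g := fun _ => 3 * ε)
        fun i _ => h1 i).trans (le_of_eq (by simp)))
  have h5 := hrun (N / q') (by positivity)
  rw [intervalIntegral.integral_sub (hφ.intervalIntegrable _ _) intervalIntegrable_const,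
    intervalIntegral.integral_const, smul_eq_mul, sub_zero] at h5
  have h6 : |q' * (∫ u in 0..(N / q' : ℝ), φ u) - N * A| ≤ N * B := by
    have e : q' * (∫ u in 0..(N / q' : ℝ), φ u) - N * A =
        q' * ((∫ u in 0..(N / q' : ℝ), φ u) - N / q' * A) := by field_simp
    rw [e, abs_mul, abs_of_pos hq0']
    calc q' * |(∫ u in 0..(N / q' : ℝ), φ u) - N / q' * A| ≤ q' * (N / q' * B) := by gcongr
      _ = N * B := by field_simp
  change |(∑ i ∈ Finset.range N, a i) - N * A| ≤ _
  rw [abs_le] at h2 h3 h4 h6 ⊢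
  constructor <;> linarith

/-- The tolerance of the `n`-th step of the construction. -/
def tol (n : ℕ) : ℝ := (1 / 2) ^ (n + 1)

theorem tol_pos (n : ℕ) : 0 < tol n := by unfold tol; positivity

theorem tol_succ (n : ℕ) : tol n = 2 * tol (n + 1) := by unfold tol; ring

theorem tol_lt_one (n : ℕ) : tol n < 1 := pow_lt_one₀ (by norm_num) (by norm_num) (by simp)

/-- A stage of the construction: a rotation number `p/q`, a conjugating diffeomorphism `H` with its
entire lift `F` and the inverse `F'` of that lift, and a ball of centre `y` and radius `η` whose
image under `H` contains the generic point to be constructed. -/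
structure Stage where
  p : ℤ
  q : ℕ
  H : Torus ≃ₜ Torus
  F : ℂ × ℂ → ℂ × ℂ
  F' : ℂ × ℂ → ℂ × ℂ
  y : Torus
  η : ℝ

namespace Stage

/-- The rotation number of a stage. -/
def angle (s : Stage) : UnitAddCircle := ((s.p / s.q : ℝ) : UnitAddCircle)

/-- The periodic diffeomorphism of a stage. -/
def map (s : Stage) : Torus ≃ₜ Torus := s.H * shift s.angle * s.H⁻¹

/-- A lift of `H ∘ S_t ∘ H⁻¹`. -/
def liftMap (s : Stage) (t : ℝ) (z : ℂ × ℂ) : ℂ × ℂ := s.F (s.F' z + ((t : ℂ), 0))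

/-- The index of the distorted annulus of a stage to which a point belongs. -/
def index (r : ℕ) [NeZero r] (s : Stage) (x : Torus) : Fin r := row r (s.H.symm x).2

/-- The requirements on the `n`-th stage. At the scale `2/q`, the map `H` and the first `n + 1` test
functions in the coordinates given by `H` vary slowly, and the first `n` test functions have good
averages over the horizontal circles that meet the distinguished ball. -/
structure IsAdmissible (f : ℕ → Torus → ℝ) (n : ℕ) (s : Stage) : Prop where
  q_pos : 0 < s.q
  coprime : IsCoprime s.p (s.q : ℤ)
  diffeo : IsEntireDiffeo 1 s.H s.F s.F'
  two_div_lt : 2 / s.q < s.η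
  slow : ∀ j ≤ n, ∀ x x', dist x x' ≤ 2 / s.q → |f j (s.H x) - f j (s.H x')| ≤ tol n
  slow_dist : ∀ x x', dist x x' ≤ 2 / s.q → dist (s.H x) (s.H x') ≤ tol n
  height : ∀ j < n, ∀ v, dist v s.y.2 ≤ s.η →
    |heightAverage (fun x => f j (s.H x)) v - ∫ x, f j x| ≤ 16 * tol n

/-- The relation between the `n`-th stage `s` and the following one `s'`: the rotation numbers are
related as in the approximation by conjugation method, the conjugating map `H⁻¹ ∘ H'` commutes with
`S_{1/q}`, and the periodic maps are close to each other on a complex strip and for `n * q` iterates.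
The orbits of the new map are almost dense, it decorrelates the first test functions inside every
distorted annulus at some time `m ≤ q'`, and the annuli themselves have hardly changed. All orbits
that start in the new ball, which lies in the old one, have good Birkhoff sums of every length. -/
structure IsStep (r : ℕ) [NeZero r] (f : ℕ → Torus → ℝ) (n : ℕ) (s s' : Stage) : Prop where
  rotation : ∃ k : ℕ, 0 < k ∧ s'.p = k * s.q * s.p + 1 ∧ s'.q = k * s.q ^ 2
  isEntire : IsEntire s.q (s.H⁻¹ * s'.H)
  lift_near : ∀ z ∈ strip 1, ‖s'.liftMap (s'.p / s'.q) z - s.liftMap (s.p / s.q) z‖ ≤ tol n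
  lift_symm_near :
    ∀ z ∈ strip 1, ‖s'.liftMap (-(s'.p / s'.q)) z - s.liftMap (-(s.p / s.q)) z‖ ≤ tol n
  iterate_near : ∀ i ≤ n * s.q, ∀ x, dist (s'.map^[i] x) (s.map^[i] x) ≤ tol n
  dense : ∀ x z, ∃ i ≤ s'.q, dist (s'.map^[i] x) z ≤ 2 * tol n
  index_near : volume {x | s'.index r x ≠ s.index r x} ≤ ENNReal.ofReal (tol n)
  mixing : ∃ m ≤ s'.q, ∀ j ≤ n, ∀ k ≤ n, ∀ i : Fin r,
    |(∫ x in {x | s'.index r x = i}, f j (s'.map^[m] x) * f k x) -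
      r * (∫ x in {x | s.index r x = i}, f j x) * ∫ x in {x | s.index r x = i}, f k x| ≤
      10 * tol n
  ball_subset : s'.H '' Metric.closedBall s'.y s'.η ⊆ s.H '' Metric.closedBall s.y s.η
  generic : ∀ x ∈ s'.H '' Metric.closedBall s'.y s'.η, ∀ N : ℕ, ∀ j < n,
    |(∑ i ∈ Finset.range N, f j (s'.map^[i] x)) - N * ∫ x, f j x| ≤ 2 * s.q + N * (24 * tol n)

end Stage

theorem dist_shift (t : UnitAddCircle) (w w' : Torus) :
    dist (shift t w) (shift t w') = dist w w' := by
  simp only [shift_apply, Prod.dist_eq, dist_add_right]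

/-- Averaging over a horizontal circle after applying `h` is averaging the height averages over its
image, up to a small error: `h` commutes with the rotation by `p/q`, and the orbits of this rotation
sample horizontal circles. -/
theorem abs_heightAverage_comp_sub_le {F : Torus → ℝ} (hF : Continuous F) {h : Torus ≃ₜ Torus}
    {q : ℕ} (hq : 0 < q) {p : ℤ} (hpq : IsCoprime p (q : ℤ))
    (hcomm : ∀ (b : ℕ) x, h (shift (b • ((p / q : ℝ) : UnitAddCircle)) x) =
      shift (b • ((p / q : ℝ) : UnitAddCircle)) (h x)) {ε : ℝ}
    (hslow : ∀ x y, dist x y ≤ 1 / q → |F x - F y| ≤ ε) (v : UnitAddCircle) :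
    |heightAverage (fun x => F (h x)) v - ∫ u : UnitAddCircle, heightAverage F (h (u, v)).2| ≤
      ε := by
  have hq0 : (0 : ℝ) < q := by exact_mod_cast hq
  have hh := h.continuous
  have hc : ∀ t : UnitAddCircle, Continuous fun u : UnitAddCircle => F (shift t (h (u, v))) := by
    intro t
    simp only [shift_apply]
    fun_prop
  have h1 : ∀ b : ℕ, ∫ u : UnitAddCircle, F (shift (b • ((p / q : ℝ) : UnitAddCircle)) (h (u, v))) =
      heightAverage (fun x => F (h x)) v := by
    intro b
    rw [heightAverage, ← integral_add_right_eq_self (fun u : UnitAddCircle => F (h (u, v)))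
      (b • ((p / q : ℝ) : UnitAddCircle))]
    refine integral_congr_ae (Eventually.of_forall fun u => ?_)
    change F (shift _ (h (u, v))) = F (h (u + _, v))
    rw [← hcomm]; rfl
  have h2 : heightAverage (fun x => F (h x)) v = ∫ u : UnitAddCircle, (q : ℝ)⁻¹ *
      ∑ b ∈ Finset.range q, F (shift (b • ((p / q : ℝ) : UnitAddCircle)) (h (u, v))) := by
    rw [integral_const_mul, integral_finsetSum _ fun b _ => (hc _).integrable_circle,
      Finset.sum_congr rfl fun b _ => h1 b]
    simp only [Finset.sum_const, Finset.card_range, nsmul_eq_mul]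
    field_simp
  have h3 := continuous_heightAverage hF
  rw [h2, ← integral_sub]
  · have := norm_integral_le_of_norm_le_const (μ := (volume : Measure UnitAddCircle))
      (f := fun u => (q : ℝ)⁻¹ * (∑ b ∈ Finset.range q,
        F (shift (b • ((p / q : ℝ) : UnitAddCircle)) (h (u, v)))) - heightAverage F (h (u, v)).2)
      (C := ε) (Eventually.of_forall fun u =>
        abs_orbit_average_sub_heightAverage_le hF hq hpq hslow (h (u, v)))
    simpa using this
  · exact (integrable_finsetSum _ fun b _ => (hc _).integrable_circle).const_mul _
  · exact Continuous.integrable_circle (by fun_prop)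

namespace Stage

theorem map_iterate_apply (s : Stage) (i : ℕ) (w : Torus) :
    s.map^[i] (s.H w) = s.H (shift (i • s.angle) w) :=
  iterate_mul_shift_apply s.H s.angle i w

theorem measurableSet_index_eq {r : ℕ} [NeZero r] (s : Stage) (i : Fin r) :
    MeasurableSet {x | s.index r x = i} :=
  s.H.symm.continuous.measurable (measurableSet_annulus i)

theorem setIntegral_index_eq {r : ℕ} [NeZero r] {s : Stage}
    (hs : MeasurePreserving s.H (volume : Measure Torus) volume) (i : Fin r) (g : Torus → ℝ) :
    ∫ x in {x | s.index r x = i}, g x = ∫ x in annulus r i, g (s.H x) := by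
  rw [← hs.setIntegral_preimage_emb s.H.measurableEmbedding]
  congr 2
  ext x
  change row r (s.H.symm (s.H x)).2 = i ↔ row r x.2 = i
  rw [s.H.symm_apply_apply]

/-- Every admissible stage has an admissible successor. The conjugating diffeomorphism is chosen
first; then `k` is taken so large that the new periodic map is close to the old one. -/
theorem IsAdmissible.exists_step {r : ℕ} [NeZero r] {f : ℕ → Torus → ℝ}
    (hf : ∀ j, Continuous (f j)) (hf1 : ∀ j x, |f j x| ≤ 1) {n : ℕ} {s : Stage}
    (hs : s.IsAdmissible f n) : ∃ s', IsAdmissible f (n + 1) s' ∧ IsStep r f n s s' := by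
  obtain ⟨p, q, H, F, F', y, η⟩ := s
  obtain ⟨hq, hpq, hH, hqη, hslow, hslowd, hheight⟩ := hs
  dsimp only at hq hpq hH hqη hslow hslowd hheight
  have hq0 : (0 : ℝ) < q := by exact_mod_cast hq
  have htol := tol_pos n
  have htol' := tol_succ n
  have hη : 0 < η := lt_trans (by positivity) hqη
  have h12 : (1 : ℝ) / q ≤ 2 / q := by gcongr; norm_num
  let G : Fin (n + 1) → Torus → ℝ := fun j x => f j (H x)
  have hG : ∀ j, Continuous (G j) := fun j => (hf j).comp H.continuous
  have hGint : ∀ j, ∫ x, G j x = ∫ x, f j x := fun j =>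
    hH.measurePreserving.integral_comp_of_aestronglyMeasurable (hf j).aestronglyMeasurable
  have hGslow : ∀ (j : Fin (n + 1)) x y, dist x y ≤ 1 / q → |G j x - G j y| ≤ tol n :=
    fun j x y hxy => hslow j (Nat.lt_succ_iff.1 j.2) x y (hxy.trans h12)
  obtain ⟨h, ⟨Φ, Φ', hΦ⟩, hmin, hinv, hwm, z, hz, hrun, htot⟩ := exists_design r hq hG
    (fun j x => hf1 j _) htol (tol_lt_one n) (κ := min (tol n) (1 / q))
    (lt_min htol (by positivity)) hGslow y
  have hκ : min (tol n) (1 / q) + 1 / q ≤ (2 : ℝ) / q := by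
    have := min_le_right (tol n) (1 / q : ℝ)
    have e : (2 : ℝ) / q = 1 / q + 1 / q := by ring
    linarith
  set H' : Torus ≃ₜ Torus := H * h with hH'def
  have hH'app : ∀ x, H' x = H (h x) := fun _ => rfl
  have hH' : IsEntireDiffeo 1 H' (F ∘ Φ) (Φ' ∘ F') := hH.mul (hΦ.to_one hq)
  -- a common modulus of continuity for the functions of the new coordinates
  let ψ : Fin (n + 1) → UnitAddCircle → ℝ := fun j => heightAverage (G j)
  have hψ : ∀ j, Continuous (ψ j) := fun j => continuous_heightAverage (hG j)
  have hcont : Continuous fun w : Torus =>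
      ((fun j : Fin (n + 2) => f j (H' w)), H' w, fun j : Fin (n + 1) => ψ j (h w).2) :=
    (continuous_pi fun j : Fin (n + 2) => (hf j).comp H'.continuous).prodMk (H'.continuous.prodMk
      (continuous_pi fun j => (hψ j).comp (continuous_snd.comp h.continuous)))
  obtain ⟨δ₀, hδ₀, Hδ₀⟩ := Metric.uniformContinuous_iff.1
    (CompactSpace.uniformContinuous_of_continuous hcont) (tol (n + 1)) (tol_pos _)
  have hfmod : ∀ j ≤ n + 1, ∀ w w', dist w w' < δ₀ → |f j (H' w) - f j (H' w')| ≤ tol (n + 1) := by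
    intro j hj w w' hw
    have h1 := Hδ₀ hw
    rw [Prod.dist_eq, max_lt_iff] at h1
    exact (dist_le_pi_dist (fun j : Fin (n + 2) => f j (H' w)) (fun j => f j (H' w'))
      ⟨j, Nat.lt_succ_iff.2 hj⟩).trans h1.1.le
  have hHmod : ∀ w w', dist w w' < δ₀ → dist (H' w) (H' w') ≤ tol (n + 1) := by
    intro w w' hw
    have h1 := Hδ₀ hw
    rw [Prod.dist_eq, max_lt_iff, Prod.dist_eq, max_lt_iff] at h1
    exact h1.2.1.le
  have hψmod : ∀ j w w', dist w w' < δ₀ → |ψ j (h w).2 - ψ j (h w').2| ≤ tol n := by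
    intro j w w' hw
    have h1 := Hδ₀ hw
    rw [Prod.dist_eq, max_lt_iff, Prod.dist_eq, max_lt_iff] at h1
    exact ((dist_le_pi_dist (fun j : Fin (n + 1) => ψ j (h w).2) (fun j => ψ j (h w').2) j).trans
      h1.2.2.le).trans (by linarith)
  -- the new ball, mapped by `h` into the old one
  obtain ⟨ρ, hρ, Hρ⟩ := Metric.continuousAt_iff.1 (h.continuous.continuousAt (x := z)) (η - 2 / q)
    (sub_pos.2 hqη)
  set η' : ℝ := min (δ₀ / 2) (ρ / 2) with hη'def
  have hη' : 0 < η' := lt_min (by positivity) (by positivity)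
  have hη'δ : η' < δ₀ := (min_le_left _ _).trans_lt (by linarith)
  have hball : ∀ w, dist w z ≤ η' → dist (h w) y ≤ η := by
    intro w hw
    have h1 := Hρ (x := w) (hw.trans_lt ((min_le_right _ _).trans_lt (by linarith)))
    have h2 := dist_triangle (h w) (h z) y
    linarith
  -- the inverse lift maps the strip into a wider strip, on which the lift is uniformly continuous
  obtain ⟨C, hC⟩ := hH'.lift_symm.exists_im_bound one_pos 1
  obtain ⟨δ₁, hδ₁, Hδ₁⟩ := hH'.lift.exists_uniform_delta one_pos C htol
  set δ : ℝ := min (δ₀ / 2) (min δ₁ (η' / 2)) with hδdef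
  have hδ : 0 < δ := lt_min (by positivity) (lt_min hδ₁ (by positivity))
  have hδδ₀ : δ < δ₀ := (min_le_left _ _).trans_lt (by linarith)
  have hδδ₁ : δ ≤ δ₁ := (min_le_right _ _).trans (min_le_left _ _)
  have hδη' : δ < η' := ((min_le_right _ _).trans (min_le_right _ _)).trans_lt (by linarith)
  obtain ⟨K, hK⟩ := exists_nat_gt ((2 + n * q + q) / δ)
  have hK0 : (0 : ℝ) < K := lt_trans (by positivity) hK
  have hKpos : 0 < K := by exact_mod_cast hK0
  set q' : ℕ := 4 * K * q ^ 2 with hq'def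
  set p' : ℤ := (4 * K : ℕ) * q * p + 1 with hp'def
  have hq'pos : 0 < q' := by positivity
  have hq'0 : (0 : ℝ) < q' := by exact_mod_cast hq'pos
  have hKq' : (K : ℝ) ≤ q' := by
    rw [hq'def]; have hq2 : 0 < q ^ 2 := by positivity
    exact_mod_cast (by nlinarith : K ≤ 4 * K * q ^ 2)
  have hsmall : (2 + n * q + q) / (q' : ℝ) ≤ δ := by
    rw [div_lt_iff₀ hδ] at hK
    rw [div_le_iff₀ hq'0]
    nlinarith
  have hsmall2 : 2 / (q' : ℝ) ≤ δ := le_trans (by gcongr; nlinarith) hsmall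
  have hsmalln : (n * q) / (q' : ℝ) ≤ δ := le_trans (by gcongr; linarith) hsmall
  have hsmallq : q / (q' : ℝ) ≤ δ := le_trans (by gcongr; nlinarith) hsmall
  have hsmall1 : 1 / (q' : ℝ) ≤ δ := le_trans (by gcongr; norm_num) hsmall2
  have hangleR : (p' / q' : ℝ) = p / q + 1 / q' := by
    rw [hp'def, hq'def]; push_cast; field_simp
  have hangle : ((p' / q' : ℝ) : UnitAddCircle) =
      ((p / q : ℝ) : UnitAddCircle) + ((1 / q' : ℝ) : UnitAddCircle) := by
    rw [hangleR]; rfl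
  set s : Stage := ⟨p, q, H, F, F', y, η⟩ with hsdef
  set s' : Stage := ⟨p', q', H', F ∘ Φ, Φ' ∘ F', z, η'⟩ with hs'def
  have hiter : ∀ i w, s'.map^[i] (H' w) = H' (shift (i • ((p' / q' : ℝ) : UnitAddCircle)) w) :=
    fun i w => map_iterate_apply s' i w
  have hcomm : ∀ (b : ℕ) x, h (shift (b • ((p / q : ℝ) : UnitAddCircle)) x) =
      shift (b • ((p / q : ℝ) : UnitAddCircle)) (h x) := by
    intro b x
    have e : b • ((p / q : ℝ) : UnitAddCircle) = (((b * p : ℤ) / q : ℝ) : UnitAddCircle) := by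
      rw [← AddCircle.coe_nsmul, nsmul_eq_mul]; congr 1; push_cast; ring
    rw [e]; exact hΦ.lift.apply_shift _ _
  have hiter_old : ∀ i w, s.map^[i] (H' w) = H' (shift (i • ((p / q : ℝ) : UnitAddCircle)) w) := by
    intro i w
    rw [hH'app, hH'app, hcomm]
    exact map_iterate_apply s i (h w)
  have hpq' : IsCoprime p' (q' : ℤ) := by
    have e : (q' : ℤ) = ((4 * K : ℕ) * q) * q := by rw [hq'def]; push_cast; ring
    rw [e]
    have h1 : IsCoprime p' ((4 * K : ℕ) * q : ℤ) := ⟨1, -p, by rw [hp'def]; ring⟩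
    exact h1.mul_right (h1.of_mul_right_right)
  have hliftnear : ∀ z₀ ∈ strip 1, ∀ (j : ℤ) (σ : ℝ), |σ| ≤ δ₁ →
      ‖s'.liftMap (j / q + σ) z₀ - s.liftMap (j / q) z₀‖ ≤ tol n := by
    intro z₀ hz₀ j σ hσ
    obtain ⟨hi1, hi2⟩ := hC z₀ hz₀.1.le hz₀.2.le
    have h1 := Hδ₁ ((Φ' ∘ F') z₀ + ((j / q : ℂ), 0)) σ
      (by simpa using hi1) (by simpa using hi2) hσ
    have e1 : s'.liftMap (j / q + σ) z₀ =
        (F ∘ Φ) ((Φ' ∘ F') z₀ + ((j / q : ℂ), 0) + ((σ : ℂ), 0)) := by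
      simp only [liftMap, hs'def]
      have e0 : (((j / q + σ : ℝ) : ℂ), (0 : ℂ)) = ((j / q : ℂ), 0) + ((σ : ℂ), 0) := by
        ext <;> simp
      rw [e0, add_assoc]
    have e2 : s.liftMap (j / q) z₀ = (F ∘ Φ) ((Φ' ∘ F') z₀ + ((j / q : ℂ), 0)) := by
      simp only [liftMap, hsdef, Function.comp_apply]
      rw [hΦ.lift.fst_zsmul, hΦ.right_inv]
      push_cast
      rfl
    rw [e1, e2]
    exact h1
  refine ⟨s', ⟨hq'pos, hpq', hH', hsmall2.trans_lt hδη', ?_, ?_, ?_⟩,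
    ⟨⟨4 * K, by positivity, rfl, rfl⟩, ?_, ?_, ?_, ?_, ?_, ?_, ?_, ?_, ?_⟩⟩
  · intro j hj x x' hx
    exact hfmod j hj x x' (lt_of_le_of_lt (hx.trans hsmall2) hδδ₀)
  · intro x x' hx
    exact hHmod x x' (lt_of_le_of_lt (hx.trans hsmall2) hδδ₀)
  · -- the ball is so small that the average at the height of `z` determines the others
    intro j hj v hv
    have h1 := abs_heightAverage_sub_le (F := fun x => f j (H' x)) ((hf j).comp H'.continuous)
      (δ := η') (ε := tol (n + 1)) (fun x x' hx => hfmod j (by omega) x x' (hx.trans_lt hη'δ)) hv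
    have h2 := abs_heightAverage_comp_sub_le (hG ⟨j, hj⟩) hq hpq hcomm (hGslow ⟨j, hj⟩) z.2
    have h3 := htot ⟨j, hj⟩
    rw [hGint] at h3
    have h4 : heightAverage (fun x => G ⟨j, hj⟩ (h x)) z.2 =
      heightAverage (fun x => f j (H' x)) z.2 := rfl
    rw [h4] at h2
    change |heightAverage (fun x => f j (H' x)) v - ∫ x, f j x| ≤ 16 * tol (n + 1)
    change |_ - heightAverage (fun x => f j (H' x)) z.2| ≤ _ at h1
    rw [abs_le] at h1 h2 h3 ⊢
    constructor <;> linarith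
  · have e : s.H⁻¹ * s'.H = h := by
      simp only [hsdef, hs'def, hH'def, inv_mul_cancel_left]
    rw [e]
    exact ⟨Φ, Φ', hΦ⟩
  · intro z₀ hz₀
    have h1 := hliftnear z₀ hz₀ p (1 / q') (by
      rw [abs_of_pos (by positivity)]; exact hsmall1.trans hδδ₁)
    rw [← hangleR] at h1
    exact h1
  · intro z₀ hz₀
    have h1 := hliftnear z₀ hz₀ (-p) (-(1 / q')) (by
      rw [abs_neg, abs_of_pos (by positivity)]; exact hsmall1.trans hδδ₁)
    have e : (((-p : ℤ) / q + -(1 / q') : ℝ)) = -(p' / q' : ℝ) := by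
      rw [hangleR]; push_cast; ring
    have e2 : (((-p : ℤ) : ℝ) / q : ℝ) = -(p / q : ℝ) := by push_cast; ring
    rw [e, e2] at h1
    exact h1
  · -- the two rotation numbers differ by `1 / q'`, so the orbits separate by at most
    -- `n * q / q'` in the coordinates given by `H'`
    intro i hi x
    obtain ⟨w, rfl⟩ := H'.surjective x
    rw [hiter, hiter_old]
    refine (hHmod _ _ ?_).trans (by linarith)
    rw [dist_shift_shift, hangle, smul_add, dist_self_add_left, ← AddCircle.coe_nsmul, nsmul_eq_mul,
      mul_one_div]
    refine lt_of_le_of_lt ((QuotientAddGroup.norm_mk_le_norm).trans ?_) hδδ₀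
    rw [Real.norm_eq_abs, abs_of_nonneg (by positivity)]
    refine le_trans ?_ hsmalln
    have : (i : ℝ) ≤ n * q := by exact_mod_cast hi
    gcongr
  · -- every `S_{p'/q'}`-orbit is `1/q'`-dense in its horizontal circle, which `h` stretches out
    intro x z'
    obtain ⟨w, rfl⟩ := H'.surjective x
    obtain ⟨x₁, hx₁⟩ := hmin w.2 (H.symm z')
    have h1 := hslowd _ _ (hx₁.trans hκ)
    rw [H.apply_symm_apply] at h1
    obtain ⟨j, hj⟩ := exists_int_div_near hq'pos w.1 x₁
    obtain ⟨i, hi, hij⟩ := exists_nsmul_eq hq'pos hpq' j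
    refine ⟨i, hi.le, ?_⟩
    rw [hiter, hij]
    have h2 : dist (shift ((j / q' : ℝ) : UnitAddCircle) w) (x₁, w.2) ≤ 1 / q' := by
      rw [shift_apply, Prod.dist_eq]
      simp only [dist_self]
      exact max_le hj (by positivity)
    have h3 := hHmod _ _ (lt_of_le_of_lt (h2.trans hsmall1) hδδ₀)
    have h4 := dist_triangle (H' (shift ((j / q' : ℝ) : UnitAddCircle) w)) (H' (x₁, w.2)) z'
    have h5 : dist (H' (x₁, w.2)) z' ≤ tol n := h1
    linarith
  · have e : {x | s'.index r x ≠ s.index r x} = H'.symm ⁻¹' {w | row r (h w).2 ≠ row r w.2} := by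
      ext x
      obtain ⟨w, rfl⟩ := H'.surjective x
      change row r (H'.symm (H' w)).2 ≠ row r (H.symm (H' w)).2 ↔
        row r (h (H'.symm (H' w))).2 ≠ row r (H'.symm (H' w)).2
      rw [H'.symm_apply_apply, hH'app, H.symm_apply_apply]
      exact ne_comm
    have hmp : MeasurePreserving H'.symm (volume : Measure Torus) volume :=
      hH'.measurePreserving.symm H'.toMeasurableEquiv
    rw [e, hmp.measure_preimage_emb H'.symm.measurableEmbedding]
    exact hinv.trans (ENNReal.ofReal_le_ofReal (min_le_left _ _))
  · -- since `q' = 4 * K * q ^ 2`, at the time `q * K` the rotation by `p'/q'` is the one by `1/(4q)`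
    refine ⟨q * K, ?_, fun j hj k hk i => ?_⟩
    · change q * K ≤ 4 * K * q ^ 2
      nlinarith [Nat.mul_pos hq hKpos]
    have hquarter : (q * K) • ((p' / q' : ℝ) : UnitAddCircle) = quarter q := by
      have e : ((q * K : ℕ) : ℝ) * (p' / q' : ℝ) = 1 / (4 * q) + (K * p : ℤ) := by
        rw [hangleR, hq'def]; push_cast; field_simp; ring
      rw [← AddCircle.coe_nsmul, nsmul_eq_mul, e, AddCircle.coe_add, quarter]
      have e2 : (((K * p : ℤ) : ℝ) : UnitAddCircle) = 0 := by
        rw [AddCircle.coe_eq_zero_iff]; exact ⟨K * p, by simp⟩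
      rw [e2, add_zero]
    have h1 := hwm ⟨j, Nat.lt_succ_iff.2 hj⟩ ⟨k, Nat.lt_succ_iff.2 hk⟩ i
    rw [setIntegral_index_eq (s := s') hH'.measurePreserving,
      setIntegral_index_eq (s := s) hH.measurePreserving,
      setIntegral_index_eq (s := s) hH.measurePreserving]
    refine le_trans (le_of_eq ?_) h1
    congr 2
    refine integral_congr_ae (Eventually.of_forall fun w => ?_)
    change f j (s'.map^[q * K] (H' w)) * f k (H' w) = _
    rw [hiter, hquarter]
    rfl
  · rintro _ ⟨w, hw, rfl⟩
    exact ⟨h w, hball w hw, rfl⟩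
  · -- the error of the running averages is the one at the height of `y`, which was controlled by
    -- the previous stage
    rintro _ ⟨w, hw, rfl⟩ N j hj
    have hj' : j < n + 1 := by omega
    have hw' : dist w z ≤ η' := hw
    have h1 := abs_birkhoffSum_sub_le (hG ⟨j, hj'⟩) (fun x => hf1 j _) hq hq'pos hpq
      (fun j x => hΦ.lift.apply_shift j x) (hGslow ⟨j, hj'⟩) (y := w) (z := z)
      (fun w w' hww => (hfmod j (by omega) w w'
        ((hww.trans hsmallq).trans_lt hδδ₀)).trans (by linarith))
      (fun u => hψmod ⟨j, hj'⟩ _ _ (by rw [dist_shift]; exact hw'.trans_lt hη'δ))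
      (fun w w' hww => hψmod ⟨j, hj'⟩ w w' ((hww.trans hsmall1).trans_lt hδδ₀))
      (fun s hs => hrun ⟨j, hj'⟩ s hs) N
    have h2 := hheight j hj y.2 (by rw [dist_self]; exact hη.le)
    have h3 : |heightAverage (G ⟨j, hj'⟩) y.2 - ∫ x, G ⟨j, hj'⟩ x| ≤ 16 * tol n := by
      rw [hGint]; exact h2
    have h4 : ∑ i ∈ Finset.range N, f j (s'.map^[i] (H' w)) =
        ∑ i ∈ Finset.range N, G ⟨j, hj'⟩ (h (shift (i • (((p / q : ℝ) : UnitAddCircle) +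
          ((1 / q' : ℝ) : UnitAddCircle))) w)) := by
      refine Finset.sum_congr rfl fun i _ => ?_
      rw [hiter, hangle]; rfl
    change |(∑ i ∈ Finset.range N, f j (s'.map^[i] (H' w))) - N * ∫ x, f j x| ≤
      2 * q + N * (24 * tol n)
    rw [h4, ← hGint ⟨j, hj'⟩]
    refine h1.trans ?_
    have hN : (0 : ℝ) ≤ N := Nat.cast_nonneg N
    have : N * (4 * tol n + (|heightAverage (G ⟨j, hj'⟩) y.2 - ∫ x, G ⟨j, hj'⟩ x| + 4 * tol n)) ≤
        N * (24 * tol n) := mul_le_mul_of_nonneg_left (by linarith) hN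
    linarith

end Stage

/-! ### The limit diffeomorphism -/

theorem tendsto_tol : Tendsto tol atTop (𝓝 0) :=
  (tendsto_add_atTop_iff_nat 1).2
    (tendsto_pow_atTop_nhds_zero_of_lt_one (by norm_num : (0 : ℝ) ≤ 1 / 2) (by norm_num))

theorem dist_le_two_mul_tol {X : Type*} [PseudoMetricSpace X] {u : ℕ → X} {n : ℕ}
    (h : ∀ m, n ≤ m → dist (u m) (u (m + 1)) ≤ tol m) {a : X} (ha : Tendsto u atTop (𝓝 a)) :
    dist (u n) a ≤ 2 * tol n := by
  have h1 := dist_le_of_le_geometric_of_tendsto (1 / 2) (tol n) (f := fun m => u (n + m))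
    (by norm_num) (fun m => (h (n + m) (by omega)).trans (le_of_eq (by unfold tol; ring)))
    (a := a) ((tendsto_add_atTop_iff_nat n).2 ha |>.congr fun m => by rw [add_comm]) 0
  simp only [add_zero, pow_zero, mul_one] at h1
  refine h1.trans (le_of_eq (by ring))

theorem exists_limit_of_dist_le_tol {X α : Type*} [MetricSpace X] [CompleteSpace X] [Nonempty X]
    {g : ℕ → α → X} {S : Set α} (h : ∀ n, ∀ z ∈ S, dist (g n z) (g (n + 1) z) ≤ tol n) :
    ∃ L : α → X, ∀ n, ∀ z ∈ S, dist (g n z) (L z) ≤ 2 * tol n := by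
  have h1 : ∀ z ∈ S, ∃ a, Tendsto (fun n => g n z) atTop (𝓝 a) := fun z hz =>
    cauchySeq_tendsto_of_complete (cauchySeq_of_le_geometric (1 / 2) (1 / 2) (by norm_num)
      fun n => (h n z hz).trans (le_of_eq (by unfold tol; ring)))
  choose! L hL using h1
  exact ⟨L, fun n z hz => dist_le_two_mul_tol (fun m _ => h m z hz) (hL z hz)⟩

theorem tendstoUniformlyOn_of_dist_le_tol {X α : Type*} [PseudoMetricSpace X] {g : ℕ → α → X}
    {S : Set α} {L : α → X} (h : ∀ n, ∀ z ∈ S, dist (g n z) (L z) ≤ 2 * tol n) :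
    TendstoUniformlyOn g L atTop S := by
  rw [Metric.tendstoUniformlyOn_iff]
  intro ε hε
  have h1 : Tendsto (fun n => 2 * tol n) atTop (𝓝 0) := by simpa using tendsto_tol.const_mul 2
  filter_upwards [h1.eventually (gt_mem_nhds hε)] with n hn z hz
  rw [dist_comm]
  exact (h n z hz).trans_lt hn

theorem isEntireLift_shift (t : ℝ) :
    IsEntireLift 1 (shift (t : UnitAddCircle)) (fun z => z + ((t : ℂ), 0)) where
  differentiable := by fun_prop
  fst_mem z := add_right_comm _ _ _
  snd_mem z := add_right_comm _ _ _
  real x := ⟨x + (t, 0), by rw [toComplex_add]; simp [toComplex], by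
    rw [proj_add]; simp [proj, shift_apply]⟩

theorem IsEntireLift.isHolomorphicLift {q : ℕ} {h : Torus → Torus} {F : ℂ × ℂ → ℂ × ℂ}
    (hF : IsEntireLift q h F) (ρ : ℝ) : IsHolomorphicLift ρ h F :=
  ⟨hF.differentiable.differentiableOn, hF.real⟩

theorem dist_proj_le (x y : ℝ × ℝ) : dist (proj x) (proj y) ≤ dist (toComplex x) (toComplex y) := by
  simp only [Prod.dist_eq, proj, toComplex]
  refine max_le_max ?_ ?_
  · refine (dist_coe_coe_le _ _).trans (le_of_eq ?_)
    rw [dist_eq_norm, ← Complex.ofReal_sub, Complex.norm_real, Real.norm_eq_abs]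
  · refine (dist_coe_coe_le _ _).trans (le_of_eq ?_)
    rw [dist_eq_norm, ← Complex.ofReal_sub, Complex.norm_real, Real.norm_eq_abs]

theorem isClosed_range_toComplex : IsClosed (range toComplex) := by
  have : range toComplex = {z | z.1.im = 0} ∩ {z | z.2.im = 0} := by
    ext z
    constructor
    · rintro ⟨x, rfl⟩
      exact ⟨Complex.ofReal_im _, Complex.ofReal_im _⟩
    · rintro ⟨h1, h2⟩
      refine ⟨(z.1.re, z.2.re), Prod.ext (Complex.ext rfl ?_) (Complex.ext rfl ?_)⟩
      · rw [show z.1.im = 0 from h1]; exact Complex.ofReal_im _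
      · rw [show z.2.im = 0 from h2]; exact Complex.ofReal_im _
  rw [this]
  exact (isClosed_eq (by fun_prop) continuous_const).inter (isClosed_eq (by fun_prop) continuous_const)

/-- A uniform limit on a strip of holomorphic lifts is a holomorphic lift of the limit. -/
theorem isHolomorphicLift_of_tendsto {ρ : ℝ} (hρ : 0 < ρ) {g : ℕ → Torus → Torus}
    {T : Torus → Torus} {G : ℕ → ℂ × ℂ → ℂ × ℂ} {L : ℂ × ℂ → ℂ × ℂ}
    (hG : ∀ n, IsHolomorphicLift ρ (g n) (G n)) (hT : ∀ x, Tendsto (fun n => g n x) atTop (𝓝 (T x)))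
    (hL : TendstoUniformlyOn G L atTop (strip ρ)) : IsHolomorphicLift ρ T L := by
  refine ⟨(TendstoUniformlyOn.analyticOnNhd_complex_prod (isOpen_strip ρ)
    (fun n => (hG n).differentiableOn) hL).differentiableOn, fun x => ?_⟩
  have h1 : Tendsto (fun n => G n (toComplex x)) atTop (𝓝 (L (toComplex x))) :=
    hL.tendsto_at (toComplex_mem_strip hρ x)
  choose y hy hy' using fun n => (hG n).lift x
  have h2 : L (toComplex x) ∈ range toComplex :=
    isClosed_range_toComplex.mem_of_tendsto h1 (Eventually.of_forall fun n => ⟨y n, (hy n).symm⟩)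
  obtain ⟨w, hw⟩ := h2
  refine ⟨w, hw.symm, ?_⟩
  have h3 : Tendsto y atTop (𝓝 w) := by
    have h4 := (rePart.continuous.tendsto _).comp h1
    rw [← hw, rePart_toComplex] at h4
    refine h4.congr fun n => ?_
    simp only [Function.comp_apply, hy, rePart_toComplex]
  refine tendsto_nhds_unique ((continuous_proj.tendsto w).comp h3) ((hT (proj x)).congr fun n => ?_)
  exact (hy' n).symm

/-- A sequence of stages, each of which is obtained from the previous one by the inductive step. -/
structure IsChain (r : ℕ) [NeZero r] (f : ℕ → Torus → ℝ) (s : ℕ → Stage) : Prop where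
  admissible : ∀ n, (s n).IsAdmissible f n
  step : ∀ n, Stage.IsStep r f n (s n) (s (n + 1))
  H_zero : (s 0).H = 1

/-- The construction starts with `H = id` and a rotation by `1/q` for large `q`. -/
theorem exists_isChain (r : ℕ) [NeZero r] {f : ℕ → Torus → ℝ} (hf : ∀ j, Continuous (f j))
    (hf1 : ∀ j x, |f j x| ≤ 1) : ∃ s, IsChain r f s := by
  obtain ⟨δ, hδ, Hδ⟩ := Metric.uniformContinuous_iff.1
    (CompactSpace.uniformContinuous_of_continuous (hf 0)) (tol 0) (tol_pos 0)
  obtain ⟨q, hq⟩ := exists_nat_gt (max (2 / δ) (max 2 (2 / tol 0)))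
  rw [max_lt_iff, max_lt_iff] at hq
  obtain ⟨hq1, hq2, hq3⟩ := hq
  have hq0 : (0 : ℝ) < q := by linarith
  rw [div_lt_iff₀ hδ] at hq1
  rw [div_lt_iff₀ (tol_pos 0)] at hq3
  let s₀ : Stage := ⟨1, q, 1, id, id, 0, 1⟩
  have hs₀ : s₀.IsAdmissible f 0 := by
    refine ⟨by exact_mod_cast hq0, isCoprime_one_left, IsEntireDiffeo.one 1, ?_, ?_, ?_, ?_⟩
    · change (2 : ℝ) / q < 1
      rw [div_lt_one hq0]; exact hq2
    · intro j hj x x' hx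
      obtain rfl : j = 0 := by omega
      refine (Hδ (a := x) (b := x') (lt_of_le_of_lt hx ?_)).le
      change (2 : ℝ) / q < δ
      rw [div_lt_iff₀ hq0]; linarith
    · intro x x' hx
      refine le_trans hx (?_ : (2 : ℝ) / q ≤ _)
      rw [div_le_iff₀ hq0]; linarith
    · intro j hj
      omega
  choose! g hg hg' using fun n s (h : Stage.IsAdmissible f n s) => h.exists_step (r := r) hf hf1
  let s : ℕ → Stage := fun n => Nat.rec s₀ (fun n s => g n s) n
  have hs : ∀ n, (s n).IsAdmissible f n := by
    intro n
    induction n with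
    | zero => exact hs₀
    | succ n ih => exact hg n _ ih
  exact ⟨s, hs, fun n => hg' n _ (hs n), rfl⟩

namespace Stage

variable {f : ℕ → Torus → ℝ} {n : ℕ} {s : Stage}

theorem IsAdmissible.isEntireLift_liftMap (hs : s.IsAdmissible f n) :
    IsEntireLift 1 s.map (s.liftMap (s.p / s.q)) :=
  (hs.diffeo.lift.comp (isEntireLift_shift (s.p / s.q))).comp hs.diffeo.lift_symm

theorem IsAdmissible.isEntireLift_liftMap_symm (hs : s.IsAdmissible f n) :
    IsEntireLift 1 s.map.symm (s.liftMap (-(s.p / s.q))) := by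
  have h1 := (hs.diffeo.lift.comp (isEntireLift_shift (-(s.p / s.q)))).comp hs.diffeo.lift_symm
  have e : (s.map.symm : Torus → Torus) =
      (s.H ∘ shift ((-(s.p / s.q) : ℝ) : UnitAddCircle)) ∘ s.H.symm := by
    funext x
    rw [Homeomorph.symm_apply_eq]
    change x = s.H (shift s.angle (s.H.symm (s.H (shift _ (s.H.symm x)))))
    rw [s.H.symm_apply_apply]
    simp only [shift_apply, angle, AddCircle.coe_neg, neg_add_cancel_right]
    rw [Prod.mk.eta, s.H.apply_symm_apply]
  rw [e]
  exact h1

theorem IsAdmissible.measurePreserving_map (hs : s.IsAdmissible f n) :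
    MeasurePreserving s.map (volume : Measure Torus) volume :=
  (hs.diffeo.measurePreserving.comp (measurePreserving_shift s.angle)).comp
    (hs.diffeo.measurePreserving.symm s.H.toMeasurableEquiv)

end Stage

theorem dist_le_of_lift_near {g g' : Torus → Torus} {G G' : ℂ × ℂ → ℂ × ℂ}
    (hG : IsEntireLift 1 g G) (hG' : IsEntireLift 1 g' G') {ε : ℝ}
    (h : ∀ z ∈ strip 1, ‖G' z - G z‖ ≤ ε) (x : Torus) : dist (g x) (g' x) ≤ ε := by
  obtain ⟨x, rfl⟩ := proj_surjective x
  obtain ⟨y, hy, hy'⟩ := hG.real x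
  obtain ⟨w, hw, hw'⟩ := hG'.real x
  rw [← hy', ← hw']
  refine (dist_proj_le _ _).trans ?_
  rw [← hy, ← hw, dist_comm, dist_eq_norm]
  exact h _ (toComplex_mem_strip one_pos x)

/-- The limit of the periodic diffeomorphisms of a chain. -/
theorem IsChain.exists_limit {r : ℕ} [NeZero r] {f : ℕ → Torus → ℝ} {s : ℕ → Stage}
    (hs : IsChain r f s) : ∃ T : Torus ≃ₜ Torus, (∀ n x, dist ((s n).map x) (T x) ≤ 2 * tol n) ∧
      ∀ n x, dist ((s n).map.symm x) (T.symm x) ≤ 2 * tol n := by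
  obtain ⟨T, hT⟩ := exists_limit_of_dist_le_tol (g := fun n x => (s n).map x) (S := univ)
    fun n x _ => dist_le_of_lift_near (hs.admissible n).isEntireLift_liftMap
      (hs.admissible (n + 1)).isEntireLift_liftMap (hs.step n).lift_near x
  obtain ⟨T', hT'⟩ := exists_limit_of_dist_le_tol (g := fun n x => (s n).map.symm x) (S := univ)
    fun n x _ => dist_le_of_lift_near (hs.admissible n).isEntireLift_liftMap_symm
      (hs.admissible (n + 1)).isEntireLift_liftMap_symm (hs.step n).lift_symm_near x
  have hu := tendstoUniformlyOn_univ.1 (tendstoUniformlyOn_of_dist_le_tol hT)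
  have hu' := tendstoUniformlyOn_univ.1 (tendstoUniformlyOn_of_dist_le_tol hT')
  have hc : Continuous T := hu.continuous (Frequently.of_forall fun n => (s n).map.continuous)
  have hc' : Continuous T' := hu'.continuous (Frequently.of_forall fun n => (s n).map.symm.continuous)
  refine ⟨⟨⟨T, T', fun x => ?_, fun x => ?_⟩, hc, hc'⟩, fun n x => hT n x (mem_univ x),
    fun n x => hT' n x (mem_univ x)⟩
  · have h1 := hu'.tendsto_comp hc'.continuousAt (hu.tendsto_at x)
    refine tendsto_nhds_unique h1 (tendsto_const_nhds.congr fun n => ?_)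
    exact ((s n).map.symm_apply_apply x).symm
  · have h1 := hu.tendsto_comp hc.continuousAt (hu'.tendsto_at x)
    refine tendsto_nhds_unique h1 (tendsto_const_nhds.congr fun n => ?_)
    exact ((s n).map.apply_symm_apply x).symm

section limit

variable {r : ℕ} [NeZero r] {f : ℕ → Torus → ℝ} {s : ℕ → Stage} {T : Torus ≃ₜ Torus}

theorem tendsto_map_iterate (hT : ∀ n x, dist ((s n).map x) (T x) ≤ 2 * tol n) (i : ℕ) (x : Torus) :
    Tendsto (fun n => (s n).map^[i] x) atTop (𝓝 (T^[i] x)) := by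
  have hu : TendstoUniformly (fun n x => (s n).map x) T atTop := tendstoUniformlyOn_univ.1
    (tendstoUniformlyOn_of_dist_le_tol (S := univ) fun n x _ => hT n x)
  induction i with
  | zero => exact tendsto_const_nhds
  | succ i ih =>
    simp only [Function.iterate_succ_apply']
    exact hu.tendsto_comp T.continuous.continuousAt ih

theorem IsChain.q_mono (hs : IsChain r f s) : Monotone fun n => (s n).q := by
  refine monotone_nat_of_le_succ fun n => ?_
  obtain ⟨k, hk, -, hq⟩ := (hs.step n).rotation
  rw [hq]
  have := (hs.admissible n).q_pos
  nlinarith [Nat.mul_pos hk this]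

/-- Up to the time `n * q n` the orbits of the limit follow those of the `n`-th periodic map. -/
theorem IsChain.dist_iterate_le (hs : IsChain r f s)
    (hT : ∀ n x, dist ((s n).map x) (T x) ≤ 2 * tol n) {n i : ℕ} (hi : i ≤ n * (s n).q) (x : Torus) :
    dist ((s n).map^[i] x) (T^[i] x) ≤ 2 * tol n := by
  refine dist_le_two_mul_tol (u := fun n => (s n).map^[i] x) (fun m hm => ?_)
    (tendsto_map_iterate hT i x)
  rw [dist_comm]
  exact (hs.step m).iterate_near i (hi.trans (Nat.mul_le_mul hm (hs.q_mono hm))) x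

theorem IsChain.isMinimalMap (hs : IsChain r f s)
    (hT : ∀ n x, dist ((s n).map x) (T x) ≤ 2 * tol n) : IsMinimalMap T := by
  intro x
  rw [Metric.dense_iff]
  intro z ε hε
  have h1 : Tendsto (fun n => 3 * tol n) atTop (𝓝 0) := by simpa using tendsto_tol.const_mul 3
  obtain ⟨n, hn⟩ := (h1.eventually (gt_mem_nhds hε)).exists
  obtain ⟨i, hi, hd⟩ := (hs.step n).dense x z
  have h2 := hs.dist_iterate_le hT (n := n + 1) (i := i) (hi.trans (by nlinarith)) x
  refine ⟨_, ?_, ⟨i, rfl⟩⟩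
  rw [Metric.mem_ball]
  have h3 := dist_triangle_left (T^[i] x) z ((s (n + 1)).map^[i] x)
  have h4 := tol_succ n
  refine lt_of_le_of_lt ?_ hn
  change dist (T^[i] x) z ≤ _
  linarith

theorem measurePreserving_of_limit (hs : ∀ n, MeasurePreserving (s n).map (volume : Measure Torus) volume)
    (hT : ∀ n x, dist ((s n).map x) (T x) ≤ 2 * tol n) :
    MeasurePreserving T (volume : Measure Torus) volume := by
  refine ⟨T.continuous.measurable, ?_⟩
  have : IsFiniteMeasure (Measure.map T (volume : Measure Torus)) := Measure.isFiniteMeasure_map _ _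
  refine ext_of_forall_integral_eq_of_IsFiniteMeasure fun g => ?_
  rw [integral_map T.continuous.aemeasurable g.continuous.aestronglyMeasurable]
  have h1 : Tendsto (fun n => ∫ x, g ((s n).map x)) atTop (𝓝 (∫ x, g (T x))) := by
    refine tendsto_integral_of_dominated_convergence (fun _ => ‖g‖)
      (fun n => (g.continuous.comp (s n).map.continuous).aestronglyMeasurable)
      (integrable_const _) (fun n => Eventually.of_forall fun x => g.norm_coe_le_norm _)
      (Eventually.of_forall fun x => ?_)
    exact (g.continuous.tendsto _).comp (tendsto_map_iterate hT 1 x)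
  refine tendsto_nhds_unique h1 (tendsto_const_nhds.congr fun n => ?_)
  exact ((hs n).integral_comp_of_aestronglyMeasurable g.continuous.aestronglyMeasurable).symm

end limit

/-! ### The generic point -/

/-- A time after `a n₀` lies between two consecutive terms of the sequence, even if the sequence is
not monotone. -/
theorem exists_between_of_le {a : ℕ → ℕ} (ha : ∀ n, n ≤ a n) {n₀ N : ℕ} (h : a n₀ ≤ N) :
    ∃ n, n₀ ≤ n ∧ a n ≤ N ∧ N < a (n + 1) := by
  classical
  have hex : ∃ k, n₀ ≤ k ∧ N < a (k + 1) :=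
    ⟨N, (ha n₀).trans h, Nat.lt_of_lt_of_le (Nat.lt_succ_self N) (ha (N + 1))⟩
  refine ⟨Nat.find hex, (Nat.find_spec hex).1, ?_, (Nat.find_spec hex).2⟩
  rcases (Nat.find_spec hex).1.eq_or_lt with heq | hlt
  · rw [← heq]; exact h
  · have h1 := Nat.find_min hex (m := Nat.find hex - 1) (by omega)
    have h2 : n₀ ≤ Nat.find hex - 1 := by omega
    have h3 : Nat.find hex - 1 + 1 = Nat.find hex := by omega
    rw [h3] at h1
    by_contra hcon
    exact h1 ⟨h2, not_le.1 hcon⟩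

/-- The point in the images of all distinguished balls has the right Birkhoff averages for all
test functions. -/
theorem IsChain.exists_generic {r : ℕ} [NeZero r] {f : ℕ → Torus → ℝ} {s : ℕ → Stage}
    {T : Torus ≃ₜ Torus} (hf : ∀ j, Continuous (f j)) (hs : IsChain r f s)
    (hT : ∀ n x, dist ((s n).map x) (T x) ≤ 2 * tol n) :
    ∃ x, ∀ j, Tendsto (fun N : ℕ => birkhoffAverage ℝ T (f j) N x) atTop (𝓝 (∫ y, f j y)) := by
  have hcomp : ∀ n, IsCompact ((s n).H '' Metric.closedBall (s n).y (s n).η) := fun n =>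
    (isCompact_closedBall _ _).image (s n).H.continuous
  have hη : ∀ n, 0 ≤ (s n).η := fun n =>
    (by positivity : (0 : ℝ) ≤ 2 / (s n).q).trans (hs.admissible n).two_div_lt.le
  obtain ⟨x, hx⟩ := IsCompact.nonempty_iInter_of_sequence_nonempty_isCompact_isClosed
    (fun n => (s n).H '' Metric.closedBall (s n).y (s n).η) (fun n => (hs.step n).ball_subset)
    (fun n => (Metric.nonempty_closedBall.2 (hη n)).image _) (hcomp 0) (fun n => (hcomp n).isClosed)
  rw [mem_iInter] at hx
  refine ⟨x, fun j => ?_⟩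
  rw [Metric.tendsto_atTop]
  intro ε hε
  obtain ⟨δ, hδ, Hδ⟩ := Metric.uniformContinuous_iff.1
    (CompactSpace.uniformContinuous_of_continuous (hf j)) (ε / 4) (by positivity)
  have e1 : ∀ᶠ n : ℕ in atTop, tol n < min δ (ε / 96) :=
    tendsto_tol.eventually (gt_mem_nhds (lt_min hδ (by positivity)))
  have e2 : ∀ᶠ n : ℕ in atTop, 8 / ε ≤ (n : ℝ) := tendsto_natCast_atTop_atTop.eventually_ge_atTop _
  obtain ⟨n₀, hn₀⟩ := eventually_atTop.1 ((e1.and e2).and (eventually_gt_atTop j))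
  have ha : ∀ n, n ≤ n * (s n).q := fun n => Nat.le_mul_of_pos_right n (hs.admissible n).q_pos
  refine ⟨max 1 (n₀ * (s n₀).q), fun N hN => ?_⟩
  obtain ⟨n, hn, hnN, hNn⟩ := exists_between_of_le (a := fun n => n * (s n).q) ha
    ((le_max_right _ _).trans hN)
  have hN1 : 1 ≤ N := (le_max_left _ _).trans hN
  have hN0 : (0 : ℝ) < N := by exact_mod_cast hN1
  obtain ⟨⟨h1, h2⟩, h3⟩ := hn₀ n hn
  rw [lt_min_iff] at h1
  have h4 := (hs.step n).generic x (hx (n + 1)) N j h3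
  have h5 : |(∑ i ∈ Finset.range N, f j (T^[i] x)) -
      ∑ i ∈ Finset.range N, f j ((s (n + 1)).map^[i] x)| ≤ N * (ε / 4) := by
    rw [← Finset.sum_sub_distrib]
    refine (Finset.abs_sum_le_sum_abs _ _).trans ((Finset.sum_le_sum (g := fun _ => ε / 4)
      fun i hi => ?_).trans (le_of_eq (by simp)))
    have hi' : i ≤ (n + 1) * (s (n + 1)).q := ((Finset.mem_range.1 hi).trans hNn).le
    have h6 := hs.dist_iterate_le hT hi' x
    rw [← tol_succ, dist_comm] at h6
    exact (Hδ (h6.trans_lt h1.1)).le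
  have h6 : 2 * ((s n).q : ℝ) ≤ N * (ε / 4) := by
    rw [div_le_iff₀ hε] at h2
    have h7 : (n : ℝ) * (s n).q ≤ N := by exact_mod_cast hnN
    have h8 : (0 : ℝ) ≤ (s n).q := Nat.cast_nonneg _
    nlinarith
  have h7 : (N : ℝ) * (24 * tol n) ≤ N * (ε / 4) := by gcongr; linarith
  have h8 : |(∑ i ∈ Finset.range N, f j (T^[i] x)) - N * ∫ y, f j y| ≤ N * (3 / 4 * ε) := by
    refine (abs_sub_le _ _ _).trans ((add_le_add h5 h4).trans ?_)
    linarith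
  have e : birkhoffAverage ℝ T (f j) N x - ∫ y, f j y =
      (N : ℝ)⁻¹ * ((∑ i ∈ Finset.range N, f j (T^[i] x)) - N * ∫ y, f j y) := by
    rw [birkhoffAverage, birkhoffSum, smul_eq_mul, mul_sub, inv_mul_cancel_left₀ hN0.ne']
  rw [Real.dist_eq, e, abs_mul, abs_of_pos (by positivity)]
  have h9 : (N : ℝ)⁻¹ * |(∑ i ∈ Finset.range N, f j (T^[i] x)) - N * ∫ y, f j y| ≤ 3 / 4 * ε := by
    rw [inv_mul_le_iff₀ hN0]; exact h8
  linarith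

/-- A dense sequence of continuous functions, normalized to have norm less than one. -/
def testFun (j : ℕ) (x : Torus) : ℝ :=
  (1 + ‖TopologicalSpace.denseSeq C(Torus, ℝ) j‖)⁻¹ * TopologicalSpace.denseSeq C(Torus, ℝ) j x

theorem continuous_testFun (j : ℕ) : Continuous (testFun j) :=
  continuous_const.mul (TopologicalSpace.denseSeq C(Torus, ℝ) j).continuous

theorem abs_testFun_le (j : ℕ) (x : Torus) : |testFun j x| ≤ 1 := by
  have h0 := norm_nonneg (TopologicalSpace.denseSeq C(Torus, ℝ) j)
  have h1 : |TopologicalSpace.denseSeq C(Torus, ℝ) j x| ≤ ‖TopologicalSpace.denseSeq C(Torus, ℝ) j‖ :=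
    ContinuousMap.norm_coe_le_norm (TopologicalSpace.denseSeq C(Torus, ℝ) j) x
  rw [testFun, abs_mul, abs_of_pos (by positivity), inv_mul_le_iff₀ (by positivity)]
  linarith

/-- Multiples of the test functions are uniformly dense. -/
theorem exists_testFun_near (φ : C(Torus, ℝ)) {ε : ℝ} (hε : 0 < ε) :
    ∃ (j : ℕ) (c : ℝ), ∀ x, |φ x - c * testFun j x| ≤ ε := by
  obtain ⟨j, hj⟩ := (TopologicalSpace.denseRange_denseSeq C(Torus, ℝ)).exists_dist_lt φ hε
  refine ⟨j, 1 + ‖TopologicalSpace.denseSeq C(Torus, ℝ) j‖, fun x => ?_⟩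
  have h0 : 0 < 1 + ‖TopologicalSpace.denseSeq C(Torus, ℝ) j‖ := by positivity
  rw [testFun, mul_inv_cancel_left₀ h0.ne']
  have h1 := ContinuousMap.dist_apply_le_dist (f := φ) (g := TopologicalSpace.denseSeq C(Torus, ℝ) j) x
  exact h1.trans hj.le

theorem isGenericMeasure_of_testFun {T : Torus → Torus} {x : Torus}
    (h : ∀ j, Tendsto (fun N : ℕ => birkhoffAverage ℝ T (testFun j) N x) atTop
      (𝓝 (∫ y, testFun j y))) :
    IsGenericMeasure T (volume : Measure Torus) := by
  refine ⟨x, fun φ hφ _ => ?_⟩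
  rw [Metric.tendsto_atTop]
  intro ε hε
  obtain ⟨j, c, hjc⟩ := exists_testFun_near ⟨φ, hφ⟩ (ε := ε / 4) (by positivity)
  change ∀ x, |φ x - c * testFun j x| ≤ ε / 4 at hjc
  obtain ⟨N₀, hN₀⟩ := Metric.tendsto_atTop.1 ((h j).const_mul c) (ε / 4) (by positivity)
  refine ⟨max 1 N₀, fun N hN => ?_⟩
  have h1 := hN₀ N ((le_max_right _ _).trans hN)
  have hN1 : 1 ≤ N := (le_max_left _ _).trans hN
  have hN0 : (0 : ℝ) < N := by exact_mod_cast hN1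
  have h2 : |birkhoffAverage ℝ T φ N x - c * birkhoffAverage ℝ T (testFun j) N x| ≤ ε / 4 := by
    have e : birkhoffAverage ℝ T φ N x - c * birkhoffAverage ℝ T (testFun j) N x =
        (N : ℝ)⁻¹ * ∑ i ∈ Finset.range N, (φ (T^[i] x) - c * testFun j (T^[i] x)) := by
      simp only [birkhoffAverage, birkhoffSum, smul_eq_mul]
      rw [Finset.sum_sub_distrib, ← Finset.mul_sum]; ring
    rw [e, abs_mul, abs_of_pos (by positivity), inv_mul_le_iff₀ hN0]
    refine (Finset.abs_sum_le_sum_abs _ _).trans ((Finset.sum_le_sum (g := fun _ => ε / 4)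
      fun i _ => hjc _).trans (le_of_eq (by simp)))
  have h3 : |(∫ y, φ y) - c * ∫ y, testFun j y| ≤ ε / 4 := by
    rw [← integral_const_mul, ← integral_sub hφ.integrable_torus
      ((continuous_testFun j).integrable_torus.const_mul c)]
    have := norm_integral_le_of_norm_le_const (μ := (volume : Measure Torus))
      (f := fun y => φ y - c * testFun j y) (C := ε / 4) (Eventually.of_forall hjc)
    simpa using this
  rw [Real.dist_eq] at h1 ⊢
  rw [abs_le] at h2 h3
  rw [abs_lt] at h1 ⊢
  constructor <;> linarith

/-! ### Weak mixing from test functions -/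

theorem tendsto_of_forall_near {u : ℕ → ℝ} {a : ℝ}
    (h : ∀ ε > 0, ∃ (v : ℕ → ℝ) (b : ℝ), Tendsto v atTop (𝓝 b) ∧ (∀ n, |u n - v n| ≤ ε) ∧
      |a - b| ≤ ε) : Tendsto u atTop (𝓝 a) := by
  rw [Metric.tendsto_atTop]
  intro ε hε
  obtain ⟨v, b, hv, huv, hab⟩ := h (ε / 4) (by positivity)
  obtain ⟨N, hN⟩ := Metric.tendsto_atTop.1 hv (ε / 4) (by positivity)
  refine ⟨N, fun n hn => ?_⟩
  have h1 := hN n hn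
  have h2 := huv n
  rw [Real.dist_eq] at h1 ⊢
  rw [abs_lt] at h1 ⊢
  rw [abs_le] at h2 hab
  constructor <;> linarith

theorem exists_testFun_integral_near {μ : Measure Torus} [IsProbabilityMeasure μ] {u : Torus → ℝ}
    (hu : Integrable u μ) {ε : ℝ} (hε : 0 < ε) :
    ∃ (j : ℕ) (c : ℝ), ∫ x, |u x - c * testFun j x| ∂μ ≤ ε := by
  obtain ⟨g, hg, hgi⟩ := hu.exists_boundedContinuous_integral_sub_le (ε := ε / 2) (by positivity)
  obtain ⟨j, c, hjc⟩ := exists_testFun_near g.toContinuousMap (ε := ε / 2) (by positivity)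
  change ∀ x, |g x - c * testFun j x| ≤ ε / 2 at hjc
  have hfi : Integrable (fun x => c * testFun j x) μ :=
    (Integrable.of_bound (continuous_testFun j).aestronglyMeasurable 1
      (Eventually.of_forall (abs_testFun_le j))).const_mul c
  have hd : Integrable (fun x => ‖u x - g x‖) μ := (hu.sub hgi).norm
  refine ⟨j, c, ?_⟩
  refine (integral_mono (g := fun x => ‖u x - g x‖ + ε / 2) (hu.sub hfi).abs
    (hd.add (integrable_const _)) fun x => ?_).trans ?_
  · have := abs_sub_le (u x) (g x) (c * testFun j x)
    exact this.trans (add_le_add le_rfl (hjc x))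
  · rw [integral_add hd (integrable_const _), integral_const, probReal_univ, one_smul]
    linarith

theorem abs_integral_mul_le {μ : Measure Torus} [IsProbabilityMeasure μ] {u v : Torus → ℝ}
    (hu : Integrable u μ) (hv : ∀ x, |v x| ≤ 1) :
    |∫ x, u x * v x ∂μ| ≤ ∫ x, |u x| ∂μ := by
  refine abs_integral_le_integral_abs.trans (integral_mono_of_nonneg
    (Eventually.of_forall fun x => abs_nonneg _) hu.abs (Eventually.of_forall fun x => ?_))
  change |u x * v x| ≤ |u x|
  rw [abs_mul]
  exact mul_le_of_le_one_right (abs_nonneg _) (hv x)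

/-- Decorrelation of the test functions extends to all bounded measurable functions, by density of
their multiples in `L¹`; the two factors are replaced one after the other. -/
theorem tendsto_correlation_of_testFun {μ : Measure Torus} [IsProbabilityMeasure μ]
    {T : Torus → Torus} (hT : MeasurePreserving T μ μ) {m : ℕ → ℕ}
    (h : ∀ j k, Tendsto (fun n => ∫ x, testFun j (T^[m n] x) * testFun k x ∂μ) atTop
      (𝓝 ((∫ x, testFun j x ∂μ) * ∫ x, testFun k x ∂μ))) {u v : Torus → ℝ} (hu : Measurable u)
    (hv : Measurable v) (hu1 : ∀ x, |u x| ≤ 1) (hv1 : ∀ x, |v x| ≤ 1) :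
    Tendsto (fun n => ∫ x, u (T^[m n] x) * v x ∂μ) atTop
      (𝓝 ((∫ x, u x ∂μ) * ∫ x, v x ∂μ)) := by
  have hprod : ∀ a b : ℝ, |a| ≤ 1 → |b| ≤ 1 → |a * b| ≤ 1 := by
    intro a b ha hb
    rw [abs_mul]
    exact mul_le_one₀ ha (abs_nonneg _) hb
  have hb : ∀ w : Torus → ℝ, Measurable w → (∀ x, |w x| ≤ 1) → Integrable w μ := fun w hw hw1 =>
    Integrable.of_bound hw.aestronglyMeasurable 1 (Eventually.of_forall hw1)
  have hint1 : ∀ w : Torus → ℝ, (∀ x, |w x| ≤ 1) → |∫ x, w x ∂μ| ≤ 1 := by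
    intro w hw
    have := norm_integral_le_of_norm_le_const (μ := μ) (f := w) (C := 1) (Eventually.of_forall hw)
    simpa using this
  have htm := fun j => (continuous_testFun j).measurable
  have hti := fun j => hb _ (htm j) (abs_testFun_le j)
  have hui := hb u hu hu1
  have hvi := hb v hv hv1
  have hTm : ∀ n, Measurable T^[m n] := fun n => (hT.iterate (m n)).measurable
  have step : ∀ k, Tendsto (fun n => ∫ x, u (T^[m n] x) * testFun k x ∂μ) atTop
      (𝓝 ((∫ x, u x ∂μ) * ∫ x, testFun k x ∂μ)) := by
    intro k
    refine tendsto_of_forall_near fun ε hε => ?_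
    obtain ⟨j, c, hjc⟩ := exists_testFun_integral_near hui hε
    have hd : Integrable (fun x => u x - c * testFun j x) μ := hui.sub ((hti j).const_mul c)
    refine ⟨_, _, (h j k).const_mul c, fun n => ?_, ?_⟩
    · have hdT : Integrable (fun x => u (T^[m n] x) - c * testFun j (T^[m n] x)) μ :=
        (hT.iterate (m n)).integrable_comp_of_integrable hd
      have e : (∫ x, u (T^[m n] x) * testFun k x ∂μ) -
          c * ∫ x, testFun j (T^[m n] x) * testFun k x ∂μ =
          ∫ x, (u (T^[m n] x) - c * testFun j (T^[m n] x)) * testFun k x ∂μ := by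
        rw [← integral_const_mul, ← integral_sub]
        · refine integral_congr_ae (Eventually.of_forall fun x => ?_)
          ring
        · exact hb _ ((hu.comp (hTm n)).mul (htm k)) fun x => hprod _ _ (hu1 _) (abs_testFun_le k x)
        · exact (hb _ (((htm j).comp (hTm n)).mul (htm k)) fun x =>
            hprod _ _ (abs_testFun_le j _) (abs_testFun_le k x)).const_mul c
      rw [e]
      refine (abs_integral_mul_le hdT (abs_testFun_le k)).trans ?_
      have e2 : ∫ x, |u (T^[m n] x) - c * testFun j (T^[m n] x)| ∂μ =
          ∫ x, |u x - c * testFun j x| ∂μ :=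
        (hT.iterate (m n)).integral_comp_of_aestronglyMeasurable hd.abs.aestronglyMeasurable
      rw [e2]
      exact hjc
    · have e : (∫ x, u x ∂μ) * (∫ x, testFun k x ∂μ) -
          c * ((∫ x, testFun j x ∂μ) * ∫ x, testFun k x ∂μ) =
          (∫ x, (u x - c * testFun j x) ∂μ) * ∫ x, testFun k x ∂μ := by
        rw [integral_sub hui ((hti j).const_mul c), integral_const_mul]; ring
      rw [e, abs_mul]
      exact (mul_le_of_le_one_right (abs_nonneg _) (hint1 _ (abs_testFun_le k))).trans
        (abs_integral_le_integral_abs.trans hjc)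
  refine tendsto_of_forall_near fun ε hε => ?_
  obtain ⟨k, c, hkc⟩ := exists_testFun_integral_near hvi hε
  have hd : Integrable (fun x => v x - c * testFun k x) μ := hvi.sub ((hti k).const_mul c)
  refine ⟨_, _, (step k).const_mul c, fun n => ?_, ?_⟩
  · have e : (∫ x, u (T^[m n] x) * v x ∂μ) - c * ∫ x, u (T^[m n] x) * testFun k x ∂μ =
        ∫ x, (v x - c * testFun k x) * u (T^[m n] x) ∂μ := by
      rw [← integral_const_mul, ← integral_sub]
      · refine integral_congr_ae (Eventually.of_forall fun x => ?_)
        ring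
      · exact hb _ ((hu.comp (hTm n)).mul hv) fun x => hprod _ _ (hu1 _) (hv1 x)
      · exact (hb _ ((hu.comp (hTm n)).mul (htm k)) fun x =>
          hprod _ _ (hu1 _) (abs_testFun_le k x)).const_mul c
    rw [e]
    exact (abs_integral_mul_le hd fun x => hu1 _).trans hkc
  · have e : (∫ x, u x ∂μ) * (∫ x, v x ∂μ) - c * ((∫ x, u x ∂μ) * ∫ x, testFun k x ∂μ) =
        (∫ x, (v x - c * testFun k x) ∂μ) * ∫ x, u x ∂μ := by
      rw [integral_sub hvi ((hti k).const_mul c), integral_const_mul]; ring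
    rw [e, abs_mul]
    exact (mul_le_of_le_one_right (abs_nonneg _) (hint1 _ hu1)).trans
      (abs_integral_le_integral_abs.trans hkc)

theorem isWeaklyMixing_of_testFun {μ : Measure Torus} [IsProbabilityMeasure μ]
    {T : Torus → Torus} (hT : MeasurePreserving T μ μ) {m : ℕ → ℕ}
    (h : ∀ j k, Tendsto (fun n => ∫ x, testFun j (T^[m n] x) * testFun k x ∂μ) atTop
      (𝓝 ((∫ x, testFun j x ∂μ) * ∫ x, testFun k x ∂μ))) : IsWeaklyMixing T μ := by
  refine ⟨hT, m, fun A B hA hB => ?_⟩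
  have hind : ∀ (S : Set Torus) x, |S.indicator (1 : Torus → ℝ) x| ≤ 1 := by
    intro S x
    by_cases hx : x ∈ S <;> simp [hx]
  have h1 := tendsto_correlation_of_testFun hT h (u := A.indicator 1) (v := B.indicator 1)
    (measurable_one.indicator hA) (measurable_one.indicator hB) (hind A) (hind B)
  rw [integral_indicator_one hA, integral_indicator_one hB] at h1
  have h2 : ∀ n, ∫ x, A.indicator (1 : Torus → ℝ) (T^[m n] x) * B.indicator 1 x ∂μ =
      μ.real (B ∩ T^[m n] ⁻¹' A) := by
    intro n
    rw [← integral_indicator_one (hB.inter ((hT.iterate (m n)).measurable hA))]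
    refine integral_congr_ae (Eventually.of_forall fun x => ?_)
    by_cases hx : x ∈ B <;> by_cases hx' : T^[m n] x ∈ A <;> simp [hx, hx']
  simp only [h2] at h1
  have h3 := (h1.sub_const (μ.real A * μ.real B)).abs
  rw [sub_self, abs_zero] at h3
  refine h3.congr fun n => ?_
  rw [mul_comm (μ.real A)]

/-! ### The invariant measures -/

/-- The set of the points that eventually belong to the `i`-th distorted annulus. -/
def limitPart (r : ℕ) [NeZero r] (s : ℕ → Stage) (i : Fin r) : Set Torus :=
  {x | ∀ᶠ n in atTop, (s n).index r x = i}

theorem measurableSet_limitPart (r : ℕ) [NeZero r] (s : ℕ → Stage) (i : Fin r) :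
    MeasurableSet (limitPart r s i) := by
  have e : limitPart r s i = ⋃ N : ℕ, ⋂ n : ℕ, ⋂ _ : N ≤ n, {x | (s n).index r x = i} := by
    ext x
    simp only [mem_iUnion, mem_iInter]
    exact eventually_atTop
  rw [e]
  exact MeasurableSet.iUnion fun N => MeasurableSet.iInter fun n => MeasurableSet.iInter fun _ =>
    (s n).measurableSet_index_eq i

theorem disjoint_limitPart {r : ℕ} [NeZero r] (s : ℕ → Stage) {i j : Fin r} (h : i ≠ j) :
    Disjoint (limitPart r s i) (limitPart r s j) := by
  rw [Set.disjoint_left]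
  intro x hi hj
  obtain ⟨n, h1, h2⟩ := (Filter.Eventually.and hi hj).exists
  exact h (h1.symm.trans h2)

/-- The restriction of Lebesgue measure to a limit set of distorted annuli, normalized by the factor
`r` because every annulus has measure `1/r`. -/
def limitMeasure (r : ℕ) [NeZero r] (s : ℕ → Stage) (i : Fin r) : Measure Torus :=
  (r : ENNReal) • volume.restrict (limitPart r s i)

theorem integral_limitMeasure {r : ℕ} [NeZero r] (s : ℕ → Stage) (i : Fin r) (g : Torus → ℝ) :
    ∫ x, g x ∂limitMeasure r s i = r * ∫ x in limitPart r s i, g x := by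
  rw [limitMeasure, integral_smul_measure, ENNReal.toReal_natCast, smul_eq_mul]

theorem Stage.index_map {r : ℕ} [NeZero r] (s : Stage) (x : Torus) :
    s.index r (s.map x) = s.index r x := by
  change row r (s.H.symm (s.H (shift s.angle (s.H.symm x)))).2 = row r (s.H.symm x).2
  rw [s.H.symm_apply_apply]; rfl

section limit

variable {r : ℕ} [NeZero r] {f : ℕ → Torus → ℝ} {s : ℕ → Stage} {T : Torus ≃ₜ Torus}

/-- By the Borel–Cantelli lemma, almost every point eventually stays in the same annulus. -/
theorem IsChain.ae_eventually_index (hs : IsChain r f s) (i : Fin r) :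
    ∀ᵐ x : Torus, ∀ᶠ n in atTop, ((s n).index r x = i ↔ x ∈ limitPart r s i) := by
  have h1 : ∑' n, volume {x | (s (n + 1)).index r x ≠ (s n).index r x} ≠ ⊤ := by
    have hsum : Summable tol := by
      have := summable_geometric_of_lt_one (by norm_num : (0 : ℝ) ≤ 1 / 2) (by norm_num)
      exact (summable_nat_add_iff 1).2 this
    refine ne_top_of_le_ne_top ?_ (ENNReal.tsum_le_tsum fun n => (hs.step n).index_near)
    exact (ENNReal.ofReal_tsum_of_nonneg (fun n => (tol_pos n).le) hsum) ▸ ENNReal.ofReal_ne_top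
  filter_upwards [ae_eventually_notMem h1] with x hx
  obtain ⟨N, hN⟩ := eventually_atTop.1 hx
  have hconst : ∀ n, N ≤ n → (s n).index r x = (s N).index r x := by
    intro n hn
    induction n, hn using Nat.le_induction with
    | base => rfl
    | succ n hn ih =>
      have := hN n hn
      rw [← ih]
      exact not_not.1 this
  filter_upwards [eventually_ge_atTop N] with n hn
  rw [hconst n hn]
  constructor
  · intro h
    refine eventually_atTop.2 ⟨N, fun k hk => ?_⟩
    rw [hconst k hk, h]
  · intro h
    obtain ⟨k, hk, hkN⟩ := (Filter.Eventually.and h (eventually_ge_atTop N)).exists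
    rw [← hconst k hkN, hk]

/-- Integrals over the distorted annuli converge to integrals over their limit set. -/
theorem IsChain.tendsto_setIntegral_sub (hs : IsChain r f s) (i : Fin r) (c : ℕ)
    {u w : ℕ → Torus → ℝ} {C : ℝ} (hu : ∀ n, Measurable (u n)) (hw : ∀ n, Measurable (w n))
    (huC : ∀ n x, |u n x| ≤ C) (hwC : ∀ n x, |w n x| ≤ C)
    (h : ∀ x, Tendsto (fun n => u n x - w n x) atTop (𝓝 0)) :
    Tendsto (fun n => (∫ x in {x | (s (n + c)).index r x = i}, u n x) -
      ∫ x in limitPart r s i, w n x) atTop (𝓝 0) := by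
  have hA : ∀ n, MeasurableSet {x | (s (n + c)).index r x = i} := fun n =>
    (s (n + c)).measurableSet_index_eq i
  have hK := measurableSet_limitPart r s i
  have hbdd : ∀ (v : Torus → ℝ), Measurable v → (∀ x, |v x| ≤ C) → Integrable v := fun v hv hvC =>
    Integrable.of_bound hv.aestronglyMeasurable C (Eventually.of_forall hvC)
  have h1 : Tendsto (fun n => ∫ x, ({x | (s (n + c)).index r x = i}.indicator (u n) x -
      (limitPart r s i).indicator (w n) x)) atTop (𝓝 (∫ _ : Torus, (0 : ℝ))) := by
    refine tendsto_integral_of_dominated_convergence (fun _ => C + C)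
      (fun n => (((hu n).indicator (hA n)).sub ((hw n).indicator hK)).aestronglyMeasurable)
      (integrable_const _) (fun n => Eventually.of_forall fun x => ?_) ?_
    · refine (norm_sub_le _ _).trans (add_le_add ?_ ?_)
      · exact (norm_indicator_le_norm_self _ _).trans (huC n x)
      · exact (norm_indicator_le_norm_self _ _).trans (hwC n x)
    · filter_upwards [hs.ae_eventually_index i] with x hx
      have hx' := (tendsto_add_atTop_nat c).eventually hx
      by_cases hxK : x ∈ limitPart r s i
      · refine (h x).congr' ?_
        filter_upwards [hx'] with n hn
        rw [indicator_of_mem hxK, indicator_of_mem (show x ∈ {x | (s (n + c)).index r x = i} from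
          hn.2 hxK)]
      · refine tendsto_const_nhds.congr' ?_
        filter_upwards [hx'] with n hn
        rw [indicator_of_notMem hxK,
          indicator_of_notMem (show x ∉ {x | (s (n + c)).index r x = i} from
            fun hmem => hxK (hn.1 hmem)), sub_self]
  rw [integral_zero] at h1
  refine h1.congr fun n => ?_
  rw [integral_sub ((hbdd _ (hu n) (huC n)).indicator (hA n)) ((hbdd _ (hw n) (hwC n)).indicator hK),
    integral_indicator (hA n), integral_indicator hK]

theorem IsChain.tendsto_setIntegral (hs : IsChain r f s) (i : Fin r) {u : Torus → ℝ} {C : ℝ}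
    (hu : Measurable u) (huC : ∀ x, |u x| ≤ C) :
    Tendsto (fun n => ∫ x in {x | (s n).index r x = i}, u x) atTop
      (𝓝 (∫ x in limitPart r s i, u x)) := by
  have h1 := hs.tendsto_setIntegral_sub i 0 (u := fun _ => u) (w := fun _ => u) (fun _ => hu)
    (fun _ => hu) (fun _ => huC) (fun _ => huC) (fun x => by simp)
  have h2 := h1.add_const (∫ x in limitPart r s i, u x)
  simpa using h2

theorem IsChain.volume_limitPart (hs : IsChain r f s) (i : Fin r) :
    volume.real (limitPart r s i) = 1 / r := by
  have h1 := hs.tendsto_setIntegral i (u := fun _ => 1) (C := 1) measurable_const (by simp)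
  simp only [setIntegral_const, smul_eq_mul, mul_one] at h1
  refine tendsto_nhds_unique h1 (tendsto_const_nhds.congr fun n => ?_)
  rw [← volume_annulus i, measureReal_def, measureReal_def,
    ← ((hs.admissible n).diffeo.measurePreserving.symm (s n).H.toMeasurableEquiv).measure_preimage_emb
      (s n).H.symm.measurableEmbedding]
  rfl

theorem IsChain.isProbabilityMeasure (hs : IsChain r f s) (i : Fin r) :
    IsProbabilityMeasure (limitMeasure r s i) := by
  have hr : r ≠ 0 := NeZero.ne r
  refine ⟨?_⟩
  have h1 : volume (limitPart r s i) = ENNReal.ofReal (1 / r) := by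
    rw [← hs.volume_limitPart i, ofReal_measureReal]
  rw [limitMeasure, Measure.smul_apply, Measure.restrict_apply_univ, h1, smul_eq_mul,
    ← ENNReal.ofReal_natCast, ← ENNReal.ofReal_mul (by positivity)]
  field_simp
  simp

theorem IsChain.injective_limitMeasure (hs : IsChain r f s) :
    Function.Injective (limitMeasure r s) := by
  intro i j hij
  by_contra hne
  have h1 := hs.isProbabilityMeasure i
  have hr : (r : ENNReal) ≠ 0 := by exact_mod_cast NeZero.ne r
  have h2 : limitMeasure r s i (limitPart r s j) = 0 := by
    rw [limitMeasure, Measure.smul_apply, Measure.restrict_apply (measurableSet_limitPart r s j),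
      (disjoint_limitPart s hne).symm.inter_eq, measure_empty, smul_zero]
  have h3 : limitMeasure r s j (limitPart r s j) = limitMeasure r s j univ := by
    rw [limitMeasure, Measure.smul_apply, Measure.smul_apply, Measure.restrict_apply_self,
      Measure.restrict_apply_univ]
  rw [hij, h3, ← hij, measure_univ] at h2
  exact one_ne_zero h2

/-- Every periodic map of the chain preserves its own distorted annuli, which converge to the limit
set. -/
theorem IsChain.measurePreserving_limitMeasure (hs : IsChain r f s)
    (hT : ∀ n x, dist ((s n).map x) (T x) ≤ 2 * tol n) (i : Fin r) :
    MeasurePreserving T (limitMeasure r s i) (limitMeasure r s i) := by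
  have hp := hs.isProbabilityMeasure i
  refine ⟨T.continuous.measurable, ?_⟩
  have : IsFiniteMeasure (Measure.map T (limitMeasure r s i)) := Measure.isFiniteMeasure_map _ _
  refine ext_of_forall_integral_eq_of_IsFiniteMeasure fun g => ?_
  rw [integral_map T.continuous.aemeasurable g.continuous.aestronglyMeasurable,
    integral_limitMeasure s i fun x => g (T x), integral_limitMeasure]
  congr 1
  have hgm := g.continuous.measurable
  have h1 := hs.tendsto_setIntegral_sub i 0 (u := fun n x => g ((s n).map x))
    (w := fun _ x => g (T x)) (C := ‖g‖) (fun n => hgm.comp (s n).map.continuous.measurable)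
    (fun _ => hgm.comp T.continuous.measurable) (fun n x => g.norm_coe_le_norm _)
    (fun n x => g.norm_coe_le_norm _) (fun x => by
      have h2 := ((g.continuous.tendsto _).comp (tendsto_map_iterate hT 1 x)).sub_const (g (T x))
      rw [Function.iterate_one, sub_self] at h2
      exact h2)
  have h2 := hs.tendsto_setIntegral i (u := g) (C := ‖g‖) hgm fun x => g.norm_coe_le_norm _
  have h3 : ∀ n, ∫ x in {x | (s n).index r x = i}, g ((s n).map x) =
      ∫ x in {x | (s n).index r x = i}, g x := by
    intro n
    have h4 := (hs.admissible n).measurePreserving_map.restrict_preimage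
      ((s n).measurableSet_index_eq i)
    have e : (s n).map ⁻¹' {x | (s n).index r x = i} = {x | (s n).index r x = i} := by
      ext x
      change (s n).index r ((s n).map x) = i ↔ (s n).index r x = i
      rw [Stage.index_map]
    rw [e] at h4
    exact h4.integral_comp_of_aestronglyMeasurable g.continuous.aestronglyMeasurable
  simp only [add_zero, h3] at h1
  have h5 := tendsto_nhds_unique h1 (h2.sub_const _)
  linarith

/-- The mixing times are those of the steps, before which the limit map follows the periodic maps. -/
theorem IsChain.isWeaklyMixing (hs : IsChain r testFun s)
    (hT : ∀ n x, dist ((s n).map x) (T x) ≤ 2 * tol n) (i : Fin r) :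
    IsWeaklyMixing T (limitMeasure r s i) := by
  have hp := hs.isProbabilityMeasure i
  choose m hm hmix using fun n => (hs.step n).mixing
  refine isWeaklyMixing_of_testFun (hs.measurePreserving_limitMeasure hT i) (m := m) fun j k => ?_
  simp only [integral_limitMeasure]
  have htm := fun j => (continuous_testFun j).measurable
  have hprod : ∀ a b : ℝ, |a| ≤ 1 → |b| ≤ 1 → |a * b| ≤ 1 := by
    intro a b ha hb
    rw [abs_mul]
    exact mul_le_one₀ ha (abs_nonneg _) hb
  have hcT : ∀ n, Continuous T^[m n] := fun n => T.continuous.iterate _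
  have hcs : ∀ n, Continuous (s (n + 1)).map^[m n] := fun n => (s (n + 1)).map.continuous.iterate _
  -- correlations of the limit map and of the periodic maps are close
  have h1 := hs.tendsto_setIntegral_sub i 1
    (u := fun n x => testFun j ((s (n + 1)).map^[m n] x) * testFun k x)
    (w := fun n x => testFun j (T^[m n] x) * testFun k x) (C := 1)
    (fun n => ((htm j).comp (hcs n).measurable).mul (htm k))
    (fun n => ((htm j).comp (hcT n).measurable).mul (htm k))
    (fun n x => hprod _ _ (abs_testFun_le _ _) (abs_testFun_le _ _))
    (fun n x => hprod _ _ (abs_testFun_le _ _) (abs_testFun_le _ _)) (fun x => by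
      have h2 : Tendsto (fun n => testFun j ((s (n + 1)).map^[m n] x) - testFun j (T^[m n] x)) atTop
          (𝓝 0) := by
        rw [Metric.tendsto_atTop]
        intro ε hε
        obtain ⟨δ, hδ, Hδ⟩ := Metric.uniformContinuous_iff.1
          (CompactSpace.uniformContinuous_of_continuous (continuous_testFun j)) ε hε
        obtain ⟨N, hN⟩ := eventually_atTop.1 (tendsto_tol.eventually (gt_mem_nhds hδ))
        refine ⟨N, fun n hn => ?_⟩
        rw [dist_zero_right, ← dist_eq_norm]
        have h3 := hs.dist_iterate_le hT (n := n + 1) (i := m n)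
          ((hm n).trans (Nat.le_mul_of_pos_left _ (by omega))) x
        rw [← tol_succ] at h3
        exact Hδ (h3.trans_lt (hN n hn))
      have h3 := h2.mul_const (testFun k x)
      rw [zero_mul] at h3
      exact h3.congr fun n => sub_mul _ _ _)
  have h2 : Tendsto (fun n => (∫ x in {x | (s (n + 1)).index r x = i},
      testFun j ((s (n + 1)).map^[m n] x) * testFun k x) -
        r * (∫ x in {x | (s n).index r x = i}, testFun j x) *
          ∫ x in {x | (s n).index r x = i}, testFun k x) atTop (𝓝 0) := by
    have h3 : Tendsto (fun n => 10 * tol n) atTop (𝓝 0) := by simpa using tendsto_tol.const_mul 10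
    refine squeeze_zero_norm' ?_ h3
    filter_upwards [eventually_ge_atTop (max j k)] with n hn
    exact hmix n j ((le_max_left _ _).trans hn) k ((le_max_right _ _).trans hn) i
  have h3 := ((hs.tendsto_setIntegral i (htm j) (abs_testFun_le j)).const_mul (r : ℝ)).mul
    (hs.tendsto_setIntegral i (htm k) (abs_testFun_le k))
  have h4 := ((h3.add h2).sub h1).const_mul (r : ℝ)
  rw [add_zero, sub_zero] at h4
  have e : ∀ a b : ℝ, r * a * (r * b) = r * (r * a * b) := fun a b => by ring
  rw [e]
  refine h4.congr fun n => ?_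
  ring

end limit

/-! ### Approximation by conjugation -/

/-- Holomorphic lifts that form a Cauchy sequence, uniformly on a strip, converge to a holomorphic
lift of the pointwise limit of the torus maps. -/
theorem tendstoOnStrip_of_dist_le_tol {g : ℕ → Torus → Torus} {T : Torus → Torus}
    {G : ℕ → ℂ × ℂ → ℂ × ℂ} {ρ : ℝ} (hρ : 0 < ρ) (hG : ∀ n, IsHolomorphicLift ρ (g n) (G n))
    (hT : ∀ n x, dist (g n x) (T x) ≤ 2 * tol n)
    (h : ∀ n, ∀ z ∈ strip ρ, ‖G (n + 1) z - G n z‖ ≤ tol n) : TendstoOnStrip ρ g T := by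
  obtain ⟨L, hL⟩ := exists_limit_of_dist_le_tol (g := G) (S := strip ρ) fun n z hz => by
    rw [dist_comm, dist_eq_norm]
    exact h n z hz
  have hu := tendstoUniformlyOn_of_dist_le_tol hL
  refine ⟨G, L, hG, isHolomorphicLift_of_tendsto hρ hG (fun x => ?_) hu, hu⟩
  exact (tendstoUniformlyOn_of_dist_le_tol (S := univ) fun n x _ => hT n x).tendsto_at (mem_univ x)

theorem TendstoOnStrip.isAnalyticMap {ρ : ℝ} (hρ : 0 < ρ) {g : ℕ → Torus → Torus}
    {T : Torus → Torus} (h : TendstoOnStrip ρ g T) : IsAnalyticMap T := by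
  obtain ⟨G, L, hG, hL, hu⟩ := h
  exact isAnalyticMap_of_analyticOnNhd hρ (TendstoUniformlyOn.analyticOnNhd_complex_prod
    (isOpen_strip ρ) (fun n => (hG n).differentiableOn) hu) hL.lift

theorem TendstoOnStrip.comp_add_one {ρ : ℝ} {g : ℕ → Torus → Torus} {T : Torus → Torus}
    (h : TendstoOnStrip ρ g T) : TendstoOnStrip ρ (fun n => g (n + 1)) T := by
  obtain ⟨G, L, hG, hL, hu⟩ := h
  exact ⟨fun n => G (n + 1), L, fun n => hG _, hL,
    fun u hu' => (tendsto_add_atTop_nat 1).eventually (hu u hu')⟩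

section limit

variable {r : ℕ} [NeZero r] {f : ℕ → Torus → ℝ} {s : ℕ → Stage} {T : Torus ≃ₜ Torus}

theorem IsChain.tendstoOnStrip (hs : IsChain r f s)
    (hT : ∀ n x, dist ((s n).map x) (T x) ≤ 2 * tol n) :
    TendstoOnStrip 1 (fun n => (s n).map) T :=
  tendstoOnStrip_of_dist_le_tol one_pos
    (fun n => (hs.admissible n).isEntireLift_liftMap.isHolomorphicLift 1) hT
    fun n => (hs.step n).lift_near

theorem IsChain.tendstoOnStrip_symm (hs : IsChain r f s)
    (hT : ∀ n x, dist ((s n).map.symm x) (T.symm x) ≤ 2 * tol n) :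
    TendstoOnStrip 1 (fun n => (s n).map.symm) T.symm :=
  tendstoOnStrip_of_dist_le_tol one_pos
    (fun n => (hs.admissible n).isEntireLift_liftMap_symm.isHolomorphicLift 1) hT
    fun n => (hs.step n).lift_symm_near

/-- The conjugating maps `h n = (H n)⁻¹ ∘ H (n + 1)` telescope. -/
theorem IsChain.conjugacy_eq (hs : IsChain r f s) (n : ℕ) :
    conjugacy (fun n => (s n).H⁻¹ * (s (n + 1)).H) n = (s (n + 1)).H := by
  induction n with
  | zero => rw [conjugacy, hs.H_zero, inv_one, one_mul]
  | succ n ih => rw [conjugacy, ih, mul_inv_cancel_left]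

theorem IsChain.isApproximationByConjugation (hs : IsChain r f s)
    (hT : ∀ n x, dist ((s n).map x) (T x) ≤ 2 * tol n)
    (hT' : ∀ n x, dist ((s n).map.symm x) (T.symm x) ≤ 2 * tol n) :
    IsApproximationByConjugation T := by
  choose k hk hp hq using fun n => (hs.step n).rotation
  refine ⟨fun n => (s n).p, fun n => (s n).q, k, fun _ => 1, fun n => (s n).angle,
    fun n => (s n).H⁻¹ * (s (n + 1)).H, (hs.admissible 0).q_pos, hk, fun _ => one_pos,
    fun n => ?_, fun n => ?_, fun n => rfl, fun n => ?_, fun n => ?_, ?_⟩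
  · simp [hp n]
  · simp [hq n]
  · obtain ⟨F, F', hF⟩ := (hs.step n).isEntire
    exact hF.isAreaPreservingAnalyticDiffeo
  · obtain ⟨F, F', hF⟩ := (hs.step n).isEntire
    exact Homeomorph.ext fun x => hF.lift.apply_shift (s n).p x
  · simp only [hs.conjugacy_eq]
    exact ⟨1, one_pos, (hs.tendstoOnStrip hT).comp_add_one,
      (hs.tendstoOnStrip_symm hT').comp_add_one⟩

end limit

end Torus

end

theorem theoremB (r : ℕ) :
    ∃ T : Torus ≃ₜ Torus,
      Torus.IsAreaPreservingAnalyticDiffeo T ∧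
      Torus.IsApproximationByConjugation T ∧
      IsMinimalMap T ∧
      IsGenericMeasure T (volume : Measure Torus) ∧
      ∃ μ : Fin r → Measure Torus,
        Function.Injective μ ∧
        ∀ i, IsProbabilityMeasure (μ i) ∧ μ i ≪ (volume : Measure Torus) ∧
          IsWeaklyMixing T (μ i) := by
  -- one arc more than needed keeps the number of arcs positive
  obtain ⟨s, hs⟩ := Torus.exists_isChain (r + 1) Torus.continuous_testFun Torus.abs_testFun_le
  obtain ⟨T, hT, hT'⟩ := hs.exists_limit
  refine ⟨T, ⟨(hs.tendstoOnStrip hT).isAnalyticMap one_pos,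
    (hs.tendstoOnStrip_symm hT').isAnalyticMap one_pos,
    Torus.measurePreserving_of_limit (fun n => (hs.admissible n).measurePreserving_map) hT⟩,
    hs.isApproximationByConjugation hT hT', hs.isMinimalMap hT, ?_,
    fun i => Torus.limitMeasure (r + 1) s i.castSucc,
    hs.injective_limitMeasure.comp (Fin.castSucc_injective r), fun i =>
    ⟨hs.isProbabilityMeasure _, ?_, hs.isWeaklyMixing hT _⟩⟩
  · obtain ⟨x, hx⟩ := hs.exists_generic Torus.continuous_testFun hT
    exact Torus.isGenericMeasure_of_testFun hx
  · exact (Measure.restrict_le_self.absolutelyContinuous).smul_left _
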